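/- Let $a:(0,1]\to[0,\infty]$ be measurable and such that (i) for every $\epsilon>0$ there is $c(\epsilon)>0$ with $a(r)\ge c(\epsilon)$ and $a(r)^{-1}\ge c(\epsilon)$ for all $r\in(0,1]$ with $r>\epsilon$; (ii) $\int_0^1 \frac{a(r)}{r}\,dr<\infty$ and $\int_0^1\frac{r}{a(r)}\,dr<\infty$; (iii) there is $K>0$ such that $\frac1{\epsilon^2}\int_0^\epsilon a(r)^{-1}\,r\int_0^r\frac{a(s)}{s}\,ds\,dr<K$ for all $\epsilon\in(0,1)$. Define the weight $\rho$ on $\mathbb R^2$ by $\rho(x)=a(|x|)^{-1}$ if $|x|<1$ and $x_1x_2>0$, $\rho(x)=a(|x|)$ if $|x|<1$ and $x_1x_2<0$, and $\rho(x)=1$ otherwise, and let $\mu(dx)=\rho(x)\,dx$. Let $\mathcal E(u,v)=\int_{\mathbb R^2}\nabla u\cdot\nabla v\,d\mu$ and $\mathcal E_1(u,v)=\mathcal E(u,v)+\int_{\mathbb R^2} uv\,d\mu$, let $\mathcal W=\{u\in W^{1,1}_{\rm loc}(\mathbb R^2):\mathcal E_1(u,u)<\infty\}$, and let $\mathcal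 H$ be the closure of $C_0^\infty(\mathbb R^2)$ in $(\mathcal W,\mathcal E_1)$. Let $\psi_0(x)=(1-|x|^2)_+\,\psi(x)$ for $x\in\mathbb R^2\setminus\{0\}$, where $\psi(x)$ equals $1$, $x_2/|x|$, $0$, $x_1/|x|$ on the first, second, third and fourth quadrant respectively. Let $\mathcal O_\Theta=(0,\pi/2)$ and let $\mathbb R^2_{\mathcal W}$ be the disjoint union of $\mathbb R^2\setminus\{0\}$, two points $0_+,0_-$ and $\mathcal O_\Theta$. Let $\pi:\mathbb R^2_{\mathcal W}\to\mathbb R^2$ be the identity on $\mathbb R^2\setminus\{0\}$ and $0$ on the added points, and extend $\psi_0$ by $\psi_0(0_+)=1$, $\psi_0(0_-)=0$, $\psi_0(z)=\sin z$ for $z\in\mathcal O_\Theta$. Equip $\mathbb R^2_{\mathcal W}$ with the metric $d_{\mathcal W}(x,y)=|\pi(x)-\pi(y)|+|\psi_0(x)-\psi_0(y)|$ and extend $\mu$ to its Borel sets by giving mass $0$ to $\{0_+,0_-\}\cup\mathcal O_\Theta$. Identifying functions on $\mathbb R^2_{\mathcal W}$ and on $\mathbb R^2$ that agree on $\mathbb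 R^2\setminus\{0\}$, regard $(\mathcal E,\mathcal W)$ also as a form on $L^2(\mathbb R^2_{\mathcal W},\mu)$. For a form $(\mathcal E,\mathcal F)$ on $L^2(E,m)$ and an open set $A\subset E$ put $\mathrm{Cap}_1(A)=\inf\{\mathcal E_1(u,u):u\in\mathcal F,\ u\ge1\ m\text{-a.e. on }A\}$ (with $\inf\emptyset=\infty$), and for arbitrary $B\subset E$ put $\mathrm{Cap}_1(B)=\inf\{\mathrm{Cap}_1(A):A\supset B\text{ open}\}$. Let $\mathrm{Cap}_1$ denote the capacity of $(\mathcal E,\mathcal H)$ on $L^2(\mathbb R^2,\mu)$ and $\mathrm{Cap}_1^{\mathcal W}$ that of $(\mathcal E,\mathcal W)$ on $L^2(\mathbb R^2_{\mathcal W},\mu)$. Then 1. $\mathrm{Cap}_1^{\mathcal W}(\mathcal O_\Theta)=0$; 2. $\mathrm{Cap}_1^{\mathcal W}(\{0_+,0_-\})=\mathrm{Cap}_1(\{0\})$; 3. $\mathrm{Cap}_1^{\mathcal W}(\{0_+\})=\mathrm{Cap}_1^{\mathcal W}(\{0_-\})>0$. -/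

import Mathlib

open MeasureTheory Set
open scoped ENNReal

namespace Zhikov

noncomputable section

/-- The Euclidean plane. The coordinates of `x` are `x 0` (horizontal) and `x 1` (vertical). -/
abbrev Plane : Type := EuclideanSpace ℝ (Fin 2)

/-! ### The weight -/

/-- The standing assumptions on the radial profile `a : (0,1] → [0,∞]`; only the values of `a`
on `(0,1]` matter. Products, quotients and integrals are taken in `[0,∞]`. -/
structure IsAdmissible (a : ℝ → ℝ≥0∞) : Prop where
  measurable : Measurable fun r : Ioc (0 : ℝ) 1 => a r
  nondegenerate : ∀ ε : ℝ, 0 < ε → ∃ c : ℝ, 0 < c ∧ ∀ r ∈ Ioc (0 : ℝ) 1, ε < r →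
    ENNReal.ofReal c ≤ a r ∧ ENNReal.ofReal c ≤ (a r)⁻¹
  integrable_div : ∫⁻ r in Ioc (0 : ℝ) 1, a r / ENNReal.ofReal r < ⊤
  integrable_inv : ∫⁻ r in Ioc (0 : ℝ) 1, ENNReal.ofReal r / a r < ⊤
  rank_one : ∃ K : ℝ, 0 < K ∧ ∀ ε ∈ Ioo (0 : ℝ) 1,
    (ENNReal.ofReal (ε ^ 2))⁻¹ *
      (∫⁻ r in Ioc (0 : ℝ) ε, (a r)⁻¹ * ENNReal.ofReal r *
        ∫⁻ s in Ioc (0 : ℝ) r, a s / ENNReal.ofReal s) < ENNReal.ofReal K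

open Classical in
/-- The weight `ρ`: it is `1 / a(|x|)` on the first and third quadrants of the unit ball, `a(|x|)`
on the second and fourth quadrants of the unit ball, and `1` elsewhere. -/
def weight (a : ℝ → ℝ≥0∞) (x : Plane) : ℝ≥0∞ :=
  if ‖x‖ < 1 ∧ 0 < x 0 * x 1 then (a ‖x‖)⁻¹
  else if ‖x‖ < 1 ∧ x 0 * x 1 < 0 then a ‖x‖
  else 1

/-- The measure `μ = ρ dx` on the plane. -/
def mu (a : ℝ → ℝ≥0∞) : Measure Plane := volume.withDensity (weight a)

/-! ### The weighted Sobolev space and its subspace generated by test functions -/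

/-- Smooth functions with compact support on the plane. -/
def TestFunctions : Set (Plane → ℝ) := {φ | ContDiff ℝ (⊤ : ℕ∞) φ ∧ HasCompactSupport φ}

/-- `u` is locally integrable and `g` is its locally integrable weak gradient (with respect to
Lebesgue measure). -/
def HasWeakGradient (u : Plane → ℝ) (g : Plane → Plane) : Prop :=
  LocallyIntegrable u ∧ LocallyIntegrable g ∧
    ∀ φ ∈ TestFunctions, ∀ i : Fin 2,
      ∫ x, u x * fderiv ℝ φ x (EuclideanSpace.single i 1) = -∫ x, g x i * φ x

/-- The space `W^{1,1}_loc` of the plane. -/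
def SobolevLoc : Set (Plane → ℝ) := {u | ∃ g, HasWeakGradient u g}

open Classical in
/-- The weak gradient of a function in `W^{1,1}_loc`; it is unique up to Lebesgue-null sets. -/
def weakGradient (u : Plane → ℝ) : Plane → Plane :=
  if h : ∃ g, HasWeakGradient u g then h.choose else 0

/-- The form `𝓔(u,v) = ∫ ∇u · ∇v dμ`. -/
def energy (μ : Measure Plane) (u v : Plane → ℝ) : ℝ :=
  ∫ x, inner ℝ (weakGradient u x) (weakGradient v x) ∂μ

/-- For a form `E` on functions over `(X, m)`, the form `E_1(u,v) = E(u,v) + ∫ u v dm`. -/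
def formOne {X : Type*} [MeasurableSpace X] (m : Measure X)
    (E : (X → ℝ) → (X → ℝ) → ℝ) (u v : X → ℝ) : ℝ :=
  E u v + ∫ x, u x * v x ∂m

/-- The weighted Sobolev space `𝓦`: the functions `u` in `W^{1,1}_loc` with
`∫ |u|² dμ + ∫ |∇u|² dμ < ∞`. Elements are functions; the set is invariant under changes on
null sets. -/
def spaceW (μ : Measure Plane) : Set (Plane → ℝ) :=
  {u | u ∈ SobolevLoc ∧ MemLp u 2 μ ∧ MemLp (weakGradient u) 2 μ}

/-- The space `𝓗`: the closure of the smooth compactly supported functions in `(𝓦, 𝓔_1)`. -/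
def spaceH (μ : Measure Plane) : Set (Plane → ℝ) :=
  {u | u ∈ spaceW μ ∧ ∀ ε : ℝ, 0 < ε → ∃ φ ∈ TestFunctions,
    φ ∈ spaceW μ ∧ formOne μ (energy μ) (u - φ) (u - φ) < ε}

/-! ### Capacity -/

/-- The 1-capacity of an open set `A` for the form `E` with domain `F` on `L²(X, m)`: the infimum
of `E_1(u,u)` over the `u ∈ F` with `u ≥ 1` `m`-a.e. on `A` (it is `∞` if there is no such `u`). -/
def capOpen {X : Type*} [MeasurableSpace X] (m : Measure X)
    (E : (X → ℝ) → (X → ℝ) → ℝ) (F : Set (X → ℝ)) (A : Set X) : ℝ≥0∞ :=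
  ⨅ u ∈ {u | u ∈ F ∧ ∀ᵐ x ∂m, x ∈ A → 1 ≤ u x}, ENNReal.ofReal (formOne m E u u)

/-- The 1-capacity of an arbitrary set: the infimum of the capacities of its open supersets. -/
def cap {X : Type*} [TopologicalSpace X] [MeasurableSpace X] (m : Measure X)
    (E : (X → ℝ) → (X → ℝ) → ℝ) (F : Set (X → ℝ)) (B : Set X) : ℝ≥0∞ :=
  ⨅ A ∈ {A : Set X | IsOpen A ∧ B ⊆ A}, capOpen m E F A

/-! ### The split plane -/

/-- The set underlying the split plane `ℝ²_𝓦`: the disjoint union of the punctured plane, of the two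
points `0₊`, `0₋` and of the arc `O_Θ = (0, π/2)`. -/
inductive SplitPlane : Type
  | punctured (x : {x : Plane // x ≠ 0}) : SplitPlane
  | plus : SplitPlane
  | minus : SplitPlane
  | arc (z : Ioo (0 : ℝ) (Real.pi / 2)) : SplitPlane

namespace SplitPlane

/-- The projection of the split plane onto the plane, collapsing all added points to the origin. -/
def proj : SplitPlane → Plane
  | punctured x => x
  | plus => 0
  | minus => 0
  | arc _ => 0

end SplitPlane

open Classical in
/-- The function `ψ`, equal to `1`, `x₂/|x|`, `0`, `x₁/|x|` on the four quadrants. -/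
def psi (x : Plane) : ℝ :=
  if 0 ≤ x 0 then (if 0 ≤ x 1 then 1 else x 0 / ‖x‖)
  else (if 0 ≤ x 1 then x 1 / ‖x‖ else 0)

namespace SplitPlane

/-- The function `ψ₀(x) = (1 - |x|²)₊ ψ(x)`, extended to the split plane. -/
def psiZero : SplitPlane → ℝ
  | punctured x => max (1 - ‖(x : Plane)‖ ^ 2) 0 * psi x
  | plus => 1
  | minus => 0
  | arc z => Real.sin z

theorem eq_of_proj_eq_of_psiZero_eq {p q : SplitPlane} (h : proj p = proj q)
    (h' : psiZero p = psiZero q) : p = q := by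
  have sin_pos : ∀ z : Ioo (0 : ℝ) (Real.pi / 2), 0 < Real.sin z := fun z =>
    Real.sin_pos_of_pos_of_lt_pi z.2.1 (by linarith [z.2.2, Real.pi_pos])
  have sin_lt : ∀ z : Ioo (0 : ℝ) (Real.pi / 2), Real.sin z < 1 := fun z => by
    have := Real.sin_lt_sin_of_lt_of_le_pi_div_two (x := z) (y := Real.pi / 2)
      (by linarith [z.2.1, Real.pi_pos]) le_rfl z.2.2
    simpa using this
  cases p with
  | punctured x =>
    cases q with
    | punctured y => exact congrArg punctured (Subtype.ext h)
    | plus => exact absurd h x.2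
    | minus => exact absurd h x.2
    | arc w => exact absurd h x.2
  | plus =>
    cases q with
    | punctured y => exact absurd h.symm y.2
    | plus => rfl
    | minus => simp [psiZero] at h'
    | arc w => exact absurd h'.symm (sin_lt w).ne
  | minus =>
    cases q with
    | punctured y => exact absurd h.symm y.2
    | plus => simp [psiZero] at h'
    | minus => rfl
    | arc w => exact absurd h' (sin_pos w).ne
  | arc z =>
    cases q with
    | punctured y => exact absurd h.symm y.2
    | plus => exact absurd h' (sin_lt z).ne
    | minus => exact absurd h'.symm (sin_pos z).ne
    | arc w =>
      refine congrArg arc (Subtype.ext ?_)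
      refine Real.injOn_sin ?_ ?_ h'
      · exact ⟨by linarith [z.2.1, Real.pi_pos], z.2.2.le⟩
      · exact ⟨by linarith [w.2.1, Real.pi_pos], w.2.2.le⟩

/-- The metric `d_𝓦(p,q) = |π(p) - π(q)| + |ψ₀(p) - ψ₀(q)|`, with its topology. -/
instance : MetricSpace SplitPlane where
  dist p q := ‖proj p - proj q‖ + |psiZero p - psiZero q|
  dist_self p := by simp
  dist_comm p q := by rw [norm_sub_rev, abs_sub_comm]
  dist_triangle p q r := by
    have h1 := norm_sub_le_norm_sub_add_norm_sub (proj p) (proj q) (proj r)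
    have h2 := abs_sub_le (psiZero p) (psiZero q) (psiZero r)
    linarith
  eq_of_dist_eq_zero {p q} h := by
    have h1 := norm_nonneg (proj p - proj q)
    have h2 := abs_nonneg (psiZero p - psiZero q)
    have h3 : ‖proj p - proj q‖ + |psiZero p - psiZero q| = 0 := h
    refine eq_of_proj_eq_of_psiZero_eq ?_ ?_
    · exact sub_eq_zero.1 (norm_eq_zero.1 (by linarith))
    · exact sub_eq_zero.1 (abs_eq_zero.1 (by linarith))

theorem dist_def (p q : SplitPlane) :
    dist p q = ‖proj p - proj q‖ + |psiZero p - psiZero q| := rfl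

instance : MeasurableSpace SplitPlane := borel SplitPlane

instance : BorelSpace SplitPlane := ⟨rfl⟩

end SplitPlane

theorem psi_eq {x : Plane} (hx : x ≠ 0) :
    psi x = √(max (x 0) 0 ^ 2 + max (x 1) 0 ^ 2) / ‖x‖ := by
  have hn : ‖x‖ ≠ 0 := norm_ne_zero_iff.2 hx
  have hnorm : ‖x‖ = √(x 0 ^ 2 + x 1 ^ 2) := by
    rw [EuclideanSpace.norm_eq, Fin.sum_univ_two]; simp
  unfold psi
  by_cases h0 : 0 ≤ x 0 <;> by_cases h1 : 0 ≤ x 1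
  · rw [if_pos h0, if_pos h1, max_eq_left h0, max_eq_left h1, ← hnorm, div_self hn]
  · rw [if_pos h0, if_neg h1, max_eq_left h0, max_eq_right (not_le.1 h1).le]
    simp [Real.sqrt_sq h0]
  · rw [if_neg h0, if_pos h1, max_eq_left h1, max_eq_right (not_le.1 h0).le]
    simp [Real.sqrt_sq h1]
  · rw [if_neg h0, if_neg h1, max_eq_right (not_le.1 h0).le, max_eq_right (not_le.1 h1).le]
    simp

/-- The inclusion of the punctured plane into the split plane is continuous. -/
theorem continuous_punctured : Continuous SplitPlane.punctured := by
  have hpsi : Continuous fun x : {x : Plane // x ≠ 0} => psi x := by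
    have : (fun x : {x : Plane // x ≠ 0} => psi x) = fun x : {x : Plane // x ≠ 0} =>
        √(max ((x : Plane) 0) 0 ^ 2 + max ((x : Plane) 1) 0 ^ 2) / ‖(x : Plane)‖ :=
      funext fun x => psi_eq x.2
    rw [this]
    exact Continuous.div (by fun_prop) (by fun_prop) fun x => norm_ne_zero_iff.2 x.2
  have hzero : Continuous fun x => SplitPlane.psiZero (SplitPlane.punctured x) := by
    show Continuous fun x : {x : Plane // x ≠ 0} => max (1 - ‖(x : Plane)‖ ^ 2) 0 * psi x
    exact Continuous.mul (by fun_prop) hpsi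
  rw [continuous_iff_continuousAt]
  intro x
  rw [ContinuousAt, tendsto_iff_dist_tendsto_zero]
  have hc : Continuous fun y : {x : Plane // x ≠ 0} =>
      ‖(y : Plane) - x‖ + |SplitPlane.psiZero (.punctured y) - SplitPlane.psiZero (.punctured x)| :=
    Continuous.add (by fun_prop) ((hzero.sub continuous_const).abs)
  have h0 := hc.tendsto x
  simp only [sub_self, norm_zero, abs_zero, add_zero] at h0
  exact h0

/-- The measure on the split plane that extends `μ` from the punctured plane and gives mass zero to
the added points. -/
def muSplit (μ : Measure Plane) : Measure SplitPlane :=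
  (μ.comap ((↑) : {x : Plane // x ≠ 0} → Plane)).map SplitPlane.punctured

theorem muSplit_apply (μ : Measure Plane) {B : Set SplitPlane} (hB : MeasurableSet B) :
    muSplit μ B = μ (Subtype.val '' (SplitPlane.punctured ⁻¹' B)) := by
  rw [muSplit, Measure.map_apply continuous_punctured.measurable hB]
  exact (MeasurableEmbedding.subtype_coe (measurableSet_singleton (0 : Plane)).compl).comap_apply ..

open Classical in
/-- The identification of functions on the split plane with functions on the plane that agree with
them on the punctured plane (the value at the origin, a null set, is irrelevant). -/
def toPlane (v : SplitPlane → ℝ) (x : Plane) : ℝ :=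
  if h : x = 0 then 0 else v (.punctured ⟨x, h⟩)

/-- The space `𝓦`, realised as a space of functions on the split plane. -/
def spaceWSplit (μ : Measure Plane) : Set (SplitPlane → ℝ) := {v | toPlane v ∈ spaceW μ}

/-- The form `𝓔`, realised on functions on the split plane. -/
def energySplit (μ : Measure Plane) (v w : SplitPlane → ℝ) : ℝ :=
  energy μ (toPlane v) (toPlane w)

/-- The added arc `O_Θ`. -/
def arcSet : Set SplitPlane := range SplitPlane.arc

/-- The 1-capacity on the plane for the form `(𝓔, 𝓗)` on `L²(ℝ², μ)`. -/
def capH (a : ℝ → ℝ≥0∞) (B : Set Plane) : ℝ≥0∞ :=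
  cap (mu a) (energy (mu a)) (spaceH (mu a)) B

/-- The 1-capacity on the split plane for the form `(𝓔, 𝓦)` on `L²(ℝ²_𝓦, μ)`. -/
def capW (a : ℝ → ℝ≥0∞) (B : Set SplitPlane) : ℝ≥0∞ :=
  cap (muSplit (mu a)) (energySplit (mu a)) (spaceWSplit (mu a)) B

end

end Zhikov

namespace Zhikov

noncomputable section

open Filter Topology

/-! In polar coordinates the conditions on `a` say that `ρ` and `1/ρ` are integrable near the
origin, that `ρ/|x|²` is integrable on the second and fourth quadrants of the unit ball, and that
`1/ρ/|x|²` is integrable on the first and third. `IsSplitWeight` records these facts together with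
the evenness of `ρ` and its two-sided bounds away from the origin; the rest of the argument sees
only this.

The arc is negligible because bounded functions of the angle carried by the cheap quadrants (the
second and fourth) have gradient `O(1/|x|)`. Cut off at radius `2R`, such a function has energy at
most a constant times the integral of `ρ/|x|²` over a shrinking set, which tends to `0`
(`exists_sobolevEnergy_sector_lt`). The arc is covered by countably many neighbourhoods on each of
which one such function equals `1`. Since `L²(μ)` embeds in `L¹_loc`, the weighted Sobolev space is
complete, and a convergent sum of these functions dominates them all (`exists_upper_bound`).

For the fibre over the origin, one inequality is the pullback along the projection. For the other,
take a competitor for the two points and add a competitor of tiny energy for the arc. Together their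
neighbourhoods contain the whole fibre, a compact segment, hence a punctured ball
(`exists_ball_subset`). After truncation the sum can be taken equal to `1` near the origin, the only
singular point of the weight, so cutoff and mollification put it in the closure of the test
functions (`exists_testFunction_approx`).

The two points have equal capacity because `x ↦ -x` preserves `μ` and exchanges their
neighbourhoods. Positivity is a flux argument: a radial field in the first quadrant of size at most
`1/|x|` has nonnegative divergence near the origin, where a competitor is at least `1`, and a
divergence independent of the inner scale away from it. Integration by parts and Cauchy–Schwarz,
using that `1/ρ/|x|²` is integrable on that quadrant, bound the energy below uniformly
(`exists_lower_bound`). -/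

/-! ### Polar coordinates and integrability of the weight. -/

theorem lintegral_fun_norm {f : ℝ → ℝ≥0∞} (hf : Measurable f) :
    ∫⁻ x : Plane, f ‖x‖ = (volume : Measure Plane).toSphere univ *
      ∫⁻ r in Ioi (0 : ℝ), ENNReal.ofReal r * f r := by
  have hd : Module.finrank ℝ Plane - 1 = 1 := by simp
  have h1 : ∫⁻ x : Plane, f ‖x‖ =
      ∫⁻ x : ({0}ᶜ : Set Plane), f ‖(x : Plane)‖ ∂(Measure.comap Subtype.val volume) := by
    rw [lintegral_subtype_comap (measurableSet_singleton (0 : Plane)).compl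
      (fun x : Plane => f ‖x‖), restrict_compl_singleton]
  have hm : Measurable fun r : Ioi (0 : ℝ) => f r := hf.comp measurable_subtype_coe
  have h2 := (volume : Measure Plane).measurePreserving_homeomorphUnitSphereProd.lintegral_comp
    (f := fun p => f p.2.1) (hm.comp measurable_snd)
  have h3 : ∫⁻ x, f x.2.1 ∂(volume : Measure Plane).toSphere.prod
      (Measure.volumeIoiPow (Module.finrank ℝ Plane - 1)) =
      (volume : Measure Plane).toSphere univ *
        ∫⁻ x : Ioi (0 : ℝ), f x ∂(Measure.volumeIoiPow (Module.finrank ℝ Plane - 1)) := by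
    rw [lintegral_prod (fun x : Metric.sphere (0 : Plane) 1 × Ioi (0 : ℝ) => f x.2.1) (hm.comp measurable_snd).aemeasurable]
    simp [mul_comm]
  have h4 : ∫⁻ x : Ioi (0 : ℝ), f x ∂(Measure.volumeIoiPow (Module.finrank ℝ Plane - 1)) =
      ∫⁻ r in Ioi (0 : ℝ), ENNReal.ofReal r * f r := by
    rw [hd, Measure.volumeIoiPow, lintegral_withDensity_eq_lintegral_mul _ (by fun_prop) hm,
      ← lintegral_subtype_comap measurableSet_Ioi]
    simp
  rw [h1, ← h4, ← h3, ← h2]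
  simp

/-- The properties of the weight of the split plane that the comparison of capacities uses. -/
structure IsSplitWeight (ρ : Plane → ℝ≥0∞) : Prop where
  measurable : Measurable ρ
  ne_zero : ∀ x, ρ x ≠ 0
  ne_top : ∀ x, ρ x ≠ ⊤
  map_neg : ∀ x, ρ (-x) = ρ x
  bounds : ∀ ε : ℝ, 0 < ε → ∃ c : ℝ, 0 < c ∧ ∀ x, ε < ‖x‖ →
    ENNReal.ofReal c ≤ ρ x ∧ ENNReal.ofReal c ≤ (ρ x)⁻¹
  lintegral_ball : ∫⁻ x in Metric.ball (0 : Plane) 1, ρ x < ⊤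
  lintegral_inv_ball : ∫⁻ x in Metric.ball (0 : Plane) 1, (ρ x)⁻¹ < ⊤
  lintegral_div_sq : ∫⁻ x in {x : Plane | ‖x‖ < 1 ∧ x 0 * x 1 < 0},
    ρ x * (ENNReal.ofReal (‖x‖ ^ 2))⁻¹ < ⊤
  lintegral_inv_div_sq : ∫⁻ x in {x : Plane | ‖x‖ < 1 ∧ 0 < x 0 * x 1},
    (ρ x)⁻¹ * (ENNReal.ofReal (‖x‖ ^ 2))⁻¹ < ⊤

open Classical in
/-- The radial profile, extended by `1` outside `(0, 1]`. -/
def profile (a : ℝ → ℝ≥0∞) (r : ℝ) : ℝ≥0∞ := if r ∈ Ioc (0 : ℝ) 1 then a r else 1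

/-- Admissibility gives measurability only on the subtype `Ioc 0 1`, while the polar formula needs a
measurable function on `ℝ`. -/
theorem IsAdmissible.measurable_profile {a : ℝ → ℝ≥0∞} (ha : IsAdmissible a) :
    Measurable (profile a) := by
  refine measurable_of_restrict_of_restrict_compl (measurableSet_Ioc (a := (0 : ℝ)) (b := 1)) ?_ ?_
  · convert ha.measurable using 1
    ext r
    simp only [domRestrict_apply, profile, if_pos r.2]
  · convert (measurable_const : Measurable fun _ : ((Ioc (0 : ℝ) 1)ᶜ : Set ℝ) => (1 : ℝ≥0∞)) using 1
    ext r
    have := r.2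
    simp only [domRestrict_apply, profile, if_neg (show ¬ ((r : ℝ) ∈ Ioc (0 : ℝ) 1) from r.2)]

theorem IsAdmissible.ne_zero {a : ℝ → ℝ≥0∞} (ha : IsAdmissible a) {r : ℝ}
    (hr : r ∈ Ioc (0 : ℝ) 1) : a r ≠ 0 := by
  obtain ⟨c, hc, h⟩ := ha.nondegenerate (r / 2) (by linarith [hr.1])
  have := (h r hr (by linarith [hr.1])).1
  intro h0
  rw [h0] at this
  simp at this
  linarith

theorem IsAdmissible.ne_top {a : ℝ → ℝ≥0∞} (ha : IsAdmissible a) {r : ℝ}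
    (hr : r ∈ Ioc (0 : ℝ) 1) : a r ≠ ⊤ := by
  obtain ⟨c, hc, h⟩ := ha.nondegenerate (r / 2) (by linarith [hr.1])
  have := (h r hr (by linarith [hr.1])).2
  intro h0
  rw [h0] at this
  simp at this
  linarith

/-- Nested cases with a globally measurable radial part make `Measurable.ite` applicable. Off the
axes `x ≠ 0`, so the value of `profile` at radius `0` plays no role. -/
theorem weight_eq_profile (a : ℝ → ℝ≥0∞) (x : Plane) :
    weight a x = if 0 < x 0 * x 1 then (if ‖x‖ < 1 then (profile a ‖x‖)⁻¹ else 1)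
      else if x 0 * x 1 < 0 then (if ‖x‖ < 1 then profile a ‖x‖ else 1) else 1 := by
  have hp : x 0 * x 1 ≠ 0 → ‖x‖ < 1 → profile a ‖x‖ = a ‖x‖ := by
    intro h h1
    have : x ≠ 0 := by rintro rfl; simp at h
    rw [profile, if_pos ⟨norm_pos_iff.2 this, h1.le⟩]
  unfold weight
  by_cases h1 : ‖x‖ < 1
  · by_cases h2 : 0 < x 0 * x 1
    · simp [h1, h2, hp h2.ne' h1]
    · by_cases h3 : x 0 * x 1 < 0
      · simp [h1, h2, h3, hp h3.ne h1]
      · simp [h2, h3]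
  · simp [h1]

theorem lintegral_ball_fun_norm_lt_top (g : ℝ → ℝ≥0∞) (hg : Measurable g)
    (h : ∫⁻ r in Ioc (0 : ℝ) 1, ENNReal.ofReal r * g r < ⊤) :
    ∫⁻ x in Metric.ball (0 : Plane) 1, g ‖x‖ < ⊤ := by
  have h1 : ∫⁻ x in Metric.ball (0 : Plane) 1, g ‖x‖ =
      ∫⁻ x : Plane, (Iio (1 : ℝ)).indicator g ‖x‖ := by
    rw [← lintegral_indicator Metric.isOpen_ball.measurableSet]
    refine lintegral_congr fun x => ?_
    simp [indicator]
  rw [h1, lintegral_fun_norm (hg.indicator measurableSet_Iio)]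
  refine ENNReal.mul_lt_top (measure_lt_top _ _) (lt_of_le_of_lt ?_ h)
  rw [← lintegral_indicator measurableSet_Ioi, ← lintegral_indicator measurableSet_Ioc]
  refine lintegral_mono fun r => ?_
  by_cases h0 : 0 < r
  · by_cases h1 : r < 1
    · simp [indicator, h0, h1, h1.le]
    · simp [indicator, h1]
  · simp [indicator, h0]

theorem IsAdmissible.isSplitWeight {a : ℝ → ℝ≥0∞} (ha : IsAdmissible a) :
    IsSplitWeight (weight a) := by
  have hpm := ha.measurable_profile
  have hm0 : Measurable fun x : Plane => x 0 * x 1 := by fun_prop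
  have hmea : Measurable (weight a) := by
    rw [funext (weight_eq_profile a)]
    have hn : MeasurableSet {x : Plane | ‖x‖ < 1} := measurableSet_lt measurable_norm measurable_const
    refine Measurable.ite (measurableSet_lt measurable_const hm0)
      (Measurable.ite hn (hpm.comp measurable_norm).inv measurable_const)
      (Measurable.ite (measurableSet_lt hm0 measurable_const)
      (Measurable.ite hn (hpm.comp measurable_norm) measurable_const) measurable_const)
  have hp0 : ∀ r, profile a r ≠ 0 := fun r => by
    unfold profile
    split_ifs with h
    · exact ha.ne_zero h
    · simp
  have hpt : ∀ r, profile a r ≠ ⊤ := fun r => by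
    unfold profile
    split_ifs with h
    · exact ha.ne_top h
    · simp
  have hI : ∀ r ∈ Ioc (0 : ℝ) 1, profile a r = a r := fun r hr => if_pos hr
  have hball : MeasurableSet (Metric.ball (0 : Plane) 1) := Metric.isOpen_ball.measurableSet
  have hs : Measurable fun r : ℝ => (ENNReal.ofReal (r ^ 2))⁻¹ := by fun_prop
  -- The Jacobian `r` turns `a(r)/r²` into `a(r)/r`. This one integral serves both quadrant
  -- conditions, because `ρ = a` on the even quadrants and `1/ρ = a` on the odd ones.
  have hA2 : ∫⁻ x in Metric.ball (0 : Plane) 1, profile a ‖x‖ * (ENNReal.ofReal (‖x‖ ^ 2))⁻¹ < ⊤ := by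
    refine lintegral_ball_fun_norm_lt_top (fun r => profile a r * (ENNReal.ofReal (r ^ 2))⁻¹)
      (hpm.mul hs) (lt_of_le_of_lt (setLIntegral_mono' measurableSet_Ioc fun r hr => ?_)
        ha.integrable_div)
    rw [hI r hr, pow_two, ENNReal.ofReal_mul hr.1.le,
      ENNReal.mul_inv (by simp [hr.1]) (by simp), div_eq_mul_inv, mul_left_comm, ← mul_assoc (ENNReal.ofReal r),
      ENNReal.mul_inv_cancel (by simp [hr.1]) (by simp), one_mul]
  have hA : ∫⁻ x in Metric.ball (0 : Plane) 1, profile a ‖x‖ < ⊤ := by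
    refine lt_of_le_of_lt (setLIntegral_mono' hball fun x hx => ?_) hA2
    refine le_mul_of_one_le_right (by simp) (ENNReal.one_le_inv.2 (ENNReal.ofReal_le_one.2 ?_))
    have : ‖x‖ < 1 := by simpa using hx
    nlinarith [norm_nonneg x]
  have hB : ∫⁻ x in Metric.ball (0 : Plane) 1, (profile a ‖x‖)⁻¹ < ⊤ := by
    refine lintegral_ball_fun_norm_lt_top (fun r => (profile a r)⁻¹) hpm.inv
      (lt_of_le_of_lt (setLIntegral_mono' measurableSet_Ioc fun r hr => ?_) ha.integrable_inv)
    rw [hI r hr, div_eq_mul_inv]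
  have hvol : ∫⁻ x in Metric.ball (0 : Plane) 1, (1 : ℝ≥0∞) < ⊤ := by
    simp
  -- A common majorant of `ρ` and `1/ρ` on the ball.
  have hsum : ∫⁻ x in Metric.ball (0 : Plane) 1,
      (profile a ‖x‖ + (profile a ‖x‖)⁻¹ + 1) < ⊤ := by
    have m1 : Measurable fun x : Plane => profile a ‖x‖ := hpm.comp measurable_norm
    rw [lintegral_add_right _ measurable_const, lintegral_add_left m1]
    simp only [ENNReal.add_lt_top]
    exact ⟨⟨hA, hB⟩, hvol⟩
  refine ⟨hmea, ?_, ?_, ?_, ?_, lt_of_le_of_lt (lintegral_mono fun x => ?_) hsum,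
    lt_of_le_of_lt (lintegral_mono fun x => ?_) hsum, ?_, ?_⟩
  · intro x
    rw [weight_eq_profile]
    split_ifs <;> simp [hp0, hpt]
  · intro x
    rw [weight_eq_profile]
    split_ifs <;> simp [hp0, hpt]
  · intro x
    simp [weight]
  · intro ε hε
    obtain ⟨c, hc, h⟩ := ha.nondegenerate ε hε
    refine ⟨min c 1, by positivity, fun x hx => ?_⟩
    have hc1 : ENNReal.ofReal (min c 1) ≤ ENNReal.ofReal c :=
      ENNReal.ofReal_le_ofReal (min_le_left _ _)
    unfold weight
    split_ifs with h1 h2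
    · have := h ‖x‖ ⟨hε.trans hx, h1.1.le⟩ hx
      rw [inv_inv]
      exact ⟨hc1.trans this.2, hc1.trans this.1⟩
    · have := h ‖x‖ ⟨hε.trans hx, h2.1.le⟩ hx
      exact ⟨hc1.trans this.1, hc1.trans this.2⟩
    · simp
  · rw [weight_eq_profile]
    split_ifs
    · exact le_add_right le_add_self
    · exact le_add_self
    · exact le_add_right le_self_add
    · exact le_add_self
    · exact le_add_self
  · rw [weight_eq_profile]
    split_ifs
    · rw [inv_inv]; exact le_add_right le_self_add
    · simp
    · exact le_add_right le_add_self
    · simp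
    · simp
  · refine lt_of_le_of_lt (setLIntegral_mono' (s := {x : Plane | ‖x‖ < 1 ∧ x 0 * x 1 < 0})
      (g := fun x => profile a ‖x‖ * (ENNReal.ofReal (‖x‖ ^ 2))⁻¹) ?_
      fun x hx => ?_) (lt_of_le_of_lt (lintegral_mono_set fun x hx => ?_) hA2)
    · exact (measurableSet_lt measurable_norm measurable_const).inter
        (measurableSet_lt hm0 measurable_const)
    · rw [weight_eq_profile, if_neg (not_lt.2 hx.2.le), if_pos hx.2, if_pos hx.1]
    · simpa using hx.1
  · refine lt_of_le_of_lt (setLIntegral_mono' (s := {x : Plane | ‖x‖ < 1 ∧ 0 < x 0 * x 1})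
      (g := fun x => profile a ‖x‖ * (ENNReal.ofReal (‖x‖ ^ 2))⁻¹) ?_
      fun x hx => ?_) (lt_of_le_of_lt (lintegral_mono_set fun x hx => ?_) hA2)
    · exact (measurableSet_lt measurable_norm measurable_const).inter
        (measurableSet_lt measurable_const hm0)
    · rw [weight_eq_profile, if_pos hx.2, if_pos hx.1, inv_inv]
    · simpa using hx.1

/-! ### Local integrability and weighted Cauchy–Schwarz. -/

namespace IsSplitWeight

variable {ρ : Plane → ℝ≥0∞}

theorem lintegral_compact (hρ : IsSplitWeight ρ) {K : Set Plane} (hK : IsCompact K) :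
    ∫⁻ x in K, ρ x < ⊤ ∧ ∫⁻ x in K, (ρ x)⁻¹ < ⊤ := by
  obtain ⟨c, hc, h⟩ := hρ.bounds (1 / 2) (by norm_num)
  have hsub : K ⊆ Metric.ball 0 1 ∪ K \ Metric.ball 0 1 := by
    intro x hx
    by_cases h : x ∈ Metric.ball (0 : Plane) 1
    · exact Or.inl h
    · exact Or.inr ⟨hx, h⟩
  have hc' : ENNReal.ofReal c ≠ 0 := by simpa using hc
  have hfin : ∫⁻ x in K \ Metric.ball 0 1, (ENNReal.ofReal c)⁻¹ < ⊤ := by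
    rw [setLIntegral_const]
    exact ENNReal.mul_lt_top (by simpa using hc)
      (lt_of_le_of_lt (measure_mono sdiff_subset) hK.measure_lt_top)
  have hms : MeasurableSet (K \ Metric.ball 0 1) :=
    hK.measurableSet.diff Metric.isOpen_ball.measurableSet
  have hn : ∀ x ∈ K \ Metric.ball 0 1, (1 / 2 : ℝ) < ‖x‖ := by
    intro x hx
    have : ¬ ‖x‖ < 1 := by simpa using hx.2
    linarith
  constructor
  · refine lt_of_le_of_lt (lintegral_mono_set hsub) (lt_of_le_of_lt (lintegral_union_le _ _ _) ?_)
    refine ENNReal.add_lt_top.2 ⟨hρ.lintegral_ball, lt_of_le_of_lt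
      (setLIntegral_mono' hms fun x hx => ?_) hfin⟩
    exact ENNReal.le_inv_iff_le_inv.1 (h x (hn x hx)).2
  · refine lt_of_le_of_lt (lintegral_mono_set hsub) (lt_of_le_of_lt (lintegral_union_le _ _ _) ?_)
    refine ENNReal.add_lt_top.2 ⟨hρ.lintegral_inv_ball, lt_of_le_of_lt
      (setLIntegral_mono' hms fun x hx => ?_) hfin⟩
    exact ENNReal.inv_le_inv.2 (h x (hn x hx)).1

/-- Cauchy–Schwarz for the splitting `f g = (f ρ^{1/2}) (g ρ^{-1/2})`, legitimate because `ρ` is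
nowhere `0` or `∞`. -/
theorem lintegral_mul_le (hρ : IsSplitWeight ρ) {f g : Plane → ℝ≥0∞} (hf : AEMeasurable f)
    (hg : AEMeasurable g) :
    ∫⁻ x, f x * g x ≤ (∫⁻ x, f x ^ 2 ∂(volume.withDensity ρ)) ^ (1 / 2 : ℝ) *
      (∫⁻ x, g x ^ 2 * (ρ x)⁻¹) ^ (1 / 2 : ℝ) := by
  have hr : AEMeasurable fun x => ρ x ^ (1 / 2 : ℝ) := (hρ.measurable.pow_const _).aemeasurable
  have hr' : AEMeasurable fun x => (ρ x ^ (1 / 2 : ℝ))⁻¹ :=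
    (hρ.measurable.pow_const _).inv.aemeasurable
  have key := ENNReal.lintegral_mul_le_Lp_mul_Lq volume (p := 2) (q := 2)
    (Real.HolderConjugate.two_two) (hf.mul hr) (hg.mul hr')
  have hsq : ∀ x, (ρ x ^ (1 / 2 : ℝ)) ^ (2 : ℝ) = ρ x := fun x => by
    rw [← ENNReal.rpow_mul]; norm_num
  convert key using 2
  · ext x
    have h0 : ρ x ^ (1 / 2 : ℝ) ≠ 0 := by simp [hρ.ne_zero x, hρ.ne_top x]
    have ht : ρ x ^ (1 / 2 : ℝ) ≠ ⊤ := by simp [hρ.ne_zero x, hρ.ne_top x]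
    simp only [Pi.mul_apply]
    rw [mul_mul_mul_comm, ENNReal.mul_inv_cancel h0 ht, mul_one]
  · congr 1
    rw [lintegral_withDensity_eq_lintegral_mul₀ hρ.measurable.aemeasurable (hf.pow_const _)]
    refine lintegral_congr fun x => ?_
    simp only [Pi.mul_apply]
    rw [ENNReal.mul_rpow_of_nonneg _ _ (by norm_num), hsq, mul_comm]
    norm_cast
  · congr 1
    refine lintegral_congr fun x => ?_
    simp only [Pi.mul_apply]
    rw [ENNReal.mul_rpow_of_nonneg _ _ (by norm_num), ENNReal.inv_rpow, hsq]
    norm_cast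

end IsSplitWeight

/-! ### Calculus of weak gradients -/

theorem gradient_coord (u : Plane → ℝ) (x : Plane) (i : Fin 2) :
    gradient u x i = fderiv ℝ u x (EuclideanSpace.single i 1) := by
  have : inner ℝ (gradient u x) (EuclideanSpace.single i (1 : ℝ)) =
      fderiv ℝ u x (EuclideanSpace.single i 1) := by
    simp [gradient]
  rw [← this, EuclideanSpace.inner_single_right]
  simp

theorem norm_gradient (u : Plane → ℝ) (x : Plane) : ‖gradient u x‖ = ‖fderiv ℝ u x‖ := by
  simp [gradient]

theorem continuous_gradient {u : Plane → ℝ} (hu : ContDiff ℝ 1 u) : Continuous (gradient u) :=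
  (LinearIsometryEquiv.continuous _).comp (hu.continuous_fderiv one_ne_zero)

theorem continuous_partial {φ : Plane → ℝ} (hφ : ContDiff ℝ 1 φ) (v : Plane) :
    Continuous fun x => fderiv ℝ φ x v :=
  (hφ.continuous_fderiv one_ne_zero).clm_apply continuous_const

theorem TestFunctions.contDiff {φ : Plane → ℝ} (hφ : φ ∈ TestFunctions) : ContDiff ℝ 1 φ :=
  hφ.1.of_le (by exact_mod_cast le_top)

theorem TestFunctions.continuous {φ : Plane → ℝ} (hφ : φ ∈ TestFunctions) : Continuous φ :=
  hφ.1.continuous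

theorem TestFunctions.mul {χ φ : Plane → ℝ} (hχ : ContDiff ℝ (⊤ : ℕ∞) χ)
    (hφ : φ ∈ TestFunctions) : (fun x => χ x * φ x) ∈ TestFunctions :=
  ⟨hχ.mul hφ.1, hφ.2.mul_left⟩

theorem hasCompactSupport_partial {φ : Plane → ℝ} (hφ : HasCompactSupport φ) (v : Plane) :
    HasCompactSupport fun x => fderiv ℝ φ x v :=
  hφ.fderiv_apply ℝ v

theorem integrable_mul_of_hasCompactSupport {f ψ : Plane → ℝ} (hf : LocallyIntegrable f)
    (hψ : Continuous ψ) (hc : HasCompactSupport ψ) : Integrable fun x => f x * ψ x :=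
  hf.integrable_smul_right_of_hasCompactSupport hψ hc

theorem LocallyIntegrable.coord {g : Plane → Plane} (hg : LocallyIntegrable g) (i : Fin 2) :
    LocallyIntegrable fun x => g x i := by
  intro x
  obtain ⟨s, hs, h⟩ := hg x
  exact ⟨s, hs, (EuclideanSpace.proj (𝕜 := ℝ) i).integrable_comp h⟩

namespace HasWeakGradient

variable {u v : Plane → ℝ} {g k : Plane → Plane}

theorem integrable_mul_partial (h : HasWeakGradient u g) {φ : Plane → ℝ} (hφ : φ ∈ TestFunctions)
    (w : Plane) : Integrable fun x => u x * fderiv ℝ φ x w :=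
  integrable_mul_of_hasCompactSupport h.1 (continuous_partial (TestFunctions.contDiff hφ) w)
    (hasCompactSupport_partial hφ.2 w)

theorem integrable_coord_mul (h : HasWeakGradient u g) {φ : Plane → ℝ} (hφ : φ ∈ TestFunctions)
    (i : Fin 2) : Integrable fun x => g x i * φ x :=
  integrable_mul_of_hasCompactSupport (LocallyIntegrable.coord h.2.1 i)
    (TestFunctions.continuous hφ) hφ.2

theorem congr (h : HasWeakGradient u g) (hu : u =ᵐ[volume] v) (hg : g =ᵐ[volume] k) :
    HasWeakGradient v k := by
  refine ⟨h.1.congr hu, h.2.1.congr hg, fun φ hφ i => ?_⟩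
  have e1 : (fun x => u x * fderiv ℝ φ x (EuclideanSpace.single i 1)) =ᵐ[volume]
      fun x => v x * fderiv ℝ φ x (EuclideanSpace.single i 1) := by
    filter_upwards [hu] with x hx
    rw [hx]
  have e2 : (fun x => g x i * φ x) =ᵐ[volume] fun x => k x i * φ x := by
    filter_upwards [hg] with x hx
    rw [hx]
  rw [← integral_congr_ae e1, h.2.2 φ hφ i, integral_congr_ae e2]

theorem unique (h : HasWeakGradient u g) (h' : HasWeakGradient u k) : g =ᵐ[volume] k := by
  have hi : ∀ i : Fin 2, ∀ᵐ x, g x i = k x i := fun i => by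
    refine ae_eq_of_integral_contDiff_smul_eq (LocallyIntegrable.coord h.2.1 i)
      (LocallyIntegrable.coord h'.2.1 i) fun φ h1 h2 => ?_
    have e1 := h.2.2 φ ⟨h1, h2⟩ i
    have e2 := h'.2.2 φ ⟨h1, h2⟩ i
    simp only [smul_eq_mul, mul_comm (φ _)]
    linarith
  filter_upwards [hi 0, hi 1] with x h0 h1
  ext i
  fin_cases i
  · exact h0
  · exact h1

theorem add (h : HasWeakGradient u g) (h' : HasWeakGradient v k) :
    HasWeakGradient (u + v) (g + k) := by
  refine ⟨h.1.add h'.1, h.2.1.add h'.2.1, fun φ hφ i => ?_⟩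
  simp only [Pi.add_apply, PiLp.add_apply, add_mul]
  rw [integral_add (h.integrable_mul_partial hφ _) (h'.integrable_mul_partial hφ _),
    integral_add (h.integrable_coord_mul hφ i) (h'.integrable_coord_mul hφ i),
    h.2.2 φ hφ i, h'.2.2 φ hφ i]
  ring

theorem sub (h : HasWeakGradient u g) (h' : HasWeakGradient v k) :
    HasWeakGradient (u - v) (g - k) := by
  refine ⟨h.1.sub h'.1, h.2.1.sub h'.2.1, fun φ hφ i => ?_⟩
  simp only [Pi.sub_apply, PiLp.sub_apply, sub_mul]
  rw [integral_sub (h.integrable_mul_partial hφ _) (h'.integrable_mul_partial hφ _),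
    integral_sub (h.integrable_coord_mul hφ i) (h'.integrable_coord_mul hφ i),
    h.2.2 φ hφ i, h'.2.2 φ hφ i]
  ring

theorem of_contDiff (hu : ContDiff ℝ 1 u) : HasWeakGradient u (gradient u) := by
  refine ⟨hu.continuous.locallyIntegrable, (continuous_gradient hu).locallyIntegrable,
    fun φ hφ i => ?_⟩
  simp only [gradient_coord]
  have h1 := TestFunctions.contDiff hφ
  refine integral_mul_fderiv_eq_neg_fderiv_mul_of_integrable ?_ ?_ ?_
    (fun x _ => hu.differentiable one_ne_zero x) (fun x _ => h1.differentiable one_ne_zero x)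
  · exact integrable_mul_of_hasCompactSupport (continuous_partial hu _).locallyIntegrable
      h1.continuous hφ.2
  · exact integrable_mul_of_hasCompactSupport hu.continuous.locallyIntegrable
      (continuous_partial h1 _) (hasCompactSupport_partial hφ.2 _)
  · exact integrable_mul_of_hasCompactSupport hu.continuous.locallyIntegrable
      h1.continuous hφ.2

theorem smooth_mul (h : HasWeakGradient u g) {χ : Plane → ℝ} (hχ : ContDiff ℝ (⊤ : ℕ∞) χ) :
    HasWeakGradient (fun x => χ x * u x) (fun x => χ x • g x + u x • gradient χ x) := by
  have h1 : ContDiff ℝ 1 χ := hχ.of_le (by exact_mod_cast le_top)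
  have li : ∀ {F : Type} [NormedAddCommGroup F] [NormedSpace ℝ F] {f : Plane → F} {c : Plane → ℝ},
      LocallyIntegrable f → Continuous c → LocallyIntegrable fun x => c x • f x := by
    intro F _ _ f c hf hc
    rw [← locallyIntegrableOn_univ] at hf ⊢
    exact hf.continuousOn_smul isOpen_univ.isLocallyClosed hc.continuousOn
  have li' : LocallyIntegrable fun x => u x • gradient χ x := by
    have := h.1
    rw [← locallyIntegrableOn_univ] at this ⊢
    exact this.smul_continuousOn isOpen_univ.isLocallyClosed (continuous_gradient h1).continuousOn
  refine ⟨li h.1 h1.continuous, (li h.2.1 h1.continuous).add li', fun φ hφ i => ?_⟩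
  have hm := TestFunctions.mul hχ hφ
  have e1 := h.2.2 _ hm i
  have hd : ∀ x, fderiv ℝ (fun x => χ x * φ x) x (EuclideanSpace.single i 1) =
      χ x * fderiv ℝ φ x (EuclideanSpace.single i 1) +
        φ x * fderiv ℝ χ x (EuclideanSpace.single i 1) := fun x => by
    rw [fderiv_fun_mul (h1.differentiable one_ne_zero x)
      ((TestFunctions.contDiff hφ).differentiable one_ne_zero x)]
    simp
  have i1 : Integrable fun x => u x * (φ x * fderiv ℝ χ x (EuclideanSpace.single i 1)) :=
    integrable_mul_of_hasCompactSupport h.1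
      ((TestFunctions.continuous hφ).mul (continuous_partial h1 _)) hφ.2.mul_right
  have i2 : Integrable fun x => u x * (χ x * fderiv ℝ φ x (EuclideanSpace.single i 1)) :=
    integrable_mul_of_hasCompactSupport h.1
      (h1.continuous.mul (continuous_partial (TestFunctions.contDiff hφ) _))
      (hasCompactSupport_partial hφ.2 _).mul_left
  simp only [hd, mul_add] at e1
  rw [integral_add i2 i1] at e1
  have e2 : ∫ x, (χ x • g x + u x • gradient χ x) i * φ x =
      (∫ x, g x i * (χ x * φ x)) +
        ∫ x, u x * (φ x * fderiv ℝ χ x (EuclideanSpace.single i 1)) := by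
    rw [← integral_add (h.integrable_coord_mul hm i) i1]
    congr with x
    simp only [PiLp.add_apply, PiLp.smul_apply, smul_eq_mul, gradient_coord]
    ring
  rw [e2]
  have e3 : ∫ x, χ x * u x * fderiv ℝ φ x (EuclideanSpace.single i 1) =
      ∫ x, u x * (χ x * fderiv ℝ φ x (EuclideanSpace.single i 1)) := by
    congr with x
    ring
  rw [e3]
  linarith

/-- Each test function lives in one ball, so having a weak gradient is a local property. This
reduces global claims to functions multiplied by a cutoff. -/
theorem of_forall_ball
    (h : ∀ R : ℝ, 0 < R → ∃ v k, HasWeakGradient v k ∧ ∀ x ∈ Metric.ball (0 : Plane) R,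
      u x = v x ∧ g x = k x) : HasWeakGradient u g := by
  have loc : ∀ {F : Type} [NormedAddCommGroup F] (f : Plane → F),
      (∀ R : ℝ, 0 < R → ∃ f', LocallyIntegrable f' ∧ ∀ x ∈ Metric.ball (0 : Plane) R,
        f x = f' x) → LocallyIntegrable f := by
    intro F _ f hf x
    obtain ⟨f', h1, h2⟩ := hf (‖x‖ + 1) (by positivity)
    obtain ⟨s, hs, hi⟩ := h1 x
    have hb : Metric.ball (0 : Plane) (‖x‖ + 1) ∈ 𝓝 x :=
      Metric.isOpen_ball.mem_nhds (by simp)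
    refine ⟨s ∩ Metric.ball 0 (‖x‖ + 1), inter_mem hs hb, ?_⟩
    have := hi.mono_set (inter_subset_left (t := Metric.ball (0 : Plane) (‖x‖ + 1)))
    have e : f =ᵐ[volume.restrict (s ∩ Metric.ball 0 (‖x‖ + 1))] f' := by
      have : f =ᵐ[volume.restrict (Metric.ball 0 (‖x‖ + 1))] f' :=
        (ae_restrict_iff' Metric.isOpen_ball.measurableSet).2 (ae_of_all _ h2)
      exact ae_restrict_of_ae_restrict_of_subset inter_subset_right this
    exact (integrable_congr e).2 this
  refine ⟨loc u fun R hR => ?_, loc g fun R hR => ?_, fun φ hφ i => ?_⟩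
  · obtain ⟨v, k, hvk, he⟩ := h R hR
    exact ⟨v, hvk.1, fun x hx => (he x hx).1⟩
  · obtain ⟨v, k, hvk, he⟩ := h R hR
    exact ⟨k, hvk.2.1, fun x hx => (he x hx).2⟩
  · obtain ⟨R, hR, hsub⟩ := hφ.2.isCompact.isBounded.subset_ball_lt 0 (0 : Plane)
    obtain ⟨v, k, hvk, he⟩ := h R hR
    have e1 : ∀ x, u x * fderiv ℝ φ x (EuclideanSpace.single i 1) =
        v x * fderiv ℝ φ x (EuclideanSpace.single i 1) := fun x => by
      by_cases hx : x ∈ tsupport φ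
      · rw [(he x (hsub hx)).1]
      · rw [fderiv_of_notMem_tsupport (𝕜 := ℝ) hx]; simp
    have e2 : ∀ x, g x i * φ x = k x i * φ x := fun x => by
      by_cases hx : x ∈ tsupport φ
      · rw [(he x (hsub hx)).2]
      · rw [image_eq_zero_of_notMem_tsupport hx]; simp
    simp only [e1, e2]
    exact hvk.2.2 φ hφ i

theorem comp_neg (h : HasWeakGradient u g) :
    HasWeakGradient (fun x => u (-x)) (fun x => -g (-x)) := by
  have li : ∀ {F : Type} [NormedAddCommGroup F] {f : Plane → F},
      LocallyIntegrable f → LocallyIntegrable fun x => f (-x) := by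
    intro F _ f hf x
    obtain ⟨s, hs, hi⟩ := hf (-x)
    refine ⟨Neg.neg ⁻¹' s, continuous_neg.continuousAt hs, ?_⟩
    exact ((Measure.measurePreserving_neg (volume : Measure Plane)).integrableOn_comp_preimage
      (MeasurableEquiv.neg Plane).measurableEmbedding).2 hi
  refine ⟨li h.1, (li h.2.1).neg, fun φ hφ i => ?_⟩
  have hφ' : (fun x => φ (-x)) ∈ TestFunctions :=
    ⟨hφ.1.comp contDiff_neg, hφ.2.comp_homeomorph (Homeomorph.neg Plane)⟩
  have e1 := h.2.2 _ hφ' i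
  have hd : ∀ x, fderiv ℝ (fun x => φ (-x)) x (EuclideanSpace.single i 1) =
      - fderiv ℝ φ (-x) (EuclideanSpace.single i 1) := fun x => by
    have := (((TestFunctions.contDiff hφ).differentiable one_ne_zero (-x)).hasFDerivAt).comp x
      (hasFDerivAt_id x).neg
    rw [show (fun x => φ (-x)) = φ ∘ fun x => -x from rfl, HasFDerivAt.fderiv this]
    simp
  simp only [hd] at e1
  rw [← integral_neg_eq_self, ← integral_neg_eq_self (fun x => (-g (-x)) i * φ x)]
  simp only [neg_neg, PiLp.neg_apply, neg_mul, mul_neg, integral_neg] at e1 ⊢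
  linarith

end HasWeakGradient

theorem tendsto_integral_mul_of_tendsto_lintegral {ι : Type*} {l : Filter ι}
    {U : ι → Plane → ℝ} {u ψ : Plane → ℝ} (hU : ∀ i, LocallyIntegrable (U i))
    (hu : LocallyIntegrable u) (hψ : Continuous ψ) (hc : HasCompactSupport ψ)
    (h : Tendsto (fun i => ∫⁻ x in tsupport ψ, ‖U i x - u x‖ₑ) l (𝓝 0)) :
    Tendsto (fun i => ∫ x, U i x * ψ x) l (𝓝 (∫ x, u x * ψ x)) := by
  refine tendsto_integral_of_L1' _
    (integrable_mul_of_hasCompactSupport hu hψ hc).aestronglyMeasurable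
    (Eventually.of_forall fun i => integrable_mul_of_hasCompactSupport (hU i) hψ hc) ?_
  obtain ⟨C, hC⟩ := hψ.bounded_above_of_compact_support hc
  have hlim : Tendsto (fun i => ENNReal.ofReal C * ∫⁻ x in tsupport ψ, ‖U i x - u x‖ₑ) l (𝓝 0) := by
    simpa using ENNReal.Tendsto.const_mul h (Or.inr ENNReal.ofReal_ne_top)
  refine tendsto_of_tendsto_of_tendsto_of_le_of_le tendsto_const_nhds hlim
    (fun _ => zero_le) fun i => ?_
  rw [eLpNorm_one_eq_lintegral_enorm, ← lintegral_const_mul' _ _ ENNReal.ofReal_ne_top,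
    ← lintegral_indicator (isClosed_tsupport ψ).measurableSet]
  refine lintegral_mono fun x => ?_
  simp only [Pi.sub_apply, ← sub_mul, enorm_mul]
  by_cases hx : x ∈ tsupport ψ
  · rw [indicator_of_mem hx, mul_comm]
    gcongr
    rw [← ofReal_norm]
    exact ENNReal.ofReal_le_ofReal (hC x)
  · rw [image_eq_zero_of_notMem_tsupport hx]
    simp

/-- Both sides of the integration by parts pass to `L¹_loc` limits. The chain rule, truncation,
removability of the origin and completeness are all obtained as limits of this kind. -/
theorem HasWeakGradient.of_tendsto {ι : Type*} {l : Filter ι} [l.NeBot]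
    {U : ι → Plane → ℝ} {G : ι → Plane → Plane} {u : Plane → ℝ} {g : Plane → Plane}
    (h : ∀ i, HasWeakGradient (U i) (G i)) (hu : LocallyIntegrable u) (hg : LocallyIntegrable g)
    (h1 : ∀ K, IsCompact K → Tendsto (fun i => ∫⁻ x in K, ‖U i x - u x‖ₑ) l (𝓝 0))
    (h2 : ∀ K, IsCompact K → Tendsto (fun i => ∫⁻ x in K, ‖G i x - g x‖ₑ) l (𝓝 0)) :
    HasWeakGradient u g := by
  refine ⟨hu, hg, fun φ hφ i => ?_⟩
  have t1 := tendsto_integral_mul_of_tendsto_lintegral (fun j => (h j).1) hu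
    (continuous_partial (TestFunctions.contDiff hφ) (EuclideanSpace.single i 1))
    (hasCompactSupport_partial hφ.2 _) (h1 _ (hasCompactSupport_partial hφ.2 _).isCompact)
  have t2 := tendsto_integral_mul_of_tendsto_lintegral
    (fun j => LocallyIntegrable.coord (h j).2.1 i) (LocallyIntegrable.coord hg i)
    (TestFunctions.continuous hφ) hφ.2 (tendsto_of_tendsto_of_tendsto_of_le_of_le
      tendsto_const_nhds (h2 _ hφ.2.isCompact) (fun _ => zero_le) fun j => by
        refine lintegral_mono fun x => ?_
        rw [← PiLp.sub_apply]
        simp only [← ofReal_norm]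
        exact ENNReal.ofReal_le_ofReal (PiLp.norm_apply_le _ _))
  refine tendsto_nhds_unique t1 (Tendsto.congr (fun j => ?_) t2.neg)
  exact ((h j).2.2 φ hφ i).symm

/-! ### Mollification -/

/-- Translations form a continuous family of measure-preserving maps, and composition with such maps
is continuous into `Lp` for finite `p`. -/
theorem tendsto_eLpNorm_translate {E : Type} [NormedAddCommGroup E] {p : ℝ≥0∞}
    (h1 : 1 ≤ p) (hp : p ≠ ⊤) {f : Plane → E}
    (hf : MemLp f p) :
    Tendsto (fun t => eLpNorm (fun x => f (x - t) - f x) p volume) (𝓝 0) (𝓝 0) := by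
  have : Fact (1 ≤ p) := ⟨h1⟩
  let T : Plane → C(Plane, Plane) := fun t => ⟨fun x => x - t, by fun_prop⟩
  have hT : Continuous T := by
    refine ContinuousMap.continuous_of_continuous_uncurry _ ?_
    show Continuous fun p : Plane × Plane => p.2 - p.1
    fun_prop
  have hmp : ∀ t, MeasurePreserving (T t) volume volume := fun t => measurePreserving_sub_right _ t
  have hc := Continuous.compMeasurePreservingLp (p := p) (ν := volume)
    (continuous_const (y := hf.toLp f)) hT hmp hp
  have h2 := (hc.tendsto 0).edist (tendsto_const_nhds (x := hf.toLp f))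
  have h0 : Lp.compMeasurePreserving (T 0) (hmp 0) (hf.toLp f) = hf.toLp f := by
    rw [Lp.toLp_compMeasurePreserving]
    congr 1
    ext x
    simp [T]
  rw [h0, edist_self] at h2
  refine h2.congr fun t => ?_
  rw [Lp.toLp_compMeasurePreserving, Lp.edist_toLp_toLp]
  rfl

section Mollification

open scoped Convolution
open ContinuousLinearMap (lsmul)

variable {E : Type} [NormedAddCommGroup E] [NormedSpace ℝ E]

/-- A sequence of bump functions whose supports shrink to the origin. -/
def bump (n : ℕ) : ContDiffBump (0 : Plane) where
  rIn := 1 / (n + 1)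
  rOut := 2 / (n + 1)
  rIn_pos := by positivity
  rIn_lt_rOut := by gcongr; norm_num

/-- The normalised bump function. -/
def kern (n : ℕ) : Plane → ℝ := (bump n).normed volume

/-- Convolution with the normalised bump function. -/
def mollify (n : ℕ) (f : Plane → E) : Plane → E :=
  convolution (kern n) f (lsmul ℝ ℝ) volume

theorem tendsto_rOut_bump : Tendsto (fun n => (bump n).rOut) atTop (𝓝 0) := by
  have := (tendsto_one_div_add_atTop_nhds_zero_nat (𝕜 := ℝ)).const_mul 2
  simpa [bump, div_eq_mul_inv] using this

theorem kern_nonneg (n : ℕ) (x : Plane) : 0 ≤ kern n x := (bump n).nonneg_normed x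

theorem contDiff_kern (n : ℕ) : ContDiff ℝ (⊤ : ℕ∞) (kern n) := (bump n).contDiff_normed

theorem continuous_kern (n : ℕ) : Continuous (kern n) := (contDiff_kern n).continuous

theorem hasCompactSupport_kern (n : ℕ) : HasCompactSupport (kern n) :=
  (bump n).hasCompactSupport_normed

theorem mollify_apply (n : ℕ) (f : Plane → E) (x : Plane) :
    mollify n f x = ∫ t, kern n t • f (x - t) := rfl

/-- The probability measure whose density is the normalised bump function. -/
def kernMeasure (n : ℕ) : Measure Plane := volume.withDensity fun t => ENNReal.ofReal (kern n t)

instance (n : ℕ) : IsProbabilityMeasure (kernMeasure n) := by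
  refine ⟨?_⟩
  rw [kernMeasure, withDensity_apply _ MeasurableSet.univ, Measure.restrict_univ,
    ← ofReal_integral_eq_lintegral_ofReal
      ((continuous_kern n).integrable_of_hasCompactSupport (hasCompactSupport_kern n))
      (ae_of_all _ (kern_nonneg n)), kern, ContDiffBump.integral_normed]
  simp

theorem integral_kernMeasure (n : ℕ) (f : Plane → E) :
    ∫ t, f t ∂(kernMeasure n) = ∫ t, kern n t • f t := by
  rw [kernMeasure, integral_withDensity_eq_integral_toReal_smul
    (by have := (continuous_kern n).measurable; fun_prop) (ae_of_all _ fun _ => by simp)]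
  simp [ENNReal.toReal_ofReal (kern_nonneg n _)]

theorem mollify_sub_eq [CompleteSpace E] (n : ℕ) {f : Plane → E} (hf : LocallyIntegrable f)
    (x : Plane) : mollify n f x - f x = ∫ t, (f (x - t) - f x) ∂(kernMeasure n) := by
  rw [integral_kernMeasure, mollify_apply]
  simp only [smul_sub]
  have hi : Integrable fun t => kern n t • f (x - t) :=
    (HasCompactSupport.convolutionExists_left (lsmul ℝ ℝ) (hasCompactSupport_kern n)
      (continuous_kern n) hf x)
  rw [integral_sub hi, integral_smul_const, kern, ContDiffBump.integral_normed, one_smul]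
  exact ((continuous_kern n).integrable_of_hasCompactSupport (hasCompactSupport_kern n)).smul_const _

theorem ae_kernMeasure (n : ℕ) : ∀ᵐ t ∂(kernMeasure n), ‖t‖ < (bump n).rOut := by
  rw [kernMeasure, ae_withDensity_iff (by have := (continuous_kern n).measurable; fun_prop)]
  refine ae_of_all _ fun t ht => ?_
  have : t ∈ Function.support (kern n) := by
    intro h0
    simp [h0] at ht
  rw [kern, ContDiffBump.support_normed_eq] at this
  simpa using this

/-- The mollification error is the average of `f (x - t) - f x` against a probability measure on
small `t`. Jensen and Tonelli bound it by the worst translate. -/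
theorem eLpNorm_mollify_sub_le [CompleteSpace E] {p : ℝ≥0∞} (h1 : 1 ≤ p) (hp : p ≠ ⊤) {f : Plane → E}
    (hf : MemLp f p) (n : ℕ) {ε : ℝ≥0∞} (hε : ∀ t : Plane, ‖t‖ < (bump n).rOut →
      eLpNorm (fun x => f (x - t) - f x) p volume ≤ ε) :
    eLpNorm (mollify n f - f) p volume ≤ ε := by
  have hp0 : p ≠ 0 := (zero_lt_one.trans_le h1).ne'
  have hpr : 0 < p.toReal := ENNReal.toReal_pos hp0 hp
  have hloc : LocallyIntegrable f := hf.locallyIntegrable h1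
  have hac : kernMeasure n ≪ volume := withDensity_absolutelyContinuous _ _
  have hm2 : AEStronglyMeasurable (fun z : Plane × Plane => f (z.1 - z.2) - f z.1)
      (volume.prod (kernMeasure n)) := by
    refine AEStronglyMeasurable.mono_ac (Measure.AbsolutelyContinuous.rfl.prod hac) ?_
    exact (hf.1.comp_quasiMeasurePreserving
      (quasiMeasurePreserving_sub volume volume)).sub hf.1.comp_fst
  have hpt : ∀ x, AEStronglyMeasurable (fun t => f (x - t) - f x) (kernMeasure n) := fun x => by
    refine AEStronglyMeasurable.mono_ac hac (AEStronglyMeasurable.sub ?_ aestronglyMeasurable_const)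
    exact hf.1.comp_quasiMeasurePreserving
      (Measure.measurePreserving_sub_left volume x).quasiMeasurePreserving
  have key : ∀ x, ‖mollify n f x - f x‖ₑ ^ p.toReal ≤
      ∫⁻ t, ‖f (x - t) - f x‖ₑ ^ p.toReal ∂(kernMeasure n) := fun x => by
    -- Jensen's inequality, in the form that `L^p` norms over a probability space increase with the
    -- exponent.
    have e1 : ‖mollify n f x - f x‖ₑ ≤ eLpNorm (fun t => f (x - t) - f x) p (kernMeasure n) := by
      rw [mollify_sub_eq n hloc]
      refine (enorm_integral_le_lintegral_enorm _).trans ?_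
      rw [← eLpNorm_one_eq_lintegral_enorm]
      exact eLpNorm_le_eLpNorm_of_exponent_le h1 (hpt x)
    rw [eLpNorm_eq_lintegral_rpow_enorm_toReal hp0 hp, one_div] at e1
    exact (ENNReal.le_rpow_inv_iff hpr).1 e1
  rw [eLpNorm_eq_lintegral_rpow_enorm_toReal hp0 hp, one_div, ENNReal.rpow_inv_le_iff hpr]
  calc ∫⁻ x, ‖(mollify n f - f) x‖ₑ ^ p.toReal
      ≤ ∫⁻ x, ∫⁻ t, ‖f (x - t) - f x‖ₑ ^ p.toReal ∂(kernMeasure n) := lintegral_mono key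
    _ = ∫⁻ t, (∫⁻ x, ‖f (x - t) - f x‖ₑ ^ p.toReal) ∂(kernMeasure n) :=
        lintegral_lintegral_swap (f := fun x t => ‖f (x - t) - f x‖ₑ ^ p.toReal) (hm2.enorm.pow_const _)
    _ ≤ ∫⁻ t, ε ^ p.toReal ∂(kernMeasure n) := by
        refine lintegral_mono_ae ?_
        filter_upwards [ae_kernMeasure n] with t ht
        have := hε t ht
        rwa [eLpNorm_eq_lintegral_rpow_enorm_toReal hp0 hp, one_div,
          ENNReal.rpow_inv_le_iff hpr] at this
    _ = ε ^ p.toReal := by simp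

theorem tendsto_eLpNorm_mollify_sub [CompleteSpace E] {p : ℝ≥0∞} (h1 : 1 ≤ p) (hp : p ≠ ⊤) {f : Plane → E}
    (hf : MemLp f p) :
    Tendsto (fun n => eLpNorm (mollify n f - f) p volume) atTop (𝓝 0) := by
  rw [ENNReal.tendsto_nhds_zero]
  intro ε hε
  have h := (ENNReal.tendsto_nhds_zero.1 (tendsto_eLpNorm_translate h1 hp hf)) ε hε
  obtain ⟨δ, hδ, hball⟩ := Metric.eventually_nhds_iff.1 h
  filter_upwards [tendsto_rOut_bump.eventually_lt_const hδ] with n hn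
  exact eLpNorm_mollify_sub_le h1 hp hf n fun t ht => hball (by simpa using ht.trans hn)

/-- Lebesgue differentiation; it applies because the ratio of outer to inner radius of `bump n` is
always `2`. -/
theorem ae_tendsto_mollify [CompleteSpace E] {f : Plane → E} (hf : LocallyIntegrable f) :
    ∀ᵐ x, Tendsto (fun n => mollify n f x) atTop (𝓝 (f x)) :=
  ContDiffBump.ae_convolution_tendsto_right_of_locallyIntegrable (K := 2) tendsto_rOut_bump
    (Eventually.of_forall fun n => by simp [bump, div_eq_mul_inv]) hf

theorem contDiff_mollify (n : ℕ) {f : Plane → E} (hf : LocallyIntegrable f) :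
    ContDiff ℝ (⊤ : ℕ∞) (mollify n f) :=
  (hasCompactSupport_kern n).contDiff_convolution_left _ (contDiff_kern n) hf

theorem hasCompactSupport_mollify (n : ℕ) {f : Plane → E} (hf : HasCompactSupport f) :
    HasCompactSupport (mollify n f) :=
  (hasCompactSupport_kern n).convolution _ hf

theorem mollify_eq_of_forall_ball [CompleteSpace E] (n : ℕ) {f : Plane → E} {x : Plane}
    (h : ∀ y ∈ Metric.ball x (bump n).rOut, f y = f x) : mollify n f x = f x :=
  ContDiffBump.normed_convolution_eq_right h

/-- The derivative falls on the kernel, and `y ↦ kern n (x - y)` is itself a test function to which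
the definition of the weak gradient applies. -/
theorem HasWeakGradient.fderiv_mollify {u : Plane → ℝ} {g : Plane → Plane}
    (h : HasWeakGradient u g) (n : ℕ) : gradient (mollify n u) = mollify n g := by
  have hK := (contDiff_kern n).of_le (show (1 : WithTop ℕ∞) ≤ ((⊤ : ℕ∞) : WithTop ℕ∞) by
    exact_mod_cast le_top)
  ext x i
  rw [gradient_coord]
  have h1 := (hasCompactSupport_kern n).hasFDerivAt_convolution_left (lsmul ℝ ℝ) hK h.1 x
  rw [show fderiv ℝ (mollify n u) x = _ from h1.fderiv]
  have hφ : (fun y => kern n (x - y)) ∈ TestFunctions := by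
    refine ⟨(contDiff_kern n).comp (contDiff_const.sub contDiff_id), ?_⟩
    exact (hasCompactSupport_kern n).comp_homeomorph (Homeomorph.subLeft x)
  have h2 := h.2.2 _ hφ i
  have hd : ∀ y, fderiv ℝ (fun y => kern n (x - y)) y (EuclideanSpace.single i 1) =
      - fderiv ℝ (kern n) (x - y) (EuclideanSpace.single i 1) := fun y => by
    have := ((hK.differentiable one_ne_zero (x - y)).hasFDerivAt).comp y
      ((hasFDerivAt_id y).const_sub x)
    rw [show (fun y => kern n (x - y)) = kern n ∘ fun y => x - y from rfl, HasFDerivAt.fderiv this]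
    simp
  simp only [hd, mul_neg, integral_neg, neg_inj] at h2
  have h3 : Integrable fun t => (lsmul ℝ ℝ).precompL Plane (fderiv ℝ (kern n) t) (u (x - t)) :=
    ((hasCompactSupport_kern n).fderiv ℝ).convolutionExists_left _
      (hK.continuous_fderiv one_ne_zero) h.1 x
  have h4 : Integrable fun t => kern n t • g (x - t) :=
    (hasCompactSupport_kern n).convolutionExists_left (lsmul ℝ ℝ) (continuous_kern n) h.2.1 x
  rw [convolution_def, ContinuousLinearMap.integral_apply h3, mollify_apply]
  have e1 : (∫ t, kern n t • g (x - t)) i = ∫ t, kern n t * g (x - t) i := by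
    have := (EuclideanSpace.proj (𝕜 := ℝ) i).integral_comp_comm h4
    simpa using this.symm
  rw [e1, ← integral_sub_left_eq_self (fun t => kern n t * g (x - t) i) volume x,
    ← integral_sub_left_eq_self (fun t => _) volume x]
  simp only [sub_sub_cancel]
  simp only [mul_comm (kern n _)]
  rw [← h2]
  congr with y
  simp [mul_comm]

end Mollification

/-! ### Smooth radial steps -/

theorem exists_bound_deriv_smoothTransition :
    ∃ L : ℝ, 0 < L ∧ ∀ t, |deriv Real.smoothTransition t| ≤ L := by
  have hc : Continuous (deriv Real.smoothTransition) :=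
    (Real.smoothTransition.contDiff (n := 1)).continuous_deriv le_rfl
  have hs : HasCompactSupport (deriv Real.smoothTransition) := by
    refine HasCompactSupport.of_support_subset_isCompact (isCompact_Icc (a := (0 : ℝ)) (b := 1)) ?_
    intro t ht
    by_contra hn
    refine ht ?_
    rcases lt_or_ge t 0 with h | h
    · have : Real.smoothTransition =ᶠ[𝓝 t] fun _ => 0 := by
        filter_upwards [Iio_mem_nhds h] with s hs
        exact Real.smoothTransition.zero_of_nonpos (le_of_lt hs)
      rw [this.deriv_eq]; simp
    · have h1 : 1 < t := by
        by_contra h'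
        exact hn ⟨h, not_lt.1 h'⟩
      have : Real.smoothTransition =ᶠ[𝓝 t] fun _ => 1 := by
        filter_upwards [Ioi_mem_nhds h1] with s hs
        exact Real.smoothTransition.one_of_one_le (le_of_lt hs)
      rw [this.deriv_eq]; simp
  obtain ⟨C, hC⟩ := hc.bounded_above_of_compact_support hs
  exact ⟨max C 1, by positivity, fun t => (hC t).trans (le_max_left _ _)⟩

/-- A bound for the derivative of the smooth transition function. -/
def stepBound : ℝ := exists_bound_deriv_smoothTransition.choose

theorem stepBound_pos : 0 < stepBound := exists_bound_deriv_smoothTransition.choose_spec.1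

theorem abs_deriv_smoothTransition_le (t : ℝ) : |deriv Real.smoothTransition t| ≤ stepBound :=
  exists_bound_deriv_smoothTransition.choose_spec.2 t

theorem hasDerivAt_smoothTransition (t : ℝ) :
    HasDerivAt Real.smoothTransition (deriv Real.smoothTransition t) t :=
  ((Real.smoothTransition.contDiff (n := 1)).differentiable one_ne_zero t).hasDerivAt

theorem deriv_smoothTransition_nonneg (t : ℝ) : 0 ≤ deriv Real.smoothTransition t :=
  Real.smoothTransition.monotone.deriv_nonneg

theorem deriv_smoothTransition_of_nonpos {t : ℝ} (ht : t ≤ 0) :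
    deriv Real.smoothTransition t = 0 := by
  have hmin : IsLocalMin Real.smoothTransition t := by
    refine Eventually.of_forall fun s => ?_
    rw [Real.smoothTransition.zero_of_nonpos ht]
    exact Real.smoothTransition.nonneg s
  exact hmin.deriv_eq_zero

theorem deriv_smoothTransition_of_one_le {t : ℝ} (ht : 1 ≤ t) :
    deriv Real.smoothTransition t = 0 := by
  have hmax : IsLocalMax Real.smoothTransition t := by
    refine Eventually.of_forall fun s => ?_
    rw [Real.smoothTransition.one_of_one_le ht]
    exact Real.smoothTransition.le_one s
  exact hmax.deriv_eq_zero

/-- A smooth function of the squared norm with values in `[0, 1]`. -/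
def radialStep (α β : ℝ) (x : Plane) : ℝ := Real.smoothTransition (α + β * ‖x‖ ^ 2)

theorem contDiff_radialStep (α β : ℝ) : ContDiff ℝ (⊤ : ℕ∞) (radialStep α β) :=
  Real.smoothTransition.contDiff.comp (contDiff_const.add (contDiff_const.mul (contDiff_norm_sq ℝ)))

theorem radialStep_nonneg (α β : ℝ) (x : Plane) : 0 ≤ radialStep α β x :=
  Real.smoothTransition.nonneg _

theorem radialStep_le_one (α β : ℝ) (x : Plane) : radialStep α β x ≤ 1 :=
  Real.smoothTransition.le_one _

theorem hasFDerivAt_radialStep (α β : ℝ) (x : Plane) :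
    HasFDerivAt (radialStep α β)
      ((deriv Real.smoothTransition (α + β * ‖x‖ ^ 2) * (2 * β)) • innerSL ℝ x) x := by
  have h1 : HasFDerivAt (fun x : Plane => ‖x‖ ^ 2) (2 • innerSL ℝ x) x :=
    (hasStrictFDerivAt_norm_sq x).hasFDerivAt
  have := (hasDerivAt_smoothTransition (α + β * ‖x‖ ^ 2)).comp_hasFDerivAt x
    ((h1.const_mul β).const_add α)
  refine this.congr_fderiv ?_
  ext v
  simp
  ring

/-- Scale invariance: the derivative lives where `α + β‖x‖² ∈ (0, 1)`, which forces `|β|‖x‖² ≤ |α| +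
1`. The bound is therefore free of `β`, i.e. of the radius of the step. -/
theorem norm_mul_norm_fderiv_radialStep_le (α β : ℝ) (x : Plane) :
    ‖x‖ * ‖fderiv ℝ (radialStep α β) x‖ ≤ 2 * (|α| + 1) * stepBound := by
  rw [(hasFDerivAt_radialStep α β x).fderiv, norm_smul, innerSL_apply_norm, Real.norm_eq_abs, abs_mul]
  by_cases h : α + β * ‖x‖ ^ 2 ∈ Ioo (0 : ℝ) 1
  · have h1 : |β| * ‖x‖ ^ 2 ≤ |α| + 1 := by
      have : |β * ‖x‖ ^ 2| ≤ |α| + 1 := by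
        rw [abs_le]
        constructor <;> linarith [h.1, h.2, neg_abs_le α, le_abs_self α]
      rwa [abs_mul, abs_of_nonneg (sq_nonneg ‖x‖)] at this
    have h2 := abs_deriv_smoothTransition_le (α + β * ‖x‖ ^ 2)
    calc ‖x‖ * (|deriv Real.smoothTransition (α + β * ‖x‖ ^ 2)| * |2 * β| * ‖x‖)
        = 2 * (|β| * ‖x‖ ^ 2) * |deriv Real.smoothTransition (α + β * ‖x‖ ^ 2)| := by
          rw [abs_mul, abs_two]; ring
      _ ≤ 2 * (|α| + 1) * stepBound := by
          gcongr
  · have h0 : deriv Real.smoothTransition (α + β * ‖x‖ ^ 2) = 0 := by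
      rcases le_or_gt (α + β * ‖x‖ ^ 2) 0 with h1 | h1
      · exact deriv_smoothTransition_of_nonpos h1
      · exact deriv_smoothTransition_of_one_le (not_lt.1 fun h2 => h ⟨h1, h2⟩)
    rw [h0]
    simp only [abs_zero, zero_mul, mul_zero]
    have := stepBound_pos
    positivity

/-- A smooth cutoff function that is `1` on the ball of radius `R` and vanishes outside the ball
of radius `2 * R`. -/
def cutoff (R : ℝ) : Plane → ℝ := radialStep 2 (-(R ^ 2)⁻¹)

theorem abs_cutoff_le_one (R : ℝ) (x : Plane) : |cutoff R x| ≤ 1 :=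
  (abs_of_nonneg (radialStep_nonneg _ _ x)).trans_le (radialStep_le_one _ _ x)

theorem cutoff_eq_one {R : ℝ} (hR : 0 < R) {x : Plane} (hx : ‖x‖ ≤ R) : cutoff R x = 1 := by
  refine Real.smoothTransition.one_of_one_le ?_
  have : (R ^ 2)⁻¹ * ‖x‖ ^ 2 ≤ 1 := by
    rw [inv_mul_le_one₀ (by positivity)]
    gcongr
  linarith

theorem cutoff_eq_zero {R : ℝ} (hR : 0 < R) {x : Plane} (hx : 2 * R ≤ ‖x‖) : cutoff R x = 0 := by
  refine Real.smoothTransition.zero_of_nonpos ?_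
  have : 2 ≤ (R ^ 2)⁻¹ * ‖x‖ ^ 2 := by
    rw [le_inv_mul_iff₀ (by positivity)]
    nlinarith
  linarith

theorem contDiff_cutoff (R : ℝ) : ContDiff ℝ (⊤ : ℕ∞) (cutoff R) := contDiff_radialStep _ _

theorem hasCompactSupport_cutoff {R : ℝ} (hR : 0 < R) : HasCompactSupport (cutoff R) := by
  refine HasCompactSupport.of_support_subset_isCompact (isCompact_closedBall (0 : Plane) (2 * R)) ?_
  intro x hx
  by_contra h
  exact hx (cutoff_eq_zero hR (by simpa using (not_le.1 (by simpa using h)).le))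

theorem gradient_cutoff_of_le {R : ℝ} (hR : 0 < R) {x : Plane} (hx : ‖x‖ ≤ R) :
    gradient (cutoff R) x = 0 := by
  have hmax : IsLocalMax (cutoff R) x := by
    refine Eventually.of_forall fun y => ?_
    rw [cutoff_eq_one hR hx]
    exact radialStep_le_one _ _ _
  rw [← norm_eq_zero, norm_gradient, hmax.fderiv_eq_zero, norm_zero]

theorem norm_gradient_cutoff_le {R : ℝ} (hR : 0 < R) (x : Plane) :
    ‖gradient (cutoff R) x‖ ≤ 6 * stepBound / R := by
  rcases le_or_gt ‖x‖ R with h | h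
  · rw [gradient_cutoff_of_le hR h]
    have := stepBound_pos
    simp only [norm_zero]
    positivity
  · rw [le_div_iff₀ hR, norm_gradient, mul_comm]
    refine le_trans ?_ ((norm_mul_norm_fderiv_radialStep_le 2 (-(R ^ 2)⁻¹) x).trans_eq ?_)
    · gcongr
      exact le_rfl
    · norm_num

/-! ### The chain rule and truncation -/

theorem abs_sub_le_of_hasDerivAt {F h : ℝ → ℝ} (hF : ∀ t, HasDerivAt F (h t) t)
    (hb : ∀ t, |h t| ≤ 1) (s t : ℝ) : |F s - F t| ≤ |s - t| := by
  have := Convex.norm_image_sub_le_of_norm_hasDerivWithin_le (C := 1)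
    (fun x _ => (hF x).hasDerivWithinAt) (fun x _ => hb x) convex_univ (mem_univ t) (mem_univ s)
  simpa using this

theorem tendsto_lintegral_enorm_sub_of_dominated {E : Type*} [NormedAddCommGroup E]
    {μ : Measure Plane} {H : ℕ → Plane → E} {k : Plane → E} {b : Plane → ℝ}
    (hH : ∀ n, AEStronglyMeasurable (H n) μ) (hk : AEStronglyMeasurable k μ)
    (hb : Integrable b μ) (hd : ∀ n, ∀ᵐ x ∂μ, ‖H n x - k x‖ ≤ b x)
    (ht : ∀ᵐ x ∂μ, Tendsto (fun n => H n x) atTop (𝓝 (k x))) :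
    Tendsto (fun n => ∫⁻ x, ‖H n x - k x‖ₑ ∂μ) atTop (𝓝 0) := by
  have := tendsto_lintegral_of_dominated_convergence' (μ := μ)
    (F := fun n x => ‖H n x - k x‖ₑ) (f := fun _ => 0) (fun x => ‖b x‖ₑ)
    (fun n => ((hH n).sub hk).enorm) (fun n => ?_) hb.2.ne ?_
  · simpa using this
  · filter_upwards [hd n] with x hx
    rw [← ofReal_norm, ← ofReal_norm]
    exact ENNReal.ofReal_le_ofReal (hx.trans (le_abs_self _))
  · filter_upwards [ht] with x hx
    have := (hx.sub_const (k x)).enorm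
    simpa using this

/-- Mollify `f` and pass to the limit. The values converge because `F` is 1-Lipschitz. The gradient
error splits into `h(fₙ)(Gₙ - G)`, small in `L¹`, and `(h(fₙ) - h(f)) G`, which tends to `0` by
dominated convergence. -/
theorem HasWeakGradient.chain_of_integrable {f : Plane → ℝ} {G : Plane → Plane}
    (hfG : HasWeakGradient f G) (hf : Integrable f) (hG : Integrable G) {F h : ℝ → ℝ}
    (hF : ∀ t, HasDerivAt F (h t) t) (hh : Continuous h) (hb : ∀ t, |h t| ≤ 1) (h0 : F 0 = 0) :
    HasWeakGradient (fun x => F (f x)) (fun x => h (f x) • G x) := by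
  have hFc : ContDiff ℝ 1 F := by
    rw [contDiff_one_iff_deriv]
    refine ⟨fun t => (hF t).differentiableAt, ?_⟩
    rwa [show deriv F = h from funext fun t => (hF t).deriv]
  have hlip := abs_sub_le_of_hasDerivAt hF hb
  have hm : ∀ n, ContDiff ℝ 1 (mollify n f) := fun n =>
    (contDiff_mollify n hfG.1).of_le (by exact_mod_cast le_top)
  have hw : ∀ n, HasWeakGradient (fun x => F (mollify n f x))
      (fun x => h (mollify n f x) • mollify n G x) := fun n => by
    have := HasWeakGradient.of_contDiff (hFc.comp (hm n))
    refine this.congr (ae_eq_refl _) (ae_of_all _ fun x => ?_)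
    have e := (hF (mollify n f x)).comp_hasFDerivAt x
      ((hm n).differentiable one_ne_zero x).hasFDerivAt
    rw [← hfG.fderiv_mollify n]
    simp [gradient, e.fderiv]
  have hFf : Integrable fun x => F (f x) := by
    refine hf.mono (hFc.continuous.comp_aestronglyMeasurable hf.1) (ae_of_all _ fun x => ?_)
    simpa [h0] using hlip (f x) 0
  have hhm : AEStronglyMeasurable (fun x => h (f x)) := hh.comp_aestronglyMeasurable hf.1
  have hhG : Integrable fun x => h (f x) • G x := by
    refine hG.mono (hhm.smul hG.1) (ae_of_all _ fun x => ?_)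
    rw [norm_smul]
    exact mul_le_of_le_one_left (norm_nonneg _) (hb _)
  have t1 := tendsto_eLpNorm_mollify_sub le_rfl ENNReal.one_ne_top (memLp_one_iff_integrable.2 hf)
  have t2 := tendsto_eLpNorm_mollify_sub le_rfl ENNReal.one_ne_top (memLp_one_iff_integrable.2 hG)
  simp only [eLpNorm_one_eq_lintegral_enorm, Pi.sub_apply] at t1 t2
  refine HasWeakGradient.of_tendsto (l := atTop) hw hFf.locallyIntegrable
    hhG.locallyIntegrable (fun K _ => ?_) (fun K _ => ?_)
  · refine tendsto_of_tendsto_of_tendsto_of_le_of_le tendsto_const_nhds t1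
      (fun _ => zero_le) fun n => ?_
    refine (setLIntegral_le_lintegral _ _).trans (lintegral_mono fun x => ?_)
    simp only [← ofReal_norm]
    exact ENNReal.ofReal_le_ofReal (hlip _ _)
  · have t3 : Tendsto (fun n => ∫⁻ x, ‖h (mollify n f x) • G x - h (f x) • G x‖ₑ) atTop (𝓝 0) := by
      refine tendsto_lintegral_enorm_sub_of_dominated (b := fun x => 2 * ‖G x‖)
        (fun n => (hh.comp (hm n).continuous).aestronglyMeasurable.smul hG.1) hhG.1
        (hG.norm.const_mul 2) (fun n => ae_of_all _ fun x => ?_) ?_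
      · rw [← sub_smul, norm_smul]
        gcongr
        have e1 : ‖h (mollify n f x)‖ ≤ 1 := hb _
        have e2 : ‖h (f x)‖ ≤ 1 := hb _
        exact (norm_sub_le _ _).trans (by linarith)
      · filter_upwards [ae_tendsto_mollify hfG.1] with x hx
        exact ((hh.tendsto _).comp hx).smul_const _
    have t4 := t2.add t3
    rw [add_zero] at t4
    refine tendsto_of_tendsto_of_tendsto_of_le_of_le tendsto_const_nhds t4
      (fun _ => zero_le) fun n => ?_
    refine (setLIntegral_le_lintegral _ _).trans ?_
    have hmm : AEMeasurable fun x => ‖mollify n G x - G x‖ₑ :=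
      ((contDiff_mollify n hfG.2.1).continuous.aestronglyMeasurable.sub hG.1).enorm
    rw [← lintegral_add_left' hmm]
    refine lintegral_mono fun x => ?_
    have e : h (mollify n f x) • mollify n G x - h (f x) • G x =
        h (mollify n f x) • (mollify n G x - G x) +
          (h (mollify n f x) • G x - h (f x) • G x) := by
      rw [smul_sub]; abel
    simp only [e]
    refine (enorm_add_le _ _).trans ?_
    gcongr
    simp only [← ofReal_norm, norm_smul]
    exact ENNReal.ofReal_le_ofReal (mul_le_of_le_one_left (norm_nonneg _) (hb _))

theorem HasWeakGradient.chain {f : Plane → ℝ} {G : Plane → Plane}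
    (hfG : HasWeakGradient f G) {F h : ℝ → ℝ}
    (hF : ∀ t, HasDerivAt F (h t) t) (hh : Continuous h) (hb : ∀ t, |h t| ≤ 1) (h0 : F 0 = 0) :
    HasWeakGradient (fun x => F (f x)) (fun x => h (f x) • G x) := by
  refine HasWeakGradient.of_forall_ball fun R hR => ?_
  have hχ := contDiff_cutoff R
  have hχ1 : ContDiff ℝ 1 (cutoff R) := hχ.of_le (by exact_mod_cast le_top)
  have hcs := hasCompactSupport_cutoff hR
  have hi1 : Integrable fun x => cutoff R x * f x :=
    hfG.1.integrable_smul_left_of_hasCompactSupport hχ.continuous hcs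
  have hi2 : Integrable fun x => cutoff R x • G x + f x • gradient (cutoff R) x :=
    (hfG.2.1.integrable_smul_left_of_hasCompactSupport hχ.continuous hcs).add
      (hfG.1.integrable_smul_right_of_hasCompactSupport (continuous_gradient hχ1)
        ((hcs.fderiv ℝ).comp_left (g := (InnerProductSpace.toDual ℝ Plane).symm) (by simp)))
  refine ⟨_, _, (hfG.smooth_mul hχ).chain_of_integrable hi1 hi2 hF hh hb h0, fun x hx => ?_⟩
  have hx' : ‖x‖ ≤ R := by simpa using (mem_ball_zero_iff.1 hx).le
  simp [cutoff_eq_one hR hx', gradient_cutoff_of_le hR hx']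

/-- Truncation to the unit interval. -/
def trunc (t : ℝ) : ℝ := max 0 (min t 1)

theorem trunc_nonneg (t : ℝ) : 0 ≤ trunc t := le_max_left _ _

theorem trunc_le_one (t : ℝ) : trunc t ≤ 1 := max_le zero_le_one (min_le_right _ _)

theorem trunc_eq_one {t : ℝ} (ht : 1 ≤ t) : trunc t = 1 := by simp [trunc, ht]

theorem abs_trunc_le (t : ℝ) : |trunc t| ≤ |t| := by
  rw [abs_of_nonneg (trunc_nonneg t)]
  exact max_le (abs_nonneg t) ((min_le_left _ _).trans (le_abs_self t))

theorem continuous_trunc : Continuous trunc := by unfold trunc; fun_prop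

theorem hasDerivAt_trunc {t : ℝ} (h0 : t ≠ 0) (h1 : t ≠ 1) :
    HasDerivAt trunc ((Ioo (0 : ℝ) 1).indicator 1 t) t := by
  rcases lt_or_gt_of_ne h0 with h | h
  · have e : trunc =ᶠ[𝓝 t] fun _ => 0 := by
      filter_upwards [Iio_mem_nhds h] with s hs
      exact max_eq_left ((min_le_left _ _).trans (le_of_lt hs))
    rw [indicator_of_notMem (fun h' => absurd h'.1 (not_lt.2 h.le))]
    exact (hasDerivAt_const t 0).congr_of_eventuallyEq e
  · rcases lt_or_gt_of_ne h1 with h' | h'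
    · have e : trunc =ᶠ[𝓝 t] fun s => s := by
        filter_upwards [Ioo_mem_nhds h h'] with s hs
        rw [trunc, min_eq_left hs.2.le, max_eq_right hs.1.le]
      rw [indicator_of_mem (show t ∈ Ioo (0 : ℝ) 1 from ⟨h, h'⟩)]
      exact (hasDerivAt_id t).congr_of_eventuallyEq e
    · have e : trunc =ᶠ[𝓝 t] fun _ => 1 := by
        filter_upwards [Ioi_mem_nhds h'] with s hs
        exact trunc_eq_one (le_of_lt hs)
      rw [indicator_of_notMem (fun h'' => absurd h''.2 (not_lt.2 h'.le))]
      exact (hasDerivAt_const t 1).congr_of_eventuallyEq e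

/-- Continuous functions that increase to the indicator of `(0, 1)`. -/
def plateau (n : ℕ) (t : ℝ) : ℝ := trunc (n * min t (1 - t))

theorem continuous_plateau (n : ℕ) : Continuous (plateau n) := by
  unfold plateau
  exact continuous_trunc.comp (by fun_prop)

theorem abs_plateau_le (n : ℕ) (t : ℝ) : |plateau n t| ≤ 1 := by
  rw [plateau, abs_of_nonneg (trunc_nonneg _)]
  exact trunc_le_one _

theorem tendsto_plateau (t : ℝ) :
    Tendsto (fun n => plateau n t) atTop (𝓝 ((Ioo (0 : ℝ) 1).indicator 1 t)) := by
  refine tendsto_const_nhds.congr' ?_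
  by_cases h : t ∈ Ioo (0 : ℝ) 1
  · have hpos : 0 < min t (1 - t) := lt_min h.1 (by linarith [h.2])
    obtain ⟨N, hN⟩ := exists_nat_ge (1 / min t (1 - t))
    filter_upwards [eventually_ge_atTop N] with n hn
    rw [indicator_of_mem h, plateau, trunc_eq_one]
    · rfl
    · rw [← div_le_iff₀ hpos]
      exact hN.trans (by exact_mod_cast hn)
  · refine Eventually.of_forall fun n => ?_
    rw [indicator_of_notMem h]
    symm
    refine max_eq_left ((min_le_left _ _).trans (mul_nonpos_of_nonneg_of_nonpos n.cast_nonneg ?_))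
    by_contra hc
    exact h ⟨(not_le.1 hc).trans_le (min_le_left _ _), by
      linarith [(not_le.1 hc).trans_le (min_le_right t (1 - t))]⟩

/-- The primitives of the plateaus are `C¹` approximations of `trunc` to which the chain rule
applies. -/
theorem tendsto_integral_plateau (t : ℝ) :
    Tendsto (fun n => ∫ s in (0 : ℝ)..t, plateau n s) atTop (𝓝 (trunc t)) := by
  have hm : Measurable ((Ioo (0 : ℝ) 1).indicator (1 : ℝ → ℝ)) :=
    measurable_one.indicator measurableSet_Ioo
  have e : ∫ s in (0 : ℝ)..t, (Ioo (0 : ℝ) 1).indicator 1 s = trunc t := by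
    have := MeasureTheory.integral_eq_of_hasDerivAt_off_countable trunc
      ((Ioo (0 : ℝ) 1).indicator 1) (a := 0) (b := t) (s := {0, 1}) (by simp)
      continuous_trunc.continuousOn
      (fun x hx => hasDerivAt_trunc (fun h => hx.2 (by simp [h])) (fun h => hx.2 (by simp [h]))) ?_
    · rw [this]; simp [trunc]
    · refine (intervalIntegrable_const (c := (1 : ℝ))).mono_fun hm.aestronglyMeasurable
        (ae_of_all _ fun x => ?_)
      by_cases hx : x ∈ Ioo (0 : ℝ) 1 <;> simp [hx]
  rw [← e]
  refine intervalIntegral.tendsto_integral_filter_of_dominated_convergence (fun _ => 1)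
    (Eventually.of_forall fun n => (continuous_plateau n).aestronglyMeasurable)
    (Eventually.of_forall fun n => ae_of_all _ fun s _ => abs_plateau_le n s)
    intervalIntegrable_const (ae_of_all _ fun s _ => tendsto_plateau s)

/-- The gradient of the truncation of a function with weak gradient `g`. -/
def truncGrad (u : Plane → ℝ) (g : Plane → Plane) (x : Plane) : Plane :=
  (Ioo (0 : ℝ) 1).indicator (1 : ℝ → ℝ) (u x) • g x

theorem norm_truncGrad_le (u : Plane → ℝ) (g : Plane → Plane) (x : Plane) :
    ‖truncGrad u g x‖ ≤ ‖g x‖ := by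
  unfold truncGrad
  by_cases hx : u x ∈ Ioo (0 : ℝ) 1 <;> simp [hx]

/-- Dominated convergence with majorants `2|u|` and `2‖g‖`. Since every plateau vanishes at `0` and
`1`, the limiting gradient is `0` on the level sets `u = 0` and `u = 1`, with no separate argument
there. -/
theorem HasWeakGradient.trunc {u : Plane → ℝ} {g : Plane → Plane} (h : HasWeakGradient u g) :
    HasWeakGradient (fun x => trunc (u x)) (truncGrad u g) := by
  have hF : ∀ n t, HasDerivAt (fun t => ∫ s in (0 : ℝ)..t, plateau n s) (plateau n t) t :=
    fun n t => intervalIntegral.integral_hasDerivAt_right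
      ((continuous_plateau n).intervalIntegrable _ _)
      ((continuous_plateau n).stronglyMeasurableAtFilter _ _) (continuous_plateau n).continuousAt
  have hw := fun n => h.chain (hF n) (continuous_plateau n) (abs_plateau_le n) (by simp)
  have hum := h.1.aestronglyMeasurable
  have hgm := h.2.1.aestronglyMeasurable
  have hm : Measurable ((Ioo (0 : ℝ) 1).indicator (1 : ℝ → ℝ)) :=
    measurable_one.indicator measurableSet_Ioo
  have hgm' : AEStronglyMeasurable (truncGrad u g) :=
    (hm.comp_aemeasurable hum.aemeasurable).aestronglyMeasurable.smul hgm
  have hum' : AEStronglyMeasurable fun x => Zhikov.trunc (u x) :=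
    continuous_trunc.comp_aestronglyMeasurable hum
  have hle : ∀ n t, |∫ s in (0 : ℝ)..t, plateau n s| ≤ |t| := fun n t => by
    simpa using abs_sub_le_of_hasDerivAt (hF n) (abs_plateau_le n) t 0
  refine HasWeakGradient.of_tendsto (l := atTop) hw (h.1.mono hum' (ae_of_all _ fun x =>
    abs_trunc_le _)) (h.2.1.mono hgm' (ae_of_all _ fun x => norm_truncGrad_le _ _ _))
    (fun K hK => ?_) (fun K hK => ?_)
  · refine tendsto_lintegral_enorm_sub_of_dominated (b := fun x => 2 * ‖u x‖)
      (fun n => (hw n).1.aestronglyMeasurable.restrict) hum'.restrict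
      ((h.1.integrableOn_isCompact hK).norm.const_mul 2) (fun n => ae_of_all _ fun x => ?_)
      (ae_of_all _ fun x => tendsto_integral_plateau _)
    refine (norm_sub_le _ _).trans ?_
    simp only [Real.norm_eq_abs]
    linarith [hle n (u x), abs_trunc_le (u x)]
  · refine tendsto_lintegral_enorm_sub_of_dominated (b := fun x => 2 * ‖g x‖)
      (fun n => (hw n).2.1.aestronglyMeasurable.restrict) hgm'.restrict
      ((h.2.1.integrableOn_isCompact hK).norm.const_mul 2) (fun n => ae_of_all _ fun x => ?_)
      (ae_of_all _ fun x => (tendsto_plateau _).smul_const _)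
    refine (norm_sub_le _ _).trans ?_
    have e1 := norm_truncGrad_le u g x
    have e2 : ‖plateau n (u x) • g x‖ ≤ ‖g x‖ := by
      rw [norm_smul]
      exact mul_le_of_le_one_left (norm_nonneg _) (abs_plateau_le n _)
    linarith

/-! ### The energy as an extended nonnegative number -/

/-- The squared norm of `(u, g)` in `L²(μ) × L²(μ)`. -/
def sobolevEnergy (μ : Measure Plane) (u : Plane → ℝ) (g : Plane → Plane) : ℝ≥0∞ :=
  ∫⁻ x, ‖g x‖ₑ ^ 2 ∂μ + ∫⁻ x, ‖u x‖ₑ ^ 2 ∂μ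

theorem memLp_two_iff {E : Type*} [NormedAddCommGroup E] {μ : Measure Plane} {f : Plane → E}
    (hf : AEStronglyMeasurable f μ) : MemLp f 2 μ ↔ ∫⁻ x, ‖f x‖ₑ ^ 2 ∂μ < ⊤ := by
  rw [MemLp, and_iff_right hf,
    eLpNorm_lt_top_iff_lintegral_rpow_enorm_lt_top two_ne_zero ENNReal.ofNat_ne_top]
  simp

theorem sobolevEnergy_congr {μ : Measure Plane} {u v : Plane → ℝ} {g k : Plane → Plane}
    (hu : u =ᵐ[μ] v) (hg : g =ᵐ[μ] k) : sobolevEnergy μ u g = sobolevEnergy μ v k := by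
  unfold sobolevEnergy
  congr 1
  · exact lintegral_congr_ae (hg.mono fun x hx => by simp only [hx])
  · exact lintegral_congr_ae (hu.mono fun x hx => by simp only [hx])

/-- Finiteness matters: a divergent Bochner integral has the default value `0`, and the two sides
would differ. -/
theorem ofReal_formOne {μ : Measure Plane} {u : Plane → ℝ}
    (hu : AEStronglyMeasurable u μ) (hg : AEStronglyMeasurable (weakGradient u) μ)
    (h : sobolevEnergy μ u (weakGradient u) < ⊤) :
    ENNReal.ofReal (formOne μ (energy μ) u u) = sobolevEnergy μ u (weakGradient u) := by
  obtain ⟨h1, h2⟩ := ENNReal.add_lt_top.1 h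
  have e1 : energy μ u u = (∫⁻ x, ‖weakGradient u x‖ₑ ^ 2 ∂μ).toReal := by
    unfold energy
    rw [integral_eq_lintegral_of_nonneg_ae (ae_of_all _ fun x => real_inner_self_nonneg)
      (hg.inner hg)]
    congr 1
    refine lintegral_congr fun x => ?_
    rw [real_inner_self_eq_norm_sq, ENNReal.ofReal_pow (norm_nonneg _), ofReal_norm]
  have e2 : ∫ x, u x * u x ∂μ = (∫⁻ x, ‖u x‖ₑ ^ 2 ∂μ).toReal := by
    rw [integral_eq_lintegral_of_nonneg_ae (ae_of_all _ fun x => mul_self_nonneg _) (hu.mul hu)]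
    congr 1
    refine lintegral_congr fun x => ?_
    rw [← ofReal_norm, ← ENNReal.ofReal_pow (norm_nonneg _), Real.norm_eq_abs, sq_abs, sq]
  rw [formOne, e1, e2, ENNReal.ofReal_add ENNReal.toReal_nonneg ENNReal.toReal_nonneg,
    ENNReal.ofReal_toReal h1.ne, ENNReal.ofReal_toReal h2.ne, sobolevEnergy]

theorem hasWeakGradient_weakGradient {u : Plane → ℝ} (h : u ∈ SobolevLoc) :
    HasWeakGradient u (weakGradient u) := by
  unfold weakGradient
  rw [dif_pos (show ∃ g, HasWeakGradient u g from h)]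
  exact (show ∃ g, HasWeakGradient u g from h).choose_spec

/-- The gradient chosen in `weakGradient` agrees a.e. with any explicit one, so membership and
energy may be computed from an explicit pair `(u, g)`. -/
theorem HasWeakGradient.mem_spaceW {μ : Measure Plane} (hμ : μ ≪ volume) {u : Plane → ℝ}
    {g : Plane → Plane} (h : HasWeakGradient u g) (hE : sobolevEnergy μ u g < ⊤) :
    u ∈ spaceW μ ∧ ENNReal.ofReal (formOne μ (energy μ) u u) = sobolevEnergy μ u g := by
  have hs : u ∈ SobolevLoc := ⟨g, h⟩
  have hw := hasWeakGradient_weakGradient hs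
  have hum : AEStronglyMeasurable u μ := h.1.aestronglyMeasurable.mono_ac hμ
  have hgm : AEStronglyMeasurable (weakGradient u) μ := hw.2.1.aestronglyMeasurable.mono_ac hμ
  have e := sobolevEnergy_congr (ae_eq_refl (μ := μ) u) (hμ.ae_eq (h.unique hw))
  have hE' := hE
  rw [e] at hE
  obtain ⟨h1, h2⟩ := ENNReal.add_lt_top.1 hE
  exact ⟨⟨hs, (memLp_two_iff hum).2 h2, (memLp_two_iff hgm).2 h1⟩, by
    rw [ofReal_formOne hum hgm hE, e]⟩

theorem exists_of_mem_spaceW {μ : Measure Plane} (hμ : μ ≪ volume) {u : Plane → ℝ}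
    (h : u ∈ spaceW μ) : ∃ g, HasWeakGradient u g ∧ sobolevEnergy μ u g < ⊤ ∧
      ENNReal.ofReal (formOne μ (energy μ) u u) = sobolevEnergy μ u g := by
  have hw := hasWeakGradient_weakGradient h.1
  have hE : sobolevEnergy μ u (weakGradient u) < ⊤ := by
    refine ENNReal.add_lt_top.2 ⟨?_, ?_⟩
    · exact (memLp_two_iff h.2.2.1).1 h.2.2
    · exact (memLp_two_iff h.2.1.1).1 h.2.1
  exact ⟨_, hw, hE, (hw.mem_spaceW hμ hE).2⟩

/-- Young's inequality with a leading constant close to `1`, so that adding a function of tiny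
energy costs nothing in the limit. -/
theorem enorm_add_sq_le {E : Type*} [NormedAddCommGroup E] {δ : ℝ} (hδ : 0 < δ) (x y : E) :
    ‖x + y‖ₑ ^ 2 ≤ ENNReal.ofReal (1 + δ) * ‖x‖ₑ ^ 2 + ENNReal.ofReal (1 + δ⁻¹) * ‖y‖ₑ ^ 2 := by
  simp only [← ofReal_norm]
  rw [← ENNReal.ofReal_pow (norm_nonneg _), ← ENNReal.ofReal_pow (norm_nonneg _),
    ← ENNReal.ofReal_pow (norm_nonneg _), ← ENNReal.ofReal_mul (by positivity),
    ← ENNReal.ofReal_mul (by positivity), ← ENNReal.ofReal_add (by positivity) (by positivity)]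
  refine ENNReal.ofReal_le_ofReal ?_
  have h1 : ‖x + y‖ ^ 2 ≤ (‖x‖ + ‖y‖) ^ 2 := by gcongr; exact norm_add_le _ _
  have h2 : 2 * (‖x‖ * ‖y‖) ≤ δ * ‖x‖ ^ 2 + δ⁻¹ * ‖y‖ ^ 2 := by
    have h3 : 0 ≤ δ⁻¹ * (δ * ‖x‖ - ‖y‖) ^ 2 := by positivity
    have h4 : δ⁻¹ * (δ * ‖x‖ - ‖y‖) ^ 2 = δ * ‖x‖ ^ 2 + δ⁻¹ * ‖y‖ ^ 2 - 2 * (‖x‖ * ‖y‖) := by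
      field_simp
      ring
    linarith
  linarith

theorem lintegral_enorm_add_sq_le {E : Type*} [NormedAddCommGroup E] {μ : Measure Plane}
    {δ : ℝ} (hδ : 0 < δ) {f : Plane → E} (hf : AEStronglyMeasurable f μ) (k : Plane → E) :
    ∫⁻ x, ‖f x + k x‖ₑ ^ 2 ∂μ ≤ ENNReal.ofReal (1 + δ) * ∫⁻ x, ‖f x‖ₑ ^ 2 ∂μ +
      ENNReal.ofReal (1 + δ⁻¹) * ∫⁻ x, ‖k x‖ₑ ^ 2 ∂μ := by
  rw [← lintegral_const_mul' _ _ ENNReal.ofReal_ne_top,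
    ← lintegral_const_mul' _ _ ENNReal.ofReal_ne_top,
    ← lintegral_add_left' ((hf.enorm.pow_const _).const_mul _)]
  exact lintegral_mono fun x => enorm_add_sq_le hδ _ _

theorem sobolevEnergy_add_le {μ : Measure Plane} {δ : ℝ} (hδ : 0 < δ) {u v : Plane → ℝ}
    {g k : Plane → Plane} (hu : AEStronglyMeasurable u μ) (hg : AEStronglyMeasurable g μ) :
    sobolevEnergy μ (u + v) (g + k) ≤ ENNReal.ofReal (1 + δ) * sobolevEnergy μ u g +
      ENNReal.ofReal (1 + δ⁻¹) * sobolevEnergy μ v k := by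
  refine (add_le_add (lintegral_enorm_add_sq_le hδ hg k)
    (lintegral_enorm_add_sq_le hδ hu v)).trans_eq ?_
  unfold sobolevEnergy
  ring

theorem sobolevEnergy_trunc_le (μ : Measure Plane) (u : Plane → ℝ) (g : Plane → Plane) :
    sobolevEnergy μ (fun x => trunc (u x)) (truncGrad u g) ≤ sobolevEnergy μ u g := by
  refine add_le_add (lintegral_mono fun x => ?_) (lintegral_mono fun x => ?_)
  · simp only [← ofReal_norm]
    gcongr
    exact norm_truncGrad_le _ _ _
  · simp only [← ofReal_norm]
    gcongr
    exact abs_trunc_le _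

/-! ### Transfer between the plane and the split plane -/

theorem SplitPlane.continuous_proj : Continuous SplitPlane.proj := by
  refine continuous_iff_continuousAt.2 fun p => ?_
  rw [Metric.continuousAt_iff]
  intro ε hε
  refine ⟨ε, hε, fun {q} hq => ?_⟩
  rw [SplitPlane.dist_def] at hq
  rw [dist_eq_norm]
  linarith [abs_nonneg (SplitPlane.psiZero q - SplitPlane.psiZero p)]

theorem SplitPlane.continuous_psiZero : Continuous SplitPlane.psiZero := by
  refine continuous_iff_continuousAt.2 fun p => ?_
  rw [Metric.continuousAt_iff]
  intro ε hε
  refine ⟨ε, hε, fun {q} hq => ?_⟩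
  rw [SplitPlane.dist_def] at hq
  rw [Real.dist_eq]
  linarith [norm_nonneg (SplitPlane.proj q - SplitPlane.proj p)]

/-- Composing with `proj` gives the subtype inclusion, so the map is an embedding; its range is the
open set where `proj` is nonzero. -/
theorem measurableEmbedding_punctured : MeasurableEmbedding SplitPlane.punctured := by
  have he : Topology.IsEmbedding SplitPlane.punctured :=
    Topology.IsEmbedding.of_comp continuous_punctured SplitPlane.continuous_proj
      (Topology.IsEmbedding.subtypeVal : Topology.IsEmbedding
        ((↑) : {x : Plane // x ≠ 0} → Plane))
  have hr : range SplitPlane.punctured = SplitPlane.proj ⁻¹' {0}ᶜ := by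
    ext p
    constructor
    · rintro ⟨x, rfl⟩
      exact x.2
    · intro hp
      cases p with
      | punctured x => exact ⟨x, rfl⟩
      | plus => exact absurd rfl hp
      | minus => exact absurd rfl hp
      | arc z => exact absurd rfl hp
  refine he.measurableEmbedding ?_
  rw [hr]
  exact (isOpen_compl_singleton.preimage SplitPlane.continuous_proj).measurableSet

theorem ae_muSplit {μ : Measure Plane} (P : SplitPlane → Prop) :
    (∀ᵐ p ∂(muSplit μ), P p) ↔ ∀ᵐ x ∂μ, ∀ hx : x ≠ 0, P (.punctured ⟨x, hx⟩) := by
  have hm : MeasurableSet {x : Plane | x ≠ 0} := (measurableSet_singleton (0 : Plane)).compl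
  rw [muSplit, measurableEmbedding_punctured.ae_map_iff]
  rw [ae_iff, ae_iff]
  refine (Eq.congr_left ((MeasurableEmbedding.subtype_coe hm).comap_apply μ _)).trans ?_
  congr! 2
  ext x
  simp

theorem integral_muSplit {μ : Measure Plane} (h0 : μ {0} = 0) (v : SplitPlane → ℝ) :
    ∫ p, v p * v p ∂(muSplit μ) = ∫ x, toPlane v x * toPlane v x ∂μ := by
  have hm : MeasurableSet {x : Plane | x ≠ 0} := (measurableSet_singleton (0 : Plane)).compl
  rw [muSplit, measurableEmbedding_punctured.integral_map]
  have e : ∀ x : {x : Plane // x ≠ 0}, v (.punctured x) * v (.punctured x) =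
      toPlane v x * toPlane v x := fun x => by
    simp [toPlane, x.2]
  simp only [e]
  have := integral_subtype_comap (μ := μ) hm fun x => toPlane v x * toPlane v x
  refine this.trans ?_
  congr 1
  refine Measure.restrict_eq_self_of_ae_mem ?_
  rw [ae_iff]
  simpa using h0

theorem formOne_split {μ : Measure Plane} (h0 : μ {0} = 0) (v : SplitPlane → ℝ) :
    formOne (muSplit μ) (energySplit μ) v v = formOne μ (energy μ) (toPlane v) (toPlane v) := by
  rw [formOne, formOne, integral_muSplit h0, energySplit]

namespace IsSplitWeight

variable {ρ : Plane → ℝ≥0∞}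

theorem ae_withDensity (hρ : IsSplitWeight ρ) (P : Plane → Prop) :
    (∀ᵐ x ∂(volume.withDensity ρ), P x) ↔ ∀ᵐ x, P x := by
  rw [ae_withDensity_iff hρ.measurable]
  simp [hρ.ne_zero]

end IsSplitWeight

/-! ### Capacities expressed through explicit pairs of a function and its weak gradient. -/

section Capacity

variable {a : ℝ → ℝ≥0∞}

theorem mu_absolutelyContinuous (a : ℝ → ℝ≥0∞) : mu a ≪ volume :=
  withDensity_absolutelyContinuous _ _

theorem mu_singleton_zero (a : ℝ → ℝ≥0∞) : mu a {0} = 0 :=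
  mu_absolutelyContinuous a (measure_singleton 0)

theorem ae_mu (ha : IsAdmissible a) (P : Plane → Prop) : (∀ᵐ x ∂(mu a), P x) ↔ ∀ᵐ x, P x :=
  ha.isSplitWeight.ae_withDensity P

/-- The competitor on the split plane is `f ∘ proj`. Since `toPlane` puts the value `0` at the
origin, it returns `f` only almost everywhere. -/
theorem capW_le (ha : IsAdmissible a) {B A : Set SplitPlane} (hA : IsOpen A) (hBA : B ⊆ A) {f : Plane → ℝ}
    {g : Plane → Plane} (h : HasWeakGradient f g) (hE : sobolevEnergy (mu a) f g < ⊤)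
    (h1 : ∀ᵐ x, ∀ hx : x ≠ 0, SplitPlane.punctured ⟨x, hx⟩ ∈ A → 1 ≤ f x) :
    capW a B ≤ sobolevEnergy (mu a) f g := by
  have hμ := mu_absolutelyContinuous a
  have hz := mu_singleton_zero a
  have htp : f =ᵐ[volume] toPlane fun p => f p.proj := by
    have : ∀ᵐ x : Plane, x ≠ 0 := by
      rw [ae_iff]
      simp
    filter_upwards [this] with x hx
    simp [toPlane, hx, SplitPlane.proj]
  have h' := h.congr htp (ae_eq_refl g)
  have e := sobolevEnergy_congr (hμ.ae_eq htp) (ae_eq_refl (μ := mu a) g)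
  obtain ⟨m1, m2⟩ := h'.mem_spaceW hμ (e ▸ hE)
  refine iInf₂_le_of_le A ⟨hA, hBA⟩ (iInf₂_le_of_le (fun p => f p.proj) ⟨m1, ?_⟩ ?_)
  · rw [ae_muSplit]
    exact (ae_mu ha _).2 h1
  · rw [formOne_split hz, m2, e]

theorem exists_of_capW_lt (ha : IsAdmissible a) {B : Set SplitPlane} {c : ℝ≥0∞} (h : capW a B < c) :
    ∃ (A : Set SplitPlane) (f : Plane → ℝ) (g : Plane → Plane), IsOpen A ∧ B ⊆ A ∧
      HasWeakGradient f g ∧ sobolevEnergy (mu a) f g < ⊤ ∧ sobolevEnergy (mu a) f g < c ∧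
      ∀ᵐ x, ∀ hx : x ≠ 0, SplitPlane.punctured ⟨x, hx⟩ ∈ A → 1 ≤ f x := by
  have hμ := mu_absolutelyContinuous a
  have hz := mu_singleton_zero a
  simp only [capW, cap, capOpen, iInf_lt_iff] at h
  obtain ⟨A, hA, v, hv, h⟩ := h
  obtain ⟨g, hg, hE, he⟩ := exists_of_mem_spaceW hμ hv.1
  rw [formOne_split hz, he] at h
  refine ⟨A, toPlane v, g, hA.1, hA.2, hg, hE, h, ?_⟩
  have := (ae_mu ha _).1 ((ae_muSplit _).1 hv.2)
  filter_upwards [this] with x hx h0 hxA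
  rw [toPlane, dif_neg h0]
  exact hx h0 hxA

theorem capH_le (ha : IsAdmissible a) {B A : Set Plane} (hA : IsOpen A) (hBA : B ⊆ A) {f : Plane → ℝ}
    {g : Plane → Plane} (h : HasWeakGradient f g) (hE : sobolevEnergy (mu a) f g < ⊤)
    (h1 : ∀ᵐ x, x ∈ A → 1 ≤ f x)
    (hap : ∀ δ : ℝ≥0∞, 0 < δ → ∃ φ ∈ TestFunctions, sobolevEnergy (mu a) φ (gradient φ) < ⊤ ∧
      sobolevEnergy (mu a) (f - φ) (g - gradient φ) < δ) :
    capH a B ≤ sobolevEnergy (mu a) f g := by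
  have hμ := mu_absolutelyContinuous a
  obtain ⟨m1, m2⟩ := h.mem_spaceW hμ hE
  refine iInf₂_le_of_le A ⟨hA, hBA⟩ (iInf₂_le_of_le f ⟨⟨m1, fun ε hε => ?_⟩, ?_⟩ m2.le)
  · obtain ⟨φ, hφ, hφE, hlt⟩ := hap (ENNReal.ofReal ε) (by simpa using hε)
    have hw := HasWeakGradient.of_contDiff (TestFunctions.contDiff hφ)
    refine ⟨φ, hφ, (hw.mem_spaceW hμ hφE).1, ?_⟩
    obtain ⟨-, e⟩ := (h.sub hw).mem_spaceW hμ (hlt.trans ENNReal.ofReal_lt_top)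
    rw [← e] at hlt
    exact (ENNReal.ofReal_lt_ofReal_iff hε).1 hlt
  · exact (ae_mu ha _).2 h1

theorem exists_of_capH_lt (ha : IsAdmissible a) {B : Set Plane} {c : ℝ≥0∞} (h : capH a B < c) :
    ∃ (A : Set Plane) (f : Plane → ℝ) (g : Plane → Plane), IsOpen A ∧ B ⊆ A ∧
      HasWeakGradient f g ∧ sobolevEnergy (mu a) f g < ⊤ ∧ sobolevEnergy (mu a) f g < c ∧
      ∀ᵐ x, x ∈ A → 1 ≤ f x := by
  have hμ := mu_absolutelyContinuous a
  simp only [capH, cap, capOpen, iInf_lt_iff] at h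
  obtain ⟨A, hA, v, hv, h⟩ := h
  obtain ⟨g, hg, hE, he⟩ := exists_of_mem_spaceW hμ hv.1.1
  rw [he] at h
  exact ⟨A, v, g, hA.1, hA.2, hg, hE, h, (ae_mu ha _).1 hv.2⟩

/-- A neighbourhood of the origin pulls back along `proj` to a neighbourhood of both points, and
`spaceH` is contained in `spaceW`. -/
theorem capW_le_capH (ha : IsAdmissible a) : capW a {SplitPlane.plus, SplitPlane.minus} ≤ capH a {0} := by
  refine le_of_forall_gt fun c hc => ?_
  obtain ⟨A, f, g, hA, h0, h, hE, hlt, h1⟩ := exists_of_capH_lt ha hc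
  refine (capW_le ha (A := SplitPlane.proj ⁻¹' A) (hA.preimage SplitPlane.continuous_proj) ?_ h hE
    ?_).trans_lt hlt
  · rintro p (rfl | rfl)
    · exact h0 rfl
    · exact h0 rfl
  · filter_upwards [h1] with x hx _ hxA
    exact hx hxA

end Capacity

/-! ### Density of test functions -/

theorem tendsto_lintegral_enorm_sq_zero {E : Type*} [NormedAddCommGroup E] {μ : Measure Plane}
    {H : ℕ → Plane → E} {b : Plane → ℝ} (hH : ∀ n, AEStronglyMeasurable (H n) μ)
    (hb : MemLp b 2 μ) (hd : ∀ᶠ n in atTop, ∀ x, ‖H n x‖ ≤ b x)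
    (ht : ∀ x, Tendsto (fun n => H n x) atTop (𝓝 0)) :
    Tendsto (fun n => ∫⁻ x, ‖H n x‖ₑ ^ 2 ∂μ) atTop (𝓝 0) := by
  have := tendsto_lintegral_filter_of_dominated_convergence' (μ := μ) (l := atTop)
    (F := fun n x => ‖H n x‖ₑ ^ 2) (f := fun _ => 0) (fun x => ‖b x‖ₑ ^ 2)
    (Eventually.of_forall fun n => (hH n).enorm.pow_const _) ?_ ((memLp_two_iff hb.1).1 hb).ne ?_
  · simpa using this
  · filter_upwards [hd] with n hn
    refine ae_of_all _ fun x => ?_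
    simp only [← ofReal_norm]
    gcongr
    exact (hn x).trans (le_abs_self _)
  · refine ae_of_all _ fun x => ?_
    have := ENNReal.Tendsto.pow (n := 2) (ht x).enorm
    simpa using this

namespace IsSplitWeight

variable {ρ : Plane → ℝ≥0∞}

theorem isFiniteMeasureOnCompacts (hρ : IsSplitWeight ρ) :
    IsFiniteMeasureOnCompacts (volume.withDensity ρ) := by
  refine ⟨fun K hK => ?_⟩
  rw [withDensity_apply _ hK.measurableSet]
  exact (hρ.lintegral_compact hK).1

theorem sobolevEnergy_testFunction (hρ : IsSplitWeight ρ) {φ : Plane → ℝ} (hφ : φ ∈ TestFunctions) :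
    sobolevEnergy (volume.withDensity ρ) φ (gradient φ) < ⊤ := by
  have := hρ.isFiniteMeasureOnCompacts
  have h1 := continuous_gradient (TestFunctions.contDiff hφ)
  have h2 : HasCompactSupport (gradient φ) :=
    (hφ.2.fderiv ℝ).comp_left (g := (InnerProductSpace.toDual ℝ Plane).symm) (by simp)
  exact ENNReal.add_lt_top.2 ⟨(memLp_two_iff h1.aestronglyMeasurable).1
      (h1.memLp_of_hasCompactSupport h2),
    (memLp_two_iff (TestFunctions.continuous hφ).aestronglyMeasurable).1
      ((TestFunctions.continuous hφ).memLp_of_hasCompactSupport hφ.2)⟩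

/-- Away from the origin `μ` and Lebesgue measure are comparable, so for functions vanishing near
the origin unweighted convergence results transfer to `μ`. -/
theorem exists_comparison (hρ : IsSplitWeight ρ) {ε : ℝ} (hε : 0 < ε) :
    ∃ C : ℝ≥0∞, C ≠ ⊤ ∧ ∀ F : Plane → ℝ≥0∞, (∀ x, ‖x‖ ≤ ε → F x = 0) →
      ∫⁻ x, F x ∂(volume.withDensity ρ) ≤ C * ∫⁻ x, F x ∧
      ∫⁻ x, F x ≤ C * ∫⁻ x, F x ∂(volume.withDensity ρ) := by
  obtain ⟨c, hc, h⟩ := hρ.bounds ε hε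
  have hc0 : ENNReal.ofReal c ≠ 0 := by simpa using hc
  refine ⟨(ENNReal.ofReal c)⁻¹, by simpa using hc, fun F hF => ?_⟩
  have e : ∫⁻ x, F x ∂(volume.withDensity ρ) = ∫⁻ x, ρ x * F x :=
    lintegral_withDensity_eq_lintegral_mul_non_measurable _ hρ.measurable
      (ae_of_all _ fun x => (hρ.ne_top x).lt_top) F
  rw [e, ← lintegral_const_mul' _ _ (by simpa using hc),
    ← lintegral_const_mul' _ _ (by simpa using hc)]
  refine ⟨lintegral_mono fun x => ?_, lintegral_mono fun x => ?_⟩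
  · rcases le_or_gt ‖x‖ ε with hx | hx
    · simp [hF x hx]
    · gcongr
      exact ENNReal.le_inv_iff_le_inv.1 (h x hx).2
  · rcases le_or_gt ‖x‖ ε with hx | hx
    · simp [hF x hx]
    · rw [← mul_assoc]
      refine le_mul_of_one_le_left' ?_
      rw [← ENNReal.inv_mul_cancel hc0 ENNReal.ofReal_ne_top]
      gcongr
      exact (h x hx).1

theorem memLp_volume (hρ : IsSplitWeight ρ) {E : Type*} [NormedAddCommGroup E] {f : Plane → E}
    (hf : MemLp f 2 (volume.withDensity ρ)) (hm : AEStronglyMeasurable f) {ε : ℝ} (hε : 0 < ε)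
    {b : E} (hb : ∀ x ∈ Metric.ball (0 : Plane) ε, f x = b) : MemLp f 2 := by
  obtain ⟨C, hC, h⟩ := hρ.exists_comparison (half_pos hε)
  have hball : MeasurableSet (Metric.ball (0 : Plane) ε) := Metric.isOpen_ball.measurableSet
  rw [memLp_two_iff hm, ← lintegral_add_compl _ hball]
  refine ENNReal.add_lt_top.2 ⟨?_, ?_⟩
  · rw [setLIntegral_congr_fun hball (g := fun _ => ‖b‖ₑ ^ 2) fun x hx => by simp only [hb x hx],
      setLIntegral_const]
    exact ENNReal.mul_lt_top (by simp) measure_ball_lt_top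
  · rw [← lintegral_indicator hball.compl]
    refine ((h _ fun x hx => ?_).2).trans_lt (ENNReal.mul_lt_top hC.lt_top ?_)
    · exact indicator_of_notMem (by simp; linarith) _
    · exact (lintegral_mono fun x => indicator_le_self _ _ x).trans_lt ((memLp_two_iff hf.1).1 hf)

/-- Once the mollification radius is below `ε / 2`, a function constant on the `ε`-ball is unchanged
on the `ε / 2`-ball. The error then lives where the weight is harmless. -/
theorem tendsto_lintegral_mollify (hρ : IsSplitWeight ρ) {E : Type} [NormedAddCommGroup E]
    [NormedSpace ℝ E] [CompleteSpace E] {f : Plane → E} (hf : MemLp f 2 (volume.withDensity ρ))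
    (hm : AEStronglyMeasurable f) {ε : ℝ} (hε : 0 < ε)
    {b : E} (hb : ∀ x ∈ Metric.ball (0 : Plane) ε, f x = b) :
    Tendsto (fun n => ∫⁻ x, ‖f x - mollify n f x‖ₑ ^ 2 ∂(volume.withDensity ρ)) atTop (𝓝 0) := by
  obtain ⟨C, hC, h⟩ := hρ.exists_comparison (half_pos hε)
  have hv := hρ.memLp_volume hf hm hε hb
  have t1 := tendsto_eLpNorm_mollify_sub one_le_two ENNReal.ofNat_ne_top hv
  have t2 := (ENNReal.Tendsto.pow (n := 2) t1)
  have t3 := ENNReal.Tendsto.const_mul t2 (Or.inr hC)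
  simp only [ne_eq, OfNat.ofNat_ne_zero, not_false_eq_true, zero_pow, mul_zero] at t3
  refine tendsto_of_tendsto_of_tendsto_of_le_of_le' tendsto_const_nhds t3
    (Eventually.of_forall fun _ => zero_le) ?_
  filter_upwards [tendsto_rOut_bump.eventually_lt_const (half_pos hε)] with n hn
  refine ((h _ fun x hx => ?_).1).trans_eq ?_
  · have hx' : x ∈ Metric.ball (0 : Plane) ε := by simp; linarith
    rw [mollify_eq_of_forall_ball n fun y hy => ?_]
    · simp
    · rw [hb x hx']
      refine hb y ?_
      rw [mem_ball_iff_norm] at hy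
      rw [mem_ball_zero_iff]
      have := norm_add_le (y - x) x
      rw [sub_add_cancel] at this
      linarith
  · rw [eLpNorm_eq_lintegral_rpow_enorm_toReal two_ne_zero ENNReal.ofNat_ne_top,
      ← ENNReal.rpow_natCast, ← ENNReal.rpow_mul]
    simp [enorm_sub_rev]

/-- Cut off at infinity, then mollify. Constancy near the origin is what keeps the singularity of
the weight out of the mollification error. -/
theorem exists_testFunction_approx (hρ : IsSplitWeight ρ) {w : Plane → ℝ} {g : Plane → Plane}
    (h : HasWeakGradient w g) (hE : sobolevEnergy (volume.withDensity ρ) w g < ⊤)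
    {ε b : ℝ} (hε : 0 < ε) (hw : ∀ x ∈ Metric.ball (0 : Plane) ε, w x = b)
    (hg : ∀ x ∈ Metric.ball (0 : Plane) ε, g x = 0) {δ : ℝ≥0∞} (hδ : 0 < δ) :
    ∃ φ ∈ TestFunctions, sobolevEnergy (volume.withDensity ρ) φ (gradient φ) < ⊤ ∧
      sobolevEnergy (volume.withDensity ρ) (w - φ) (g - gradient φ) < δ := by
  set μ := volume.withDensity ρ with hμdef
  have hμ : μ ≪ volume := withDensity_absolutelyContinuous _ _
  obtain ⟨hE1, hE2⟩ := ENNReal.add_lt_top.1 hE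
  have hwm := h.1.aestronglyMeasurable.mono_ac hμ
  have hgm := h.2.1.aestronglyMeasurable.mono_ac hμ
  have hwL : MemLp w 2 μ := (memLp_two_iff hwm).2 hE2
  have hgL : MemLp g 2 μ := (memLp_two_iff hgm).2 hE1
  let f : ℕ → Plane → ℝ := fun n x => cutoff (n + 1) x * w x
  let G : ℕ → Plane → Plane := fun n x =>
    cutoff (n + 1) x • g x + w x • gradient (cutoff (n + 1)) x
  have hpos : ∀ n : ℕ, (0 : ℝ) < n + 1 := fun n => by positivity
  have hfG : ∀ n, HasWeakGradient (f n) (G n) := fun n => h.smooth_mul (contDiff_cutoff _)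
  have hfm : ∀ n, AEStronglyMeasurable (f n) μ := fun n => (hfG n).1.aestronglyMeasurable.mono_ac hμ
  have hGm : ∀ n, AEStronglyMeasurable (G n) μ := fun n =>
    (hfG n).2.1.aestronglyMeasurable.mono_ac hμ
  have hc01 : ∀ n x, |1 - cutoff n x| ≤ 1 := fun n x => by
    rw [abs_le]
    constructor <;> linarith [radialStep_nonneg 2 (-(n ^ 2)⁻¹) x, radialStep_le_one 2 (-(n ^ 2)⁻¹) x,
      show cutoff n x = radialStep 2 (-(n ^ 2)⁻¹) x from rfl]
  have hgb : ∀ (n : ℕ) x, ‖w x • gradient (cutoff (n + 1)) x‖ ≤ 6 * stepBound * ‖w x‖ := fun n x => by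
    rw [norm_smul, mul_comm]
    refine mul_le_mul_of_nonneg_right ((norm_gradient_cutoff_le (hpos n) x).trans ?_) (norm_nonneg _)
    exact div_le_self (by have := stepBound_pos; positivity) (by simp)
  have hev : ∀ x : Plane, ∀ᶠ n : ℕ in atTop, ‖x‖ ≤ n + 1 := fun x => by
    obtain ⟨N, hN⟩ := exists_nat_ge ‖x‖
    filter_upwards [eventually_ge_atTop N] with n hn
    have : (N : ℝ) ≤ n := by exact_mod_cast hn
    linarith
  have t1 : Tendsto (fun n => ∫⁻ x, ‖w x - f n x‖ₑ ^ 2 ∂μ) atTop (𝓝 0) := by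
    refine tendsto_lintegral_enorm_sq_zero (fun n => hwm.sub (hfm n)) hwL.norm
      (Eventually.of_forall fun n x => ?_) fun x => ?_
    · have : w x - f n x = (1 - cutoff (n + 1) x) * w x := by simp only [f]; ring
      rw [this, norm_mul]
      exact mul_le_of_le_one_left (norm_nonneg _) (hc01 _ x)
    · refine tendsto_const_nhds.congr' ?_
      filter_upwards [hev x] with n hn
      simp [f, cutoff_eq_one (hpos n) hn]
  have t2 : Tendsto (fun n => ∫⁻ x, ‖g x - G n x‖ₑ ^ 2 ∂μ) atTop (𝓝 0) := by
    refine tendsto_lintegral_enorm_sq_zero (b := fun x => ‖g x‖ + 6 * stepBound * ‖w x‖)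
      (fun n => hgm.sub (hGm n)) (hgL.norm.add (hwL.norm.const_mul _))
      (Eventually.of_forall fun n x => ?_) fun x => ?_
    · have : g x - G n x = (1 - cutoff (n + 1) x) • g x - w x • gradient (cutoff (n + 1)) x := by
        simp only [G, sub_smul, one_smul]; abel
      rw [this]
      refine (norm_sub_le _ _).trans (add_le_add ?_ (hgb n x))
      rw [norm_smul]
      exact mul_le_of_le_one_left (norm_nonneg _) (hc01 _ x)
    · refine tendsto_const_nhds.congr' ?_
      filter_upwards [hev x] with n hn
      simp [G, cutoff_eq_one (hpos n) hn, gradient_cutoff_of_le (hpos n) hn]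
  have tA : Tendsto (fun n => ENNReal.ofReal (1 + 1) * sobolevEnergy μ (w - f n) (g - G n)) atTop
      (𝓝 0) := by
    have := ENNReal.Tendsto.const_mul (t2.add t1)
      (Or.inr (ENNReal.ofReal_ne_top (r := 1 + 1)))
    simpa [sobolevEnergy] using this
  -- The vector `single 0 ε` has norm `ε`; the second condition says that the cutoff is still `1` on
  -- the `ε`-ball, so the cut-off function stays constant there.
  obtain ⟨n, hnA, hnε⟩ := ((tA.eventually_lt_const (ENNReal.half_pos hδ.ne')).and
    (hev (EuclideanSpace.single 0 ε))).exists
  have hnε' : ε ≤ n + 1 := by simpa [abs_of_pos hε] using hnε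
  have hfb : ∀ x ∈ Metric.ball (0 : Plane) ε, f n x = b := fun x hx => by
    have : ‖x‖ ≤ n + 1 := (mem_ball_zero_iff.1 hx).le.trans hnε'
    simp [f, cutoff_eq_one (hpos n) this, hw x hx]
  have hGb : ∀ x ∈ Metric.ball (0 : Plane) ε, G n x = 0 := fun x hx => by
    have : ‖x‖ ≤ n + 1 := (mem_ball_zero_iff.1 hx).le.trans hnε'
    simp [G, hg x hx, gradient_cutoff_of_le (hpos n) this]
  have hfL : MemLp (f n) 2 μ := by
    refine hwL.mono (hfm n) (ae_of_all _ fun x => ?_)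
    rw [norm_mul]
    exact mul_le_of_le_one_left (norm_nonneg _) (abs_cutoff_le_one _ x)
  have hGL : MemLp (G n) 2 μ := by
    refine (hgL.norm.add (hwL.norm.const_mul (6 * stepBound))).mono (hGm n)
      (ae_of_all _ fun x => ?_)
    refine (norm_add_le _ _).trans ((add_le_add ?_ (hgb n x)).trans (le_abs_self _))
    rw [norm_smul]
    exact mul_le_of_le_one_left (norm_nonneg _) (abs_cutoff_le_one _ x)
  have t3 := hρ.tendsto_lintegral_mollify hfL (hfG n).1.aestronglyMeasurable hε hfb
  have t4 := hρ.tendsto_lintegral_mollify hGL (hfG n).2.1.aestronglyMeasurable hε hGb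
  have tB : Tendsto (fun m => ENNReal.ofReal (1 + 1⁻¹) *
      sobolevEnergy μ (f n - mollify m (f n)) (G n - mollify m (G n))) atTop (𝓝 0) := by
    have := ENNReal.Tendsto.const_mul (t4.add t3)
      (Or.inr (ENNReal.ofReal_ne_top (r := 1 + 1⁻¹)))
    simpa [sobolevEnergy] using this
  obtain ⟨m, hm⟩ := (tB.eventually_lt_const (ENNReal.half_pos hδ.ne')).exists
  have hφ : mollify m (f n) ∈ TestFunctions :=
    ⟨contDiff_mollify m (hfG n).1,
      hasCompactSupport_mollify m (hasCompactSupport_cutoff (hpos n)).mul_right⟩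
  refine ⟨_, hφ, hρ.sobolevEnergy_testFunction hφ, ?_⟩
  have key := sobolevEnergy_add_le (μ := μ) one_pos (u := w - f n) (g := g - G n)
    (v := f n - mollify m (f n)) (k := G n - mollify m (G n)) (hwm.sub (hfm n)) (hgm.sub (hGm n))
  rw [sub_add_sub_cancel, sub_add_sub_cancel] at key
  rw [(hfG n).fderiv_mollify m]
  refine key.trans_lt ?_
  rw [← ENNReal.add_halves δ]
  exact ENNReal.add_lt_add hnA hm

end IsSplitWeight

/-! ### A point is removable for weak gradients bounded by a multiple of `1 / ‖x‖` -/

theorem locallyIntegrable_inv_norm : LocallyIntegrable fun x : Plane => ‖x‖⁻¹ := by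
  intro x
  refine ⟨Metric.ball 0 (‖x‖ + 1), Metric.isOpen_ball.mem_nhds (by simp), ?_⟩
  rw [integrableOn_fun_norm_addHaar (volume : Measure Plane) (f := fun r : ℝ => r⁻¹)]
  have : IntegrableOn (fun _ : ℝ => (1 : ℝ)) (Ioo 0 (‖x‖ + 1)) := by
    simp
  refine this.congr_fun (fun r hr => ?_) measurableSet_Ioo
  have : r ≠ 0 := hr.1.ne'
  simp [this]

theorem measurable_gradient (u : Plane → ℝ) : Measurable (gradient u) :=
  (LinearIsometryEquiv.continuous _).measurable.comp (measurable_fderiv ℝ u)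

theorem ae_ne_zero : ∀ᵐ x : Plane, x ≠ 0 := by
  rw [ae_iff]
  simp

theorem aestronglyMeasurable_of_contDiffAt {u : Plane → ℝ} (hu : ∀ x ≠ 0, ContDiffAt ℝ 1 u x) :
    AEStronglyMeasurable u := by
  have h : ContinuousOn u {0}ᶜ := fun x hx => (hu x hx).continuousAt.continuousWithinAt
  have := h.aestronglyMeasurable (μ := volume) (measurableSet_singleton (0 : Plane)).compl
  rwa [restrict_compl_singleton] at this

/-- Multiply by steps that vanish for `‖x‖ ≤ 1/k` and equal `1` for `‖x‖ ≥ 2/k`. By scale invariance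
their gradients are bounded by a multiple of `1/‖x‖` independent of `k`, and `1/‖x‖` is locally
integrable in the plane, so dominated convergence applies. -/
theorem HasWeakGradient.of_contDiffAt {u : Plane → ℝ} {C : ℝ} (hu : ∀ x ≠ 0, ContDiffAt ℝ 1 u x)
    (hb : ∀ x, |u x| ≤ 1) (hC : ∀ x ≠ 0, ‖x‖ * ‖fderiv ℝ u x‖ ≤ C) :
    HasWeakGradient u (gradient u) := by
  have hum := aestronglyMeasurable_of_contDiffAt hu
  have hgm := (measurable_gradient u).aestronglyMeasurable (μ := volume)
  have hgle : ∀ x ≠ 0, ‖gradient u x‖ ≤ C * ‖x‖⁻¹ := fun x hx => by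
    rw [norm_gradient, ← div_eq_mul_inv, le_div_iff₀ (norm_pos_iff.2 hx), mul_comm]
    exact hC x hx
  have hul : LocallyIntegrable u :=
    ((continuous_const (y := (1 : ℝ))).locallyIntegrable).mono hum
      (ae_of_all _ fun x => by simpa using hb x)
  have hgl : LocallyIntegrable (gradient u) := by
    refine (locallyIntegrable_inv_norm.smul C).mono hgm ?_
    filter_upwards [ae_ne_zero] with x hx
    exact (hgle x hx).trans (le_abs_self _)
  let θ : ℕ → Plane → ℝ := fun k => radialStep (-1) ((k : ℝ) ^ 2)
  have hθ0 : ∀ (k : ℕ) x, (k : ℝ) * ‖x‖ ≤ 1 → θ k x = 0 := fun k x hx => by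
    refine Real.smoothTransition.zero_of_nonpos ?_
    have : ((k : ℝ) * ‖x‖) ^ 2 ≤ 1 := pow_le_one₀ (by positivity) hx
    nlinarith
  have hθ1 : ∀ (k : ℕ) x, 2 ≤ (k : ℝ) * ‖x‖ → θ k x = 1 := fun k x hx => by
    refine Real.smoothTransition.one_of_one_le ?_
    have : (2 : ℝ) ^ 2 ≤ ((k : ℝ) * ‖x‖) ^ 2 := by gcongr
    nlinarith
  have hθc : ∀ k, ContDiff ℝ 1 (θ k) := fun k =>
    (contDiff_radialStep _ _).of_le (by exact_mod_cast le_top)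
  let U : ℕ → Plane → ℝ := fun k x => θ k x * u x
  have hU : ∀ k, ContDiff ℝ 1 (U k) := fun k => by
    rw [contDiff_iff_contDiffAt]
    intro x
    by_cases hx : x = 0
    · have e : U k =ᶠ[𝓝 x] fun _ => 0 := by
        have : ∀ᶠ y : Plane in 𝓝 x, (k : ℝ) * ‖y‖ < 1 := by
          have hc : Continuous fun y : Plane => (k : ℝ) * ‖y‖ := by fun_prop
          exact hc.continuousAt.eventually_lt_const (by simp [hx])
        filter_upwards [this] with y hy
        simp [U, hθ0 k y hy.le]
      exact contDiffAt_const.congr_of_eventuallyEq e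
    · exact (hθc k).contDiffAt.mul (hu x hx)
  have hgU : ∀ k, ∀ x ≠ 0, gradient (U k) x = θ k x • gradient u x + u x • gradient (θ k) x := by
    intro k x hx
    have e := fderiv_fun_mul ((hθc k).differentiable one_ne_zero x)
      ((hu x hx).differentiableAt one_ne_zero)
    have e' : fderiv ℝ (U k) x = θ k x • fderiv ℝ u x + u x • fderiv ℝ (θ k) x := e
    simp [gradient, e']
  have hθa : ∀ k x, |θ k x| ≤ 1 := fun k x =>
    (abs_of_nonneg (radialStep_nonneg _ _ x)).trans_le (radialStep_le_one _ _ x)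
  have hev : ∀ x : Plane, x ≠ 0 → ∀ᶠ k : ℕ in atTop, 2 < (k : ℝ) * ‖x‖ := fun x hx => by
    have := (tendsto_natCast_atTop_atTop (R := ℝ)).atTop_mul_const (norm_pos_iff.2 hx)
    exact this.eventually_gt_atTop 2
  refine HasWeakGradient.of_tendsto (l := atTop) (fun k => HasWeakGradient.of_contDiff (hU k))
    hul hgl (fun K hK => ?_) (fun K hK => ?_)
  · have : IsFiniteMeasure (volume.restrict K) := ⟨by simpa using hK.measure_lt_top⟩
    refine tendsto_lintegral_enorm_sub_of_dominated (b := fun _ => 2)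
      (fun k => (hU k).continuous.aestronglyMeasurable) hum.restrict (integrable_const _)
      (fun k => ae_of_all _ fun x => ?_) ?_
    · have h1 : ‖U k x‖ ≤ 1 := by
        rw [norm_mul]
        exact mul_le_one₀ (hθa k x) (norm_nonneg _) (hb x)
      have h2 : ‖u x‖ ≤ 1 := hb x
      exact (norm_sub_le _ _).trans (by linarith)
    · filter_upwards [ae_restrict_of_ae ae_ne_zero] with x hx
      refine tendsto_const_nhds.congr' ?_
      filter_upwards [hev x hx] with k hk
      simp [U, hθ1 k x hk.le]
  · refine tendsto_lintegral_enorm_sub_of_dominated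
      (b := fun x => (2 * C + 4 * stepBound) * ‖x‖⁻¹)
      (fun k => (measurable_gradient _).aestronglyMeasurable) hgm.restrict
      ((locallyIntegrable_inv_norm.integrableOn_isCompact hK).const_mul _) (fun k => ?_) ?_
    · filter_upwards [ae_restrict_of_ae ae_ne_zero] with x hx
      have h1 : ‖θ k x • gradient u x‖ ≤ C * ‖x‖⁻¹ := by
        rw [norm_smul]
        exact (mul_le_of_le_one_left (norm_nonneg _) (hθa k x)).trans (hgle x hx)
      have h2 : ‖u x • gradient (θ k) x‖ ≤ 4 * stepBound * ‖x‖⁻¹ := by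
        rw [norm_smul]
        refine (mul_le_of_le_one_left (norm_nonneg _) (hb x)).trans ?_
        rw [norm_gradient, ← div_eq_mul_inv, le_div_iff₀ (norm_pos_iff.2 hx), mul_comm]
        refine (norm_mul_norm_fderiv_radialStep_le _ _ x).trans_eq ?_
        norm_num
      rw [hgU k x hx]
      refine (norm_sub_le _ _).trans ((add_le_add (norm_add_le _ _) le_rfl).trans ?_)
      linarith [hgle x hx]
    · filter_upwards [ae_restrict_of_ae ae_ne_zero] with x hx
      refine tendsto_const_nhds.congr' ?_
      filter_upwards [hev x hx] with k hk
      have e : U k =ᶠ[𝓝 x] u := by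
        have hc : Continuous fun y : Plane => (k : ℝ) * ‖y‖ := by fun_prop
        filter_upwards [hc.continuousAt.eventually_const_lt hk] with y hy
        simp [U, hθ1 k y hy.le]
      simp [gradient, e.fderiv_eq]

/-! ### Functions concentrated on sectors -/

/-- A function of the angle that is positive on the second and fourth quadrants. -/
def angle (x : Plane) : ℝ := -(x 0 * x 1) * (‖x‖ ^ 2)⁻¹

theorem contDiffAt_angle {x : Plane} (hx : x ≠ 0) : ContDiffAt ℝ (⊤ : ℕ∞) angle x := by
  have h0 : ∀ i : Fin 2, ContDiff ℝ (⊤ : ℕ∞) fun x : Plane => x i := fun i =>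
    (EuclideanSpace.proj (𝕜 := ℝ) i).contDiff
  exact (((h0 0).mul (h0 1)).neg.contDiffAt).mul
    ((contDiff_norm_sq ℝ).contDiffAt.inv (by simpa using hx))

/-- The function is homogeneous of degree zero. The constant is `2` from differentiating `‖x‖⁻²`
plus `1 + 1` from the two coordinates. -/
theorem norm_mul_norm_fderiv_angle_le {x : Plane} (hx : x ≠ 0) :
    ‖x‖ * ‖fderiv ℝ angle x‖ ≤ 4 := by
  have hn : 0 < ‖x‖ := norm_pos_iff.2 hx
  have hp : ∀ i : Fin 2, HasFDerivAt (fun x : Plane => x i) (EuclideanSpace.proj i : Plane →L[ℝ] ℝ) x :=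
    fun i => (EuclideanSpace.proj (𝕜 := ℝ) i).hasFDerivAt
  have h1 : HasFDerivAt (fun x : Plane => ‖x‖ ^ 2) (2 • innerSL ℝ x) x :=
    (hasStrictFDerivAt_norm_sq x).hasFDerivAt
  have h2 := (hasDerivAt_inv (pow_pos hn 2).ne').comp_hasFDerivAt x h1
  have h3 := ((hp 0).mul (hp 1)).neg.mul h2
  have e : fderiv ℝ angle x = _ := h3.fderiv
  have hx0 : |x 0| ≤ ‖x‖ := PiLp.norm_apply_le x 0
  have hx1 : |x 1| ≤ ‖x‖ := PiLp.norm_apply_le x 1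
  rw [e, ← le_div_iff₀' hn]
  refine ContinuousLinearMap.opNorm_le_bound _ (by positivity) fun v => ?_
  have hv0 : |v 0| ≤ ‖v‖ := PiLp.norm_apply_le v 0
  have hv1 : |v 1| ≤ ‖v‖ := PiLp.norm_apply_le v 1
  have hin : |inner ℝ x v| ≤ ‖x‖ * ‖v‖ := abs_real_inner_le_norm x v
  simp only [Function.comp_apply, add_apply, smul_apply, neg_apply, smul_eq_mul, innerSL_apply_apply,
    nsmul_eq_mul, Nat.cast_ofNat,
    PiLp.proj_apply, Real.norm_eq_abs]
  have a1 : |x 0 * x 1| ≤ ‖x‖ ^ 2 := by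
    rw [abs_mul, sq]; gcongr
  have a2 : |x 0 * v 1| ≤ ‖x‖ * ‖v‖ := by
    rw [abs_mul]; gcongr
  have a3 : |x 1 * v 0| ≤ ‖x‖ * ‖v‖ := by
    rw [abs_mul]; gcongr
  have b1 : |x 0 * x 1 * (‖x‖ ^ 2)⁻¹| ≤ 1 := by
    rw [abs_mul, abs_of_pos (inv_pos.2 (pow_pos hn 2)), ← div_eq_mul_inv, div_le_one (pow_pos hn 2)]
    exact a1
  have b2 : |x 0 * x 1 * (‖x‖ ^ 2)⁻¹ * (2 * inner ℝ x v)| ≤ 2 * (‖x‖ * ‖v‖) := by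
    rw [abs_mul, abs_mul 2, abs_two]
    calc _ ≤ 1 * (2 * (‖x‖ * ‖v‖)) := by gcongr
      _ = _ := one_mul _
  have b3 : |x 0 * x 1 * (‖x‖ ^ 2)⁻¹ * (2 * inner ℝ x v) - (x 0 * v 1 + x 1 * v 0)| ≤
      4 * (‖x‖ * ‖v‖) := by
    refine (abs_sub _ _).trans ?_
    linarith [abs_add_le (x 0 * v 1) (x 1 * v 0)]
  calc _ = |(‖x‖ ^ 2)⁻¹ * (x 0 * x 1 * (‖x‖ ^ 2)⁻¹ * (2 * inner ℝ x v) -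
        (x 0 * v 1 + x 1 * v 0))| := by
        congr 1
        simp only [Pi.neg_apply, Pi.mul_apply]
        field_simp
        ring
    _ ≤ (‖x‖ ^ 2)⁻¹ * (4 * (‖x‖ * ‖v‖)) := by
        rw [abs_mul, abs_of_pos (inv_pos.2 (pow_pos hn 2))]
        gcongr
    _ = 4 / ‖x‖ * ‖v‖ := by field_simp

/-- A bounded function that is `1` where `angle x ≥ 2 * c` and `‖x‖ ≤ R`, and vanishes where
`angle x ≤ c` or `‖x‖ ≥ 2 * R`. -/
def sector (c R : ℝ) (x : Plane) : ℝ :=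
  Real.smoothTransition (c⁻¹ * angle x - 1) * cutoff R x

theorem sector_nonneg (c R : ℝ) (x : Plane) : 0 ≤ sector c R x :=
  mul_nonneg (Real.smoothTransition.nonneg _) (radialStep_nonneg _ _ _)

theorem abs_sector_le_one (c R : ℝ) (x : Plane) : |sector c R x| ≤ 1 := by
  rw [abs_of_nonneg (sector_nonneg c R x)]
  exact mul_le_one₀ (Real.smoothTransition.le_one _) (radialStep_nonneg _ _ _)
    (radialStep_le_one _ _ _)

theorem sector_eq_one {c R : ℝ} (hc : 0 < c) (hR : 0 < R) {x : Plane} (h : 2 * c ≤ angle x)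
    (hx : ‖x‖ ≤ R) : sector c R x = 1 := by
  rw [sector, cutoff_eq_one hR hx, Real.smoothTransition.one_of_one_le, one_mul]
  have : 2 ≤ c⁻¹ * angle x := by
    rw [le_inv_mul_iff₀ hc]
    linarith
  linarith

theorem contDiffAt_sector (c R : ℝ) {x : Plane} (hx : x ≠ 0) : ContDiffAt ℝ 1 (sector c R) x := by
  have h1 : ContDiffAt ℝ 1 angle x := (contDiffAt_angle hx).of_le (by exact_mod_cast le_top)
  exact (Real.smoothTransition.contDiffAt.comp x ((contDiffAt_const.mul h1).sub
    contDiffAt_const)).mul ((contDiff_cutoff R).contDiffAt.of_le (by exact_mod_cast le_top))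

theorem fderiv_sector (c R : ℝ) {x : Plane} (hx : x ≠ 0) :
    fderiv ℝ (sector c R) x =
      Real.smoothTransition (c⁻¹ * angle x - 1) • fderiv ℝ (cutoff R) x +
      (cutoff R x * (deriv Real.smoothTransition (c⁻¹ * angle x - 1) * c⁻¹)) •
        fderiv ℝ angle x := by
  have h1 : HasFDerivAt angle (fderiv ℝ angle x) x :=
    ((contDiffAt_angle hx).differentiableAt (by simp)).hasFDerivAt
  have h2 := (hasDerivAt_smoothTransition (c⁻¹ * angle x - 1)).comp_hasFDerivAt x
    ((h1.const_mul c⁻¹).sub_const 1)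
  have h3 : HasFDerivAt (cutoff R) (fderiv ℝ (cutoff R) x) x :=
    ((contDiff_cutoff R).differentiable (by simp) x).hasFDerivAt
  rw [show fderiv ℝ (sector c R) x = _ from (h2.mul h3).fderiv]
  ext v
  simp
  ring

theorem norm_mul_norm_fderiv_sector_le {c : ℝ} (hc : 0 < c) (R : ℝ) {x : Plane} (hx : x ≠ 0) :
    ‖x‖ * ‖fderiv ℝ (sector c R) x‖ ≤ 6 * stepBound + 4 * stepBound * c⁻¹ := by
  have h1 := norm_mul_norm_fderiv_radialStep_le 2 (-(R ^ 2)⁻¹) x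
  have h2 := norm_mul_norm_fderiv_angle_le hx
  have hs := stepBound_pos
  rw [fderiv_sector c R hx]
  have e1 : ‖Real.smoothTransition (c⁻¹ * angle x - 1) • fderiv ℝ (cutoff R) x‖ ≤
      ‖fderiv ℝ (cutoff R) x‖ := by
    rw [norm_smul]
    refine mul_le_of_le_one_left (norm_nonneg _) ?_
    rw [Real.norm_eq_abs, abs_of_nonneg (Real.smoothTransition.nonneg _)]
    exact Real.smoothTransition.le_one _
  have e2 : ‖(cutoff R x * (deriv Real.smoothTransition (c⁻¹ * angle x - 1) * c⁻¹)) •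
      fderiv ℝ angle x‖ ≤ (stepBound * c⁻¹) * ‖fderiv ℝ angle x‖ := by
    rw [norm_smul]
    gcongr
    rw [norm_mul, norm_mul, Real.norm_eq_abs, Real.norm_eq_abs, Real.norm_eq_abs,
      abs_of_pos (inv_pos.2 hc)]
    calc _ ≤ 1 * (stepBound * c⁻¹) := by
          gcongr
          · exact abs_cutoff_le_one R x
          · exact abs_deriv_smoothTransition_le _
      _ = _ := one_mul _
  have h3 : ‖x‖ * ‖fderiv ℝ (cutoff R) x‖ ≤ 6 * stepBound := by
    refine h1.trans_eq ?_
    norm_num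
  calc ‖x‖ * _ ≤ ‖x‖ * (‖fderiv ℝ (cutoff R) x‖ + (stepBound * c⁻¹) * ‖fderiv ℝ angle x‖) := by
        gcongr
        exact (norm_add_le _ _).trans (add_le_add e1 e2)
    _ = ‖x‖ * ‖fderiv ℝ (cutoff R) x‖ + (stepBound * c⁻¹) * (‖x‖ * ‖fderiv ℝ angle x‖) := by ring
    _ ≤ 6 * stepBound + (stepBound * c⁻¹) * 4 := by gcongr
    _ = _ := by ring

theorem sector_eq_zero {c R : ℝ} (hc : 0 < c) (hR : 0 < R) {x : Plane}
    (h : 0 ≤ x 0 * x 1 ∨ 2 * R ≤ ‖x‖) : sector c R x = 0 := by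
  rcases h with h | h
  · rw [sector, Real.smoothTransition.zero_of_nonpos, zero_mul]
    have : c⁻¹ * angle x ≤ 0 := by
      refine mul_nonpos_of_nonneg_of_nonpos (by positivity) ?_
      exact mul_nonpos_of_nonpos_of_nonneg (by linarith) (by positivity)
    linarith
  · rw [sector, cutoff_eq_zero hR h, mul_zero]

/-- A zero of a nonnegative function is a minimum; this covers the axes, the outer circle and the
origin without case distinction. -/
theorem gradient_sector_eq_zero {c R : ℝ} (hc : 0 < c) (hR : 0 < R) {x : Plane}
    (h : 0 ≤ x 0 * x 1 ∨ 2 * R ≤ ‖x‖) : gradient (sector c R) x = 0 := by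
  have hmin : IsLocalMin (sector c R) x := by
    refine Eventually.of_forall fun y => ?_
    rw [sector_eq_zero hc hR h]
    exact sector_nonneg _ _ _
  rw [← norm_eq_zero, norm_gradient, hmin.fderiv_eq_zero, norm_zero]

theorem hasWeakGradient_sector {c : ℝ} (hc : 0 < c) (R : ℝ) :
    HasWeakGradient (sector c R) (gradient (sector c R)) :=
  HasWeakGradient.of_contDiffAt (fun _ hx => contDiffAt_sector c R hx) (abs_sector_le_one c R)
    fun _ hx => norm_mul_norm_fderiv_sector_le hc R hx

namespace IsSplitWeight

variable {ρ : Plane → ℝ≥0∞}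

/-- Both the function and its gradient are at most a multiple of `1/‖x‖`, uniformly in `R`, and
vanish outside the second and fourth quadrants of the `2R`-ball. The energy is thus controlled by
the integral of `ρ/‖x‖²` over that set, which vanishes as `R → 0` by absolute continuity. -/
theorem exists_sobolevEnergy_sector_lt (hρ : IsSplitWeight ρ) {c : ℝ} (hc : 0 < c) {r : ℝ}
    (hr : 0 < r) {δ : ℝ≥0∞} (hδ : 0 < δ) :
    ∃ R : ℝ, 0 < R ∧ R < r ∧
      sobolevEnergy (volume.withDensity ρ) (sector c R) (gradient (sector c R)) < δ := by
  set D : ℝ := 6 * stepBound + 4 * stepBound * c⁻¹ with hD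
  have hD0 : 0 ≤ D := by have := stepBound_pos; positivity
  set Q : Set Plane := {x : Plane | ‖x‖ < 1 ∧ x 0 * x 1 < 0} with hQ
  have hm0 : Measurable fun x : Plane => x 0 * x 1 := by fun_prop
  have hQm : MeasurableSet Q := (measurableSet_lt measurable_norm measurable_const).inter
    (measurableSet_lt hm0 measurable_const)
  let F : Plane → ℝ≥0∞ := fun x => ρ x * (ENNReal.ofReal (‖x‖ ^ 2))⁻¹
  have hb : ∀ R : ℝ, 0 < R → 2 * R < 1 →
      sobolevEnergy (volume.withDensity ρ) (sector c R) (gradient (sector c R)) ≤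
        ENNReal.ofReal (D ^ 2 + 1) * ∫⁻ x in Metric.ball 0 (2 * R), F x ∂(volume.restrict Q) := by
    intro R hR hR1
    have hbm : MeasurableSet (Metric.ball (0 : Plane) (2 * R)) := Metric.isOpen_ball.measurableSet
    have hpt : ∀ x : Plane, ρ x * (‖gradient (sector c R) x‖ₑ ^ 2 + ‖sector c R x‖ₑ ^ 2) ≤
        (Metric.ball 0 (2 * R) ∩ Q).indicator (fun x => ENNReal.ofReal (D ^ 2 + 1) * F x) x := by
      intro x
      by_cases hx : x ∈ Metric.ball 0 (2 * R) ∩ Q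
      · have hx0 : x ≠ 0 := by
          rintro rfl
          simpa using hx.2.2
        have hn : 0 < ‖x‖ := norm_pos_iff.2 hx0
        rw [indicator_of_mem hx, mul_left_comm]
        refine mul_le_mul_right ?_ _
        rw [← ofReal_norm, ← ofReal_norm, ← ENNReal.ofReal_pow (norm_nonneg _),
          ← ENNReal.ofReal_pow (norm_nonneg _), ← ENNReal.ofReal_add (by positivity) (by positivity),
          ← ENNReal.ofReal_inv_of_pos (by positivity), ← ENNReal.ofReal_mul (by positivity)]
        refine ENNReal.ofReal_le_ofReal ?_
        rw [← div_eq_mul_inv, le_div_iff₀ (by positivity)]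
        have h1 : ‖x‖ * ‖gradient (sector c R) x‖ ≤ D := by
          rw [norm_gradient]
          exact norm_mul_norm_fderiv_sector_le hc R hx0
        have h2 : ‖x‖ * ‖sector c R x‖ ≤ 1 :=
          mul_le_one₀ hx.2.1.le (norm_nonneg _) (abs_sector_le_one c R x)
        calc _ = (‖x‖ * ‖gradient (sector c R) x‖) ^ 2 + (‖x‖ * ‖sector c R x‖) ^ 2 := by ring
          _ ≤ D ^ 2 + 1 ^ 2 := by gcongr
          _ = _ := by ring
      · have h : 0 ≤ x 0 * x 1 ∨ 2 * R ≤ ‖x‖ := by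
          by_contra hcon
          push Not at hcon
          exact hx ⟨by simpa using hcon.2, by linarith, hcon.1⟩
        rw [gradient_sector_eq_zero hc hR h, sector_eq_zero hc hR h]
        simp
    have hgm : Measurable fun x => ‖gradient (sector c R) x‖ₑ ^ 2 :=
      (measurable_gradient _).enorm.pow_const _
    unfold sobolevEnergy
    rw [← lintegral_add_left hgm,
      lintegral_withDensity_eq_lintegral_mul_non_measurable _ hρ.measurable
        (ae_of_all _ fun x => (hρ.ne_top x).lt_top), Measure.restrict_restrict hbm,
      ← lintegral_const_mul' _ _ ENNReal.ofReal_ne_top, ← lintegral_indicator (hbm.inter hQm)]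
    exact lintegral_mono hpt
  have hvol : Tendsto (fun R : ℝ => (volume.restrict Q) (Metric.ball (0 : Plane) (2 * R)))
      (𝓝[>] 0) (𝓝 0) := by
    have h1 : Tendsto (fun R : ℝ => volume (Metric.ball (0 : Plane) (2 * R))) (𝓝[>] 0) (𝓝 0) := by
      have e : ∀ R : ℝ, 0 < R → volume (Metric.ball (0 : Plane) (2 * R)) =
          ENNReal.ofReal ((2 * R) ^ 2) * volume (Metric.ball (0 : Plane) 1) := fun R hR => by
        rw [Measure.addHaar_ball volume _ (by positivity)]
        simp
      have h2 : Tendsto (fun R : ℝ => ENNReal.ofReal ((2 * R) ^ 2) *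
          volume (Metric.ball (0 : Plane) 1)) (𝓝[>] 0) (𝓝 0) := by
        have h3 : Tendsto (fun R : ℝ => ENNReal.ofReal ((2 * R) ^ 2)) (𝓝[>] 0) (𝓝 0) := by
          have hc : Continuous fun R : ℝ => ENNReal.ofReal ((2 * R) ^ 2) :=
            ENNReal.continuous_ofReal.comp (by fun_prop)
          have := hc.tendsto 0
          simp only [mul_zero, ne_eq, OfNat.ofNat_ne_zero, not_false_eq_true, zero_pow,
            ENNReal.ofReal_zero] at this
          exact this.mono_left nhdsWithin_le_nhds
        have h4 := ENNReal.Tendsto.mul_const h3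
          (Or.inr (measure_ball_lt_top (μ := volume) (x := (0 : Plane)) (r := 1)).ne)
        rwa [zero_mul] at h4
      refine h2.congr' ?_
      filter_upwards [self_mem_nhdsWithin] with R hR
      exact (e R hR).symm
    exact tendsto_of_tendsto_of_tendsto_of_le_of_le tendsto_const_nhds h1 (fun _ => zero_le)
      fun R => Measure.restrict_apply_le _ _
  have hlim := ENNReal.Tendsto.const_mul (tendsto_setLIntegral_zero (f := F)
    hρ.lintegral_div_sq.ne hvol) (Or.inr (ENNReal.ofReal_ne_top (r := D ^ 2 + 1)))
  rw [mul_zero] at hlim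
  have hsmall : ∀ᶠ R : ℝ in 𝓝[>] 0, R < r ∧ 2 * R < 1 ∧ 0 < R := by
    have : ∀ᶠ R : ℝ in 𝓝[>] 0, R < min r (1 / 2) :=
      (Iio_mem_nhds (by positivity : (0 : ℝ) < min r (1 / 2))) |> mem_nhdsWithin_of_mem_nhds
    filter_upwards [this, self_mem_nhdsWithin] with R h1 h2
    exact ⟨h1.trans_le (min_le_left _ _), by linarith [h1.trans_le (min_le_right r (1 / 2))], h2⟩
  obtain ⟨R, h1, h2, h3, h4⟩ := ((hlim.eventually_lt_const hδ).and hsmall).exists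
  exact ⟨R, h4, h2, (hb R h4 h3).trans_lt h1⟩

end IsSplitWeight

/-! ### Completeness of the weighted Sobolev space -/

namespace IsSplitWeight

variable {ρ : Plane → ℝ≥0∞}

/-- Cauchy–Schwarz against an indicator: as `1/ρ` is locally integrable, `L²(μ)` embeds continuously
in `L¹_loc`. -/
theorem setLIntegral_enorm_le (hρ : IsSplitWeight ρ) {E : Type*} [NormedAddCommGroup E]
    {f : Plane → E} (hf : AEStronglyMeasurable f) {K : Set Plane} (hK : MeasurableSet K) :
    ∫⁻ x in K, ‖f x‖ₑ ≤ (∫⁻ x, ‖f x‖ₑ ^ 2 ∂(volume.withDensity ρ)) ^ (1 / 2 : ℝ) *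
      (∫⁻ x in K, (ρ x)⁻¹) ^ (1 / 2 : ℝ) := by
  have h := hρ.lintegral_mul_le hf.enorm
    ((measurable_one.indicator hK : Measurable (K.indicator (1 : Plane → ℝ≥0∞))).aemeasurable)
  have e1 : ∫⁻ x in K, ‖f x‖ₑ = ∫⁻ x, ‖f x‖ₑ * K.indicator (1 : Plane → ℝ≥0∞) x := by
    rw [← lintegral_indicator hK]
    refine lintegral_congr fun x => ?_
    by_cases hx : x ∈ K <;> simp [hx]
  have e2 : ∫⁻ x in K, (ρ x)⁻¹ = ∫⁻ x, K.indicator (1 : Plane → ℝ≥0∞) x ^ 2 * (ρ x)⁻¹ := by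
    rw [← lintegral_indicator hK]
    refine lintegral_congr fun x => ?_
    by_cases hx : x ∈ K <;> simp [hx]
  rwa [e1, e2]

theorem locallyIntegrable (hρ : IsSplitWeight ρ) {E : Type*} [NormedAddCommGroup E]
    {f : Plane → E} (hf : AEStronglyMeasurable f) (h : MemLp f 2 (volume.withDensity ρ)) :
    LocallyIntegrable f := by
  rw [locallyIntegrable_iff]
  intro K hK
  refine ⟨hf.restrict, (hρ.setLIntegral_enorm_le hf hK.measurableSet).trans_lt ?_⟩
  exact ENNReal.mul_lt_top
    (ENNReal.rpow_lt_top_of_nonneg (by norm_num) ((memLp_two_iff h.1).1 h).ne)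
    (ENNReal.rpow_lt_top_of_nonneg (by norm_num) (hρ.lintegral_compact hK).2.ne)

theorem tendsto_setLIntegral (hρ : IsSplitWeight ρ) {E : Type*} [NormedAddCommGroup E]
    {f : ℕ → Plane → E} (hf : ∀ n, AEStronglyMeasurable (f n)) {K : Set Plane} (hK : IsCompact K)
    (h : Tendsto (fun n => ∫⁻ x, ‖f n x‖ₑ ^ 2 ∂(volume.withDensity ρ)) atTop (𝓝 0)) :
    Tendsto (fun n => ∫⁻ x in K, ‖f n x‖ₑ) atTop (𝓝 0) := by
  have h1 : Tendsto (fun n => (∫⁻ x, ‖f n x‖ₑ ^ 2 ∂(volume.withDensity ρ)) ^ (1 / 2 : ℝ)) atTop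
      (𝓝 0) := by
    have := h.ennrpow_const (1 / 2 : ℝ)
    rwa [ENNReal.zero_rpow_of_pos (by norm_num)] at this
  have h2 := ENNReal.Tendsto.mul_const h1 (Or.inr (ENNReal.rpow_lt_top_of_nonneg
    (by norm_num : (0 : ℝ) ≤ 1 / 2) (hρ.lintegral_compact hK).2.ne).ne)
  rw [zero_mul] at h2
  exact tendsto_of_tendsto_of_tendsto_of_le_of_le tendsto_const_nhds h2 (fun _ => zero_le)
    fun n => hρ.setLIntegral_enorm_le (hf n) hK.measurableSet

theorem lintegral_enorm_sq_eq_eLpNorm {E : Type*} [NormedAddCommGroup E] {μ : Measure Plane}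
    (f : Plane → E) : ∫⁻ x, ‖f x‖ₑ ^ 2 ∂μ = eLpNorm f 2 μ ^ 2 := by
  rw [eLpNorm_eq_lintegral_rpow_enorm_toReal two_ne_zero ENNReal.ofNat_ne_top,
    ← ENNReal.rpow_natCast, ← ENNReal.rpow_mul]
  simp

theorem hasWeakGradient_of_tendsto_Lp (hρ : IsSplitWeight ρ) {u : ℕ → Plane → ℝ}
    {g : ℕ → Plane → Plane} (h : ∀ n, HasWeakGradient (u n) (g n))
    (hu : ∀ n, MemLp (u n) 2 (volume.withDensity ρ)) (hg : ∀ n, MemLp (g n) 2 (volume.withDensity ρ))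
    {U : Lp ℝ 2 (volume.withDensity ρ)} {G : Lp Plane 2 (volume.withDensity ρ)}
    (hU : Tendsto (fun n => (hu n).toLp (u n)) atTop (𝓝 U))
    (hG : Tendsto (fun n => (hg n).toLp (g n)) atTop (𝓝 G)) : HasWeakGradient U G := by
  have hUm : AEStronglyMeasurable U := (Lp.stronglyMeasurable U).aestronglyMeasurable
  have hGm : AEStronglyMeasurable G := (Lp.stronglyMeasurable G).aestronglyMeasurable
  have conv : ∀ {E : Type} [NormedAddCommGroup E] {f : ℕ → Plane → E} {F : Lp E 2 (volume.withDensity ρ)}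
      (hf : ∀ n, MemLp (f n) 2 (volume.withDensity ρ)),
      Tendsto (fun n => (hf n).toLp (f n)) atTop (𝓝 F) →
      Tendsto (fun n => ∫⁻ x, ‖f n x - F x‖ₑ ^ 2 ∂(volume.withDensity ρ)) atTop (𝓝 0) := by
    intro E _ f F hf ht
    have h1 : Tendsto (fun n => edist ((hf n).toLp (f n)) F) atTop (𝓝 0) := by
      have := ht.edist (tendsto_const_nhds (x := F))
      rwa [edist_self] at this
    have h2 := ENNReal.Tendsto.pow (n := 2) h1
    simp only [ne_eq, OfNat.ofNat_ne_zero, not_false_eq_true, zero_pow] at h2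
    refine h2.congr fun n => ?_
    have e := lintegral_enorm_sq_eq_eLpNorm (μ := volume.withDensity ρ) (fun x => f n x - F x)
    rw [e, Lp.edist_def]
    congr 1
    refine eLpNorm_congr_ae ?_
    filter_upwards [(hf n).coeFn_toLp] with x hx
    simp [hx]
  exact HasWeakGradient.of_tendsto h (hρ.locallyIntegrable hUm (Lp.memLp U))
    (hρ.locallyIntegrable hGm (Lp.memLp G))
    (fun K hK => hρ.tendsto_setLIntegral (fun n => (h n).1.aestronglyMeasurable.sub hUm) hK
      (conv hu hU))
    (fun K hK => hρ.tendsto_setLIntegral (fun n => (h n).2.1.aestronglyMeasurable.sub hGm) hK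
      (conv hg hG))

/-- Takes the place of countable subadditivity of capacity. `U` is the sum of the series, convergent
in `L²(μ)` together with the gradients; nonnegativity makes it dominate every term. Each of the two
norms is at most `∑ η / 2 / 2 ^ n = η`, whence `2 * η ^ 2`. -/
theorem exists_upper_bound (hρ : IsSplitWeight ρ) {u : ℕ → Plane → ℝ} {g : ℕ → Plane → Plane}
    (h : ∀ n, HasWeakGradient (u n) (g n)) (h0 : ∀ n x, 0 ≤ u n x) {η : ℝ} (hη : 0 < η)
    (hE : ∀ n, sobolevEnergy (volume.withDensity ρ) (u n) (g n) <
      ENNReal.ofReal ((η / 2 / 2 ^ n) ^ 2)) :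
    ∃ U G, HasWeakGradient U G ∧
      sobolevEnergy (volume.withDensity ρ) U G ≤ ENNReal.ofReal (2 * η ^ 2) ∧
      ∀ n, ∀ᵐ x, u n x ≤ U x := by
  set μ := volume.withDensity ρ
  have hμ : μ ≪ volume := withDensity_absolutelyContinuous _ _
  have hum : ∀ n, AEStronglyMeasurable (u n) μ := fun n => (h n).1.aestronglyMeasurable.mono_ac hμ
  have hgm : ∀ n, AEStronglyMeasurable (g n) μ := fun n => (h n).2.1.aestronglyMeasurable.mono_ac hμ
  have hfin : ∀ n, sobolevEnergy μ (u n) (g n) < ⊤ := fun n => (hE n).trans ENNReal.ofReal_lt_top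
  have huL : ∀ n, MemLp (u n) 2 μ := fun n =>
    (memLp_two_iff (hum n)).2 (ENNReal.add_lt_top.1 (hfin n)).2
  have hgL : ∀ n, MemLp (g n) 2 μ := fun n =>
    (memLp_two_iff (hgm n)).2 (ENNReal.add_lt_top.1 (hfin n)).1
  have norm_le : ∀ {E : Type} [NormedAddCommGroup E] {f : Plane → E} (hf : MemLp f 2 μ) {c : ℝ},
      0 ≤ c → ∫⁻ x, ‖f x‖ₑ ^ 2 ∂μ ≤ ENNReal.ofReal (c ^ 2) → ‖hf.toLp f‖ ≤ c := by
    intro E _ f hf c hc hle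
    rw [lintegral_enorm_sq_eq_eLpNorm, ENNReal.ofReal_pow hc,
      ENNReal.pow_le_pow_left_iff two_ne_zero] at hle
    rw [Lp.norm_toLp]
    exact ENNReal.toReal_le_of_le_ofReal hc hle
  have hun : ∀ n, ‖(huL n).toLp (u n)‖ ≤ η / 2 / 2 ^ n := fun n =>
    norm_le (huL n) (by positivity) (le_add_self.trans (hE n).le)
  have hgn : ∀ n, ‖(hgL n).toLp (g n)‖ ≤ η / 2 / 2 ^ n := fun n =>
    norm_le (hgL n) (by positivity) (le_self_add.trans (hE n).le)
  have hs : HasSum (fun n : ℕ => η / 2 / 2 ^ n) η := hasSum_geometric_two' η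
  have hus : Summable fun n => (huL n).toLp (u n) := .of_norm_bounded hs.summable hun
  have hgs : Summable fun n => (hgL n).toLp (g n) := .of_norm_bounded hs.summable hgn
  set U := ∑' n, (huL n).toLp (u n)
  set G := ∑' n, (hgL n).toLp (g n)
  have hUn : ‖U‖ ≤ η := tsum_of_norm_bounded hs hun
  have hGn : ‖G‖ ≤ η := tsum_of_norm_bounded hs hgn
  have sq_le : ∀ {E : Type} [NormedAddCommGroup E] (F : Lp E 2 μ), ‖F‖ ≤ η →
      ∫⁻ x, ‖F x‖ₑ ^ 2 ∂μ ≤ ENNReal.ofReal (η ^ 2) := by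
    intro E _ F hF
    rw [lintegral_enorm_sq_eq_eLpNorm, ENNReal.ofReal_pow hη.le,
      ENNReal.pow_le_pow_left_iff two_ne_zero, ← Lp.enorm_def, ← ofReal_norm]
    exact ENNReal.ofReal_le_ofReal hF
  have hpw : ∀ n, HasWeakGradient (fun x => ∑ i ∈ Finset.range n, u i x)
      (fun x => ∑ i ∈ Finset.range n, g i x) := by
    intro n
    induction n with
    | zero =>
      refine ((HasWeakGradient.of_contDiff (contDiff_const (c := (0 : ℝ)))).congr
        (ae_of_all _ fun x => by simp) (ae_of_all _ fun x => ?_))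
      simp [gradient]
    | succ n ih =>
      simp only [Finset.sum_range_succ]
      exact ih.add (h n)
  have huS : ∀ n, MemLp (fun x => ∑ i ∈ Finset.range n, u i x) 2 μ := fun n =>
    memLp_finsetSum _ fun i _ => huL i
  have hgS : ∀ n, MemLp (fun x => ∑ i ∈ Finset.range n, g i x) 2 μ := fun n =>
    memLp_finsetSum _ fun i _ => hgL i
  have eqS : ∀ {E : Type} [NormedAddCommGroup E] {f : ℕ → Plane → E} (hf : ∀ n, MemLp (f n) 2 μ)
      (hS : ∀ n, MemLp (fun x => ∑ i ∈ Finset.range n, f i x) 2 μ) (n : ℕ),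
      ∑ i ∈ Finset.range n, (hf i).toLp (f i) = (hS n).toLp _ := by
    intro E _ f hf hS n
    induction n with
    | zero => simp; rfl
    | succ n ih =>
      rw [Finset.sum_range_succ, ih, ← MemLp.toLp_add]
      refine MemLp.toLp_congr _ _ (ae_of_all _ fun x => ?_)
      simp [Finset.sum_range_succ]
  refine ⟨U, G, hρ.hasWeakGradient_of_tendsto_Lp hpw huS hgS ?_ ?_, ?_, fun n => ?_⟩
  · simp only [← eqS huL huS]
    exact hus.hasSum.tendsto_sum_nat
  · simp only [← eqS hgL hgS]
    exact hgs.hasSum.tendsto_sum_nat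
  · rw [two_mul, ENNReal.ofReal_add (by positivity) (by positivity)]
    exact add_le_add (sq_le G hGn) (sq_le U hUn)
  · have hle : (huL n).toLp (u n) ≤ U := by
      refine hus.le_tsum n fun j _ => ?_
      rw [← Lp.coeFn_nonneg]
      filter_upwards [(huL j).coeFn_toLp] with x hx
      rw [hx]
      exact h0 j x
    rw [← Lp.coeFn_le] at hle
    rw [← hρ.ae_withDensity]
    filter_upwards [hle, (huL n).coeFn_toLp] with x h1 h2
    rwa [h2] at h1

end IsSplitWeight

/-! ### The arc has capacity zero -/

theorem norm_sq_plane (x : Plane) : ‖x‖ ^ 2 = x 0 ^ 2 + x 1 ^ 2 := by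
  rw [EuclideanSpace.norm_sq_eq, Fin.sum_univ_two]
  simp

theorem psi_nonneg (x : Plane) : 0 ≤ psi x := by
  unfold psi
  split_ifs <;> positivity

theorem psi_le_one (x : Plane) : psi x ≤ 1 := by
  unfold psi
  have h : ∀ i : Fin 2, x i / ‖x‖ ≤ 1 := fun i =>
    div_le_one_of_le₀ ((le_abs_self _).trans (PiLp.norm_apply_le x i)) (norm_nonneg _)
  split_ifs
  · exact le_rfl
  · exact h 0
  · exact h 1
  · exact zero_le_one

/-- The bounds exclude the first and third quadrants. In the other two `psi` and `√(1 - psi²)` are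
the absolute values of the two direction cosines, and `angle` is their product. -/
theorem angle_ge_of_psi {α : ℝ} (hα : 0 < α) {x : Plane} (hx : x ≠ 0)
    (h1 : α ≤ psi x) (h2 : psi x ≤ 1 - α) : α ^ 2 ≤ angle x := by
  have hn : 0 < ‖x‖ := norm_pos_iff.2 hx
  have key : ∀ s t : ℝ, ‖x‖ ^ 2 = s ^ 2 + t ^ 2 → t < 0 → α ≤ s / ‖x‖ → s / ‖x‖ ≤ 1 - α →
      α ^ 2 ≤ -(s * t) * (‖x‖ ^ 2)⁻¹ := by
    intro s t hst ht hs1 hs2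
    -- Here `α ≤ 1 - α`, so `1 - (1 - α)² ≥ α²`.
    have hb : α ≤ -t / ‖x‖ := by
      have e : (-t / ‖x‖) ^ 2 = 1 - (s / ‖x‖) ^ 2 := by
        field_simp
        linarith
      have hpos : 0 ≤ -t / ‖x‖ := div_nonneg (by linarith) hn.le
      nlinarith
    have e : -(s * t) * (‖x‖ ^ 2)⁻¹ = (s / ‖x‖) * (-t / ‖x‖) := by field_simp
    rw [e, sq]
    exact mul_le_mul hs1 hb hα.le (hα.le.trans hs1)
  unfold psi at h1 h2
  unfold angle
  split_ifs at h1 h2 with h3 h4 h4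
  · linarith
  · exact key _ _ (norm_sq_plane x) (not_le.1 h4) h1 h2
  · rw [mul_comm (x 0)]
    exact key _ _ ((norm_sq_plane x).trans (add_comm _ _)) (not_le.1 h3) h1 h2
  · linarith

/-- Near the origin the factor `1 - ‖x‖²` is at least `1 - α/2`, and `(1 - α/2)² ≥ 1 - α`; passing
from `psiZero` to `psi` costs half of `α`. -/
theorem angle_ge_of_psiZero {α : ℝ} (hα : 0 < α) (hα2 : α ≤ 1) {x : Plane} (hx : x ≠ 0)
    (hn : ‖x‖ ^ 2 ≤ α / 2) (h1 : α < SplitPlane.psiZero (.punctured ⟨x, hx⟩))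
    (h2 : SplitPlane.psiZero (.punctured ⟨x, hx⟩) < 1 - α) : (α / 2) ^ 2 ≤ angle x := by
  have h0 := psi_nonneg x
  have hmax : max (1 - ‖x‖ ^ 2) 0 = 1 - ‖x‖ ^ 2 := max_eq_left (by linarith)
  simp only [SplitPlane.psiZero, hmax] at h1 h2
  have hs := sq_nonneg ‖x‖
  refine angle_ge_of_psi (by positivity) hx ?_ ?_
  · nlinarith
  · by_contra hcon
    nlinarith [not_le.1 hcon]

theorem capW_arcSet {a : ℝ → ℝ≥0∞} (ha : IsAdmissible a) : capW a arcSet = 0 := by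
  have hρ := ha.isSplitWeight
  have main : ∀ η : ℝ, 0 < η → capW a arcSet ≤ ENNReal.ofReal (2 * η ^ 2) := by
    intro η hη
    let α : ℕ → ℝ := fun n => 1 / (n + 1)
    have hα0 : ∀ n, 0 < α n := fun n => by positivity
    have hα1 : ∀ n, α n ≤ 1 := fun n => by
      simp only [α]
      rw [div_le_one (by positivity)]
      simp
    -- The sector parameter is half of the lower bound for `angle` in `angle_ge_of_psiZero`, because
    -- `sector c R` equals `1` where `angle ≥ 2 * c`.
    have hc0 : ∀ n, 0 < (α n / 2) ^ 2 / 2 := fun n => by have := hα0 n; positivity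
    have hex := fun n => hρ.exists_sobolevEnergy_sector_lt (hc0 n) (half_pos (hα0 n))
      (δ := ENNReal.ofReal ((η / 2 / 2 ^ n) ^ 2)) (by simp only [ENNReal.ofReal_pos]; positivity)
    choose R hR0 hR1 hRE using hex
    obtain ⟨U, G, hUG, hE, hle⟩ := hρ.exists_upper_bound
      (fun n => hasWeakGradient_sector (hc0 n) (R n)) (fun n => sector_nonneg _ _) hη hRE
    -- The arc is not compact, so its neighbourhood must shrink towards the end points: the `n`th
    -- piece has its own radius `R n`.
    let A : Set SplitPlane := ⋃ n, {p | ‖p.proj‖ < R n ∧ α n < p.psiZero ∧ p.psiZero < 1 - α n}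
    have hA : IsOpen A := by
      refine isOpen_iUnion fun n => ?_
      have hp := SplitPlane.continuous_proj
      have hψ := SplitPlane.continuous_psiZero
      exact (isOpen_lt hp.norm continuous_const).inter
        ((isOpen_lt continuous_const hψ).inter (isOpen_lt hψ continuous_const))
    refine (capW_le ha hA ?_ hUG (hE.trans_lt ENNReal.ofReal_lt_top) ?_).trans hE
    · rintro p ⟨z, rfl⟩
      have s0 : 0 < Real.sin z :=
        Real.sin_pos_of_pos_of_lt_pi z.2.1 (by linarith [z.2.2, Real.pi_pos])
      have s1 : Real.sin z < 1 := by
        have := Real.sin_lt_sin_of_lt_of_le_pi_div_two (x := z) (y := Real.pi / 2)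
          (by linarith [z.2.1, Real.pi_pos]) le_rfl z.2.2
        simpa using this
      obtain ⟨n, hn⟩ := exists_nat_one_div_lt (lt_min s0 (sub_pos.2 s1))
      refine mem_iUnion.2 ⟨n, by simpa [SplitPlane.proj] using hR0 n,
        hn.trans_le (min_le_left _ _), ?_⟩
      have := hn.trans_le (min_le_right _ _)
      simp only [SplitPlane.psiZero, α]
      linarith
    · filter_upwards [ae_all_iff.2 hle] with x hx h0 hxA
      obtain ⟨n, h1, h2, h3⟩ := mem_iUnion.1 hxA
      simp only [SplitPlane.proj] at h1
      have hang : (α n / 2) ^ 2 ≤ angle x := by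
        refine angle_ge_of_psiZero (hα0 n) (hα1 n) h0 ?_ h2 h3
        have := hR1 n
        have := norm_nonneg x
        nlinarith [hα0 n, hα1 n]
      have := hx n
      rwa [sector_eq_one (hc0 n) (hR0 n) (by linarith) h1.le] at this
  have hlim : Tendsto (fun η : ℝ => ENNReal.ofReal (2 * η ^ 2)) (𝓝[>] 0) (𝓝 0) := by
    have hc : Continuous fun η : ℝ => ENNReal.ofReal (2 * η ^ 2) :=
      ENNReal.continuous_ofReal.comp (by fun_prop)
    have := hc.tendsto 0
    simp only [ne_eq, OfNat.ofNat_ne_zero, not_false_eq_true, zero_pow, mul_zero,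
      ENNReal.ofReal_zero] at this
    exact this.mono_left nhdsWithin_le_nhds
  refine le_antisymm (ge_of_tendsto hlim ?_) zero_le
  filter_upwards [self_mem_nhdsWithin] with η hη
  exact main η hη

/-! ### The capacity of the fibre over the origin -/

theorem SplitPlane.exists_proj_eq_zero {s : ℝ} (hs : s ∈ Icc (0 : ℝ) 1) :
    ∃ p : SplitPlane, p.proj = 0 ∧ p.psiZero = s := by
  rcases eq_or_lt_of_le hs.1 with h0 | h0
  · exact ⟨.minus, rfl, h0⟩
  · rcases eq_or_lt_of_le hs.2 with h1 | h1
    · exact ⟨.plus, rfl, h1.symm⟩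
    · exact ⟨.arc ⟨Real.arcsin s, Real.arcsin_pos.2 h0, Real.arcsin_lt_pi_div_two.2 h1⟩, rfl,
        Real.sin_arcsin (by linarith) h1.le⟩

theorem SplitPlane.psiZero_mem (x : {x : Plane // x ≠ 0}) :
    SplitPlane.psiZero (.punctured x) ∈ Icc (0 : ℝ) 1 := by
  have h : max (1 - ‖(x : Plane)‖ ^ 2) 0 ≤ 1 := max_le (by linarith [sq_nonneg ‖(x : Plane)‖]) zero_le_one
  exact ⟨mul_nonneg (le_max_right _ _) (psi_nonneg _), mul_le_one₀ h (psi_nonneg _) (psi_le_one _)⟩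

/-- With `psiZero` as coordinate the fibre over the origin is isometric to `[0, 1]`, hence compact,
and `A` contains a uniform thickening of it. A punctured point `x` lies at distance `‖x‖` from the
fibre point with the same `psiZero`. -/
theorem SplitPlane.exists_ball_subset {A : Set SplitPlane} (hA : IsOpen A)
    (h : ∀ p : SplitPlane, p.proj = 0 → p ∈ A) :
    ∃ ε : ℝ, 0 < ε ∧ ∀ x : Plane, ‖x‖ < ε → ∀ hx : x ≠ 0, SplitPlane.punctured ⟨x, hx⟩ ∈ A := by
  choose F hF0 hF1 using fun s : Icc (0 : ℝ) 1 => SplitPlane.exists_proj_eq_zero s.2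
  have hiso : Isometry F := Isometry.of_dist_eq fun s t => by
    rw [SplitPlane.dist_def, hF0, hF0, hF1, hF1, sub_self, norm_zero, zero_add]
    rfl
  have hK : IsCompact (range F) := isCompact_range hiso.continuous
  obtain ⟨δ, hδ, hsub⟩ := hK.exists_thickening_subset_open hA (by
    rintro _ ⟨s, rfl⟩
    exact h _ (hF0 s))
  refine ⟨δ, hδ, fun x hx h0 => hsub ?_⟩
  rw [Metric.mem_thickening_iff]
  refine ⟨F ⟨_, SplitPlane.psiZero_mem ⟨x, h0⟩⟩, mem_range_self _, ?_⟩
  rw [SplitPlane.dist_def, hF0, hF1]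
  simpa [SplitPlane.proj] using hx

theorem sobolevEnergy_lt_top_of_add {μ : Measure Plane} {u v : Plane → ℝ} {g k : Plane → Plane}
    (hu : AEStronglyMeasurable u μ) (hg : AEStronglyMeasurable g μ)
    (h1 : sobolevEnergy μ u g < ⊤) (h2 : sobolevEnergy μ v k < ⊤) :
    sobolevEnergy μ (u + v) (g + k) < ⊤ :=
  (sobolevEnergy_add_le one_pos hu hg).trans_lt (ENNReal.add_lt_top.2
    ⟨ENNReal.mul_lt_top ENNReal.ofReal_lt_top h1, ENNReal.mul_lt_top ENNReal.ofReal_lt_top h2⟩)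

theorem capH_le_of_one_le {a : ℝ → ℝ≥0∞} (ha : IsAdmissible a) {f : Plane → ℝ}
    {g : Plane → Plane} (h : HasWeakGradient f g) (hE : sobolevEnergy (mu a) f g < ⊤)
    {ε : ℝ} (hε : 0 < ε) (h1 : ∀ᵐ x, x ∈ Metric.ball (0 : Plane) ε → 1 ≤ f x) :
    capH a {0} ≤ sobolevEnergy (mu a) f g := by
  classical
  -- A null-set modification of the truncation: `exists_testFunction_approx` asks for pointwise
  -- constancy on the ball, but `f ≥ 1` holds there only almost everywhere.
  let w : Plane → ℝ := fun x => if x ∈ Metric.ball (0 : Plane) ε then 1 else trunc (f x)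
  let k : Plane → Plane := fun x => if x ∈ Metric.ball (0 : Plane) ε then 0 else truncGrad f g x
  have ew : (fun x => trunc (f x)) =ᵐ[volume] w := by
    filter_upwards [h1] with x hx
    by_cases hb : x ∈ Metric.ball (0 : Plane) ε
    · simp only [w, if_pos hb, trunc_eq_one (hx hb)]
    · simp only [w, if_neg hb]
  have ek : truncGrad f g =ᵐ[volume] k := by
    filter_upwards [h1] with x hx
    by_cases hb : x ∈ Metric.ball (0 : Plane) ε
    · have : f x ∉ Ioo (0 : ℝ) 1 := fun h' => absurd h'.2 (not_lt.2 (hx hb))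
      simp only [k, if_pos hb, truncGrad, indicator_of_notMem this, zero_smul]
    · simp only [k, if_neg hb]
  have hwk := h.trunc.congr ew ek
  have hμ := mu_absolutelyContinuous a
  have hle : sobolevEnergy (mu a) w k ≤ sobolevEnergy (mu a) f g := by
    rw [← sobolevEnergy_congr (hμ.ae_eq ew) (hμ.ae_eq ek)]
    exact sobolevEnergy_trunc_le _ _ _
  have hwE := hle.trans_lt hE
  refine (capH_le ha (A := Metric.ball (0 : Plane) ε) Metric.isOpen_ball
    (singleton_subset_iff.2 (Metric.mem_ball_self hε)) hwk hwE
    (ae_of_all _ fun x hx => by simp only [w, if_pos hx, le_refl]) fun δ hδ => ?_).trans hle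
  exact ha.isSplitWeight.exists_testFunction_approx hwk hwE hε (b := 1)
    (fun x hx => if_pos hx) (fun x hx => if_pos hx) hδ

theorem capH_le_capW {a : ℝ → ℝ≥0∞} (ha : IsAdmissible a) :
    capH a {0} ≤ capW a {SplitPlane.plus, SplitPlane.minus} := by
  refine le_of_forall_gt fun c hc => ?_
  obtain ⟨A, f, g, hA, h0, h, hE, hlt, h1⟩ := exists_of_capW_lt ha hc
  refine lt_of_le_of_lt ?_ hlt
  have hμ := mu_absolutelyContinuous a
  have main : ∀ δ : ℝ, 0 < δ → capH a {0} ≤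
      ENNReal.ofReal (1 + δ) * sobolevEnergy (mu a) f g +
        ENNReal.ofReal (1 + δ⁻¹) * ENNReal.ofReal (δ ^ 2) := by
    intro δ hδ
    -- The energy budget `δ²` beats the Young constant `1 + δ⁻¹`: their product `δ² + δ` tends to
    -- `0`.
    have harc : capW a arcSet < ENNReal.ofReal (δ ^ 2) := by
      rw [capW_arcSet ha, ENNReal.ofReal_pos]
      positivity
    obtain ⟨A', v, k, hA', h0', h', hE', hlt', h1'⟩ := exists_of_capW_lt ha harc
    obtain ⟨ε, hε, hball⟩ := SplitPlane.exists_ball_subset (hA.union hA') fun p hp => by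
      cases p with
      | punctured x => exact absurd hp x.2
      | plus => exact Or.inl (h0 (by simp))
      | minus => exact Or.inl (h0 (by simp))
      | arc z => exact Or.inr (h0' ⟨z, rfl⟩)
    have t1 := h.trunc
    have t2 := h'.trunc
    have m1 := t1.1.aestronglyMeasurable.mono_ac hμ
    have m2 := t1.2.1.aestronglyMeasurable.mono_ac hμ
    have e1 := sobolevEnergy_trunc_le (mu a) f g
    have e2 := sobolevEnergy_trunc_le (mu a) v k
    refine (capH_le_of_one_le ha (t1.add t2) (sobolevEnergy_lt_top_of_add m1 m2
      (e1.trans_lt hE) (e2.trans_lt hE')) hε ?_).trans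
      ((sobolevEnergy_add_le hδ m1 m2).trans ?_)
    · filter_upwards [h1, h1', ae_ne_zero] with x hx hx' hx0 hxb
      rw [Pi.add_apply]
      rcases hball x (mem_ball_zero_iff.1 hxb) hx0 with hh | hh
      · rw [trunc_eq_one (hx hx0 hh)]
        linarith [trunc_nonneg (v x)]
      · rw [trunc_eq_one (hx' hx0 hh)]
        linarith [trunc_nonneg (f x)]
    · gcongr
      exact e2.trans hlt'.le
  have hlim : Tendsto (fun δ : ℝ => ENNReal.ofReal (1 + δ) * sobolevEnergy (mu a) f g +
      ENNReal.ofReal (1 + δ⁻¹) * ENNReal.ofReal (δ ^ 2)) (𝓝[>] 0)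
      (𝓝 (sobolevEnergy (mu a) f g)) := by
    have hc1 : Continuous fun δ : ℝ => ENNReal.ofReal (1 + δ) :=
      ENNReal.continuous_ofReal.comp (by fun_prop)
    have hc2 : Continuous fun δ : ℝ => ENNReal.ofReal (δ ^ 2 + δ) :=
      ENNReal.continuous_ofReal.comp (by fun_prop)
    have l1 := (ENNReal.Tendsto.mul_const (hc1.tendsto 0) (Or.inr hE.ne)).add (hc2.tendsto 0)
    simp only [add_zero, ENNReal.ofReal_one, one_mul, ne_eq, OfNat.ofNat_ne_zero,
      not_false_eq_true, zero_pow, ENNReal.ofReal_zero] at l1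
    refine (l1.mono_left nhdsWithin_le_nhds).congr' ?_
    filter_upwards [self_mem_nhdsWithin] with δ hδ
    have hδ' : (0 : ℝ) < δ := hδ
    rw [← ENNReal.ofReal_mul (by positivity)]
    congr 2
    field_simp
  refine ge_of_tendsto hlim ?_
  filter_upwards [self_mem_nhdsWithin] with δ hδ
  exact main δ hδ

/-! ### Symmetry of the two added points -/

/-- By `psi_eq`, `psi` measures the coordinatewise positive part of `x / ‖x‖`; the reflection
exchanges positive and negative parts, whose squares add up to `1`. -/
theorem psi_neg_sq {x : Plane} (hx : x ≠ 0) : psi (-x) ^ 2 = 1 - psi x ^ 2 := by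
  have hn : ‖x‖ ^ 2 ≠ 0 := pow_ne_zero 2 (norm_ne_zero_iff.2 hx)
  rw [psi_eq hx, psi_eq (neg_ne_zero.2 hx), div_pow, div_pow, norm_neg,
    Real.sq_sqrt (by positivity), Real.sq_sqrt (by positivity), eq_sub_iff_add_eq, ← add_div,
    div_eq_one_iff_eq hn, norm_sq_plane]
  have h : ∀ t : ℝ, max (-t) 0 ^ 2 + max t 0 ^ 2 = t ^ 2 := fun t => by
    rcases le_total 0 t with ht | ht
    · rw [max_eq_left ht, max_eq_right (by linarith)]; ring
    · rw [max_eq_right ht, max_eq_left (by linarith)]; ring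
  have h0 := h (x 0)
  have h1 := h (x 1)
  simp only [PiLp.neg_apply]
  linarith

theorem sobolevEnergy_comp_neg {ρ : Plane → ℝ≥0∞} (hρ : IsSplitWeight ρ) (f : Plane → ℝ)
    (g : Plane → Plane) : sobolevEnergy (volume.withDensity ρ) (fun x => f (-x)) (fun x => -g (-x)) =
      sobolevEnergy (volume.withDensity ρ) f g := by
  have key : ∀ F : Plane → ℝ≥0∞, ∫⁻ x, F (-x) ∂(volume.withDensity ρ) =
      ∫⁻ x, F x ∂(volume.withDensity ρ) := fun F => by
    have ht : ∀ᵐ x, ρ x < ⊤ := ae_of_all _ fun x => (hρ.ne_top x).lt_top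
    rw [lintegral_withDensity_eq_lintegral_mul_non_measurable _ hρ.measurable ht,
      lintegral_withDensity_eq_lintegral_mul_non_measurable _ hρ.measurable ht,
      ← lintegral_neg_eq_self]
    refine lintegral_congr fun x => ?_
    simp [hρ.map_neg]
  unfold sobolevEnergy
  simp only [enorm_neg]
  rw [key fun x => ‖g x‖ₑ ^ 2, key fun x => ‖f x‖ₑ ^ 2]

/-- The hypothesis encodes that `x ↦ -x` extends continuously with `q ↦ p`, without defining the
reflection on the added points. Energies agree because `ρ` is even. -/
theorem capW_le_of_neg {a : ℝ → ℝ≥0∞} (ha : IsAdmissible a) {p q : SplitPlane}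
    (h : ∀ A : Set SplitPlane, IsOpen A → p ∈ A → ∃ A', IsOpen A' ∧ q ∈ A' ∧
      ∀ x : Plane, ∀ hx : x ≠ 0, SplitPlane.punctured ⟨x, hx⟩ ∈ A' →
        SplitPlane.punctured ⟨-x, neg_ne_zero.2 hx⟩ ∈ A) : capW a {q} ≤ capW a {p} := by
  refine le_of_forall_gt fun c hc => ?_
  obtain ⟨A, f, g, hA, h0, hfg, hE, hlt, h1⟩ := exists_of_capW_lt ha hc
  obtain ⟨A', hA', hq, hsub⟩ := h A hA (h0 rfl)
  have e : sobolevEnergy (mu a) (fun x => f (-x)) (fun x => -g (-x)) = sobolevEnergy (mu a) f g :=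
    sobolevEnergy_comp_neg ha.isSplitWeight f g
  rw [← e] at hE hlt
  refine (capW_le ha hA' (singleton_subset_iff.2 hq) hfg.comp_neg hE ?_).trans_lt hlt
  have := (Measure.measurePreserving_neg (volume : Measure Plane)).quasiMeasurePreserving.ae h1
  filter_upwards [this] with x hx h0 hxA
  exact hx (neg_ne_zero.2 h0) (hsub x h0 hxA)

theorem psiZero_punctured {x : Plane} (hx : x ≠ 0) (hn : ‖x‖ ≤ 1) :
    SplitPlane.psiZero (.punctured ⟨x, hx⟩) = (1 - ‖x‖ ^ 2) * psi x := by
  have : max (1 - ‖x‖ ^ 2) 0 = 1 - ‖x‖ ^ 2 := max_eq_left (by nlinarith [norm_nonneg x])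
  simp only [SplitPlane.psiZero, this]

theorem capW_minus_le_plus {a : ℝ → ℝ≥0∞} (ha : IsAdmissible a) :
    capW a {SplitPlane.minus} ≤ capW a {SplitPlane.plus} := by
  refine capW_le_of_neg ha fun A hA hp => ?_
  obtain ⟨δ, hδ, hball⟩ := Metric.isOpen_iff.1 hA _ hp
  -- The distance from `-x` to `plus` is less than `δ' + 3 * δ'`: one part from the projection,
  -- three from `psiZero`.
  set δ' := min (δ / 4) (1 / 2) with hδ'
  have h0 : 0 < δ' := by positivity
  have h4 : δ' ≤ δ / 4 := min_le_left _ _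
  have h2 : δ' ≤ 1 / 2 := min_le_right _ _
  refine ⟨{p | ‖p.proj‖ < δ' ∧ p.psiZero < δ'},
    (isOpen_lt SplitPlane.continuous_proj.norm continuous_const).inter
      (isOpen_lt SplitPlane.continuous_psiZero continuous_const),
    ⟨by simpa [SplitPlane.proj] using h0, h0⟩, fun x hx hxA => hball ?_⟩
  have e1 : ‖x‖ < δ' := hxA.1
  have e2 := hxA.2
  have hsq := psi_neg_sq hx
  have p0 := psi_nonneg x
  have p1 := psi_le_one x
  have q0 := psi_nonneg (-x)
  have q1 := psi_le_one (-x)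
  have hn0 := norm_nonneg x
  rw [psiZero_punctured hx (by linarith)] at e2
  rw [Metric.mem_ball, SplitPlane.dist_def,
    psiZero_punctured (neg_ne_zero.2 hx) (by rw [norm_neg]; linarith), norm_neg]
  have r1 : psi x < 2 * δ' := by nlinarith
  have r2 : 1 - 2 * δ' ≤ psi (-x) := by nlinarith
  have r3 : |(1 - ‖x‖ ^ 2) * psi (-x) - 1| ≤ 3 * δ' := by
    have hs : ‖x‖ ^ 2 ≤ δ' := by nlinarith
    have hs0 := sq_nonneg ‖x‖
    rw [abs_le]
    constructor <;> nlinarith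
  have r4 : ‖-x - (0 : Plane)‖ = ‖x‖ := by simp
  show ‖-x - (0 : Plane)‖ + |(1 - ‖x‖ ^ 2) * psi (-x) - 1| < δ
  rw [r4]
  linarith

theorem capW_plus_le_minus {a : ℝ → ℝ≥0∞} (ha : IsAdmissible a) :
    capW a {SplitPlane.plus} ≤ capW a {SplitPlane.minus} := by
  refine capW_le_of_neg ha fun A hA hp => ?_
  obtain ⟨δ, hδ, hball⟩ := Metric.isOpen_iff.1 hA _ hp
  -- In this direction a square root is lost: `psi x > 1 - δ'` only gives `psi (-x) ^ 2 < 2 * δ'`,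
  -- which has to be at most `(δ / 2) ^ 2`.
  set δ' := min (min (δ / 2) (1 / 2)) ((δ / 2) ^ 2 / 2) with hδ'
  have h0 : 0 < δ' := by positivity
  have h4 : δ' ≤ δ / 2 := (min_le_left _ _).trans (min_le_left _ _)
  have h2 : δ' ≤ 1 / 2 := (min_le_left _ _).trans (min_le_right _ _)
  have h3 : δ' ≤ (δ / 2) ^ 2 / 2 := min_le_right _ _
  refine ⟨{p | ‖p.proj‖ < δ' ∧ 1 - δ' < p.psiZero},
    (isOpen_lt SplitPlane.continuous_proj.norm continuous_const).inter
      (isOpen_lt continuous_const SplitPlane.continuous_psiZero),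
    ⟨by simpa [SplitPlane.proj] using h0, by simpa [SplitPlane.psiZero] using h0⟩,
    fun x hx hxA => hball ?_⟩
  have e1 : ‖x‖ < δ' := hxA.1
  have e2 := hxA.2
  have hsq := psi_neg_sq hx
  have p0 := psi_nonneg x
  have p1 := psi_le_one x
  have q0 := psi_nonneg (-x)
  have q1 := psi_le_one (-x)
  have hn0 := norm_nonneg x
  have hs0 := sq_nonneg ‖x‖
  have hs1 : ‖x‖ ^ 2 ≤ 1 := by nlinarith
  rw [psiZero_punctured hx (by linarith)] at e2
  rw [Metric.mem_ball, SplitPlane.dist_def,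
    psiZero_punctured (neg_ne_zero.2 hx) (by rw [norm_neg]; linarith), norm_neg]
  have r1 : 1 - δ' < psi x := by nlinarith
  have r2 : psi (-x) ^ 2 < (δ / 2) ^ 2 := by nlinarith
  have r3 : psi (-x) < δ / 2 := lt_of_pow_lt_pow_left₀ 2 (by positivity) r2
  have r5 : |(1 - ‖x‖ ^ 2) * psi (-x) - 0| < δ / 2 := by
    rw [sub_zero, abs_of_nonneg (mul_nonneg (by linarith) q0)]
    nlinarith
  have r4 : ‖-x - (0 : Plane)‖ = ‖x‖ := by simp
  show ‖-x - (0 : Plane)‖ + |(1 - ‖x‖ ^ 2) * psi (-x) - 0| < δ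
  rw [r4]
  linarith

/-! ### The added points have positive capacity -/

/-- A function of the angle with values in `[0, 1]` that is positive exactly on the open first
quadrant. -/
def quadrant (x : Plane) : ℝ :=
  Real.smoothTransition (x 0 * ‖x‖⁻¹) * Real.smoothTransition (x 1 * ‖x‖⁻¹)

/-- A radial profile that rises from `0` to `1` on `[ε² / 2, ε²]` and falls back to `0` on
`[1 / 4, 1 / 2]`, as a function of the squared radius. -/
def ramp (ε s : ℝ) : ℝ :=
  Real.smoothTransition (2 / ε ^ 2 * s - 1) - Real.smoothTransition (4 * s - 1)

/-- The radial vector field `radialField ε x • x` has divergence `2 * ramp' (‖x‖²) * quadrant x`. -/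
def radialField (ε : ℝ) (x : Plane) : ℝ := ramp ε (‖x‖ ^ 2) * quadrant x * (‖x‖ ^ 2)⁻¹

/-- The derivative of `ramp`. -/
def rampDeriv (ε s : ℝ) : ℝ :=
  deriv Real.smoothTransition (2 / ε ^ 2 * s - 1) * (2 / ε ^ 2) -
    deriv Real.smoothTransition (4 * s - 1) * 4

/-- The outer part of the divergence of the radial field. -/
def outerDiv (x : Plane) : ℝ := 8 * deriv Real.smoothTransition (4 * ‖x‖ ^ 2 - 1) * quadrant x

theorem quadrant_nonneg (x : Plane) : 0 ≤ quadrant x :=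
  mul_nonneg (Real.smoothTransition.nonneg _) (Real.smoothTransition.nonneg _)

theorem quadrant_le_one (x : Plane) : quadrant x ≤ 1 :=
  mul_le_one₀ (Real.smoothTransition.le_one _) (Real.smoothTransition.nonneg _)
    (Real.smoothTransition.le_one _)

theorem quadrant_eq_zero {x : Plane} (h : ¬(0 < x 0 ∧ 0 < x 1)) : quadrant x = 0 := by
  have hz : ∀ t : ℝ, t ≤ 0 → Real.smoothTransition (t * ‖x‖⁻¹) = 0 := fun t ht =>
    Real.smoothTransition.zero_of_nonpos
      (mul_nonpos_of_nonpos_of_nonneg ht (inv_nonneg.2 (norm_nonneg _)))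
  rcases not_and_or.1 h with h | h
  · rw [quadrant, hz _ (not_lt.1 h), zero_mul]
  · rw [quadrant, hz _ (not_lt.1 h), mul_zero]

theorem contDiffAt_quadrant {x : Plane} (hx : x ≠ 0) : ContDiffAt ℝ (⊤ : ℕ∞) quadrant x := by
  have h0 : ∀ i : Fin 2, ContDiffAt ℝ (⊤ : ℕ∞) (fun x : Plane => x i) x := fun i =>
    (EuclideanSpace.proj (𝕜 := ℝ) i).contDiff.contDiffAt
  have hn : ContDiffAt ℝ (⊤ : ℕ∞) (fun x : Plane => ‖x‖⁻¹) x :=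
    (contDiffAt_norm ℝ hx).inv (norm_ne_zero_iff.2 hx)
  exact (Real.smoothTransition.contDiffAt.comp x ((h0 0).mul hn)).mul
    (Real.smoothTransition.contDiffAt.comp x ((h0 1).mul hn))

theorem quadrant_smul {t : ℝ} (ht : 0 < t) (x : Plane) : quadrant (t • x) = quadrant x := by
  have h : ∀ i : Fin 2, (t • x) i * ‖t • x‖⁻¹ = x i * ‖x‖⁻¹ := fun i => by
    rw [norm_smul, Real.norm_eq_abs, abs_of_pos ht, mul_inv, PiLp.smul_apply, smul_eq_mul]
    field_simp
  rw [quadrant, h, h, quadrant]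

theorem hasDerivAt_ramp (ε s : ℝ) : HasDerivAt (ramp ε) (rampDeriv ε s) s := by
  have h1 := (hasDerivAt_smoothTransition (2 / ε ^ 2 * s - 1)).comp s
    (((hasDerivAt_id s).const_mul (2 / ε ^ 2)).sub_const 1)
  have h2 := (hasDerivAt_smoothTransition (4 * s - 1)).comp s
    (((hasDerivAt_id s).const_mul 4).sub_const 1)
  simpa [ramp, rampDeriv, Function.comp_def] using! h1.sub h2

theorem abs_ramp_le_one (ε s : ℝ) : |ramp ε s| ≤ 1 := by
  have h1 := Real.smoothTransition.nonneg (2 / ε ^ 2 * s - 1)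
  have h2 := Real.smoothTransition.le_one (2 / ε ^ 2 * s - 1)
  have h3 := Real.smoothTransition.nonneg (4 * s - 1)
  have h4 := Real.smoothTransition.le_one (4 * s - 1)
  rw [ramp, abs_le]
  constructor <;> linarith

section

variable {ε : ℝ}

theorem ramp_of_small (hε : 0 < ε) (hε2 : ε ≤ 1 / 2) {s : ℝ} (hs : s ≤ ε ^ 2 / 2) : ramp ε s = 0 := by
  rw [ramp, Real.smoothTransition.zero_of_nonpos, Real.smoothTransition.zero_of_nonpos, sub_zero]
  · nlinarith
  · rw [div_mul_eq_mul_div, sub_nonpos, div_le_one (by positivity)]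
    linarith

theorem ramp_of_large (hε : 0 < ε) (hε2 : ε ≤ 1 / 2) {s : ℝ} (hs : 1 / 2 ≤ s) : ramp ε s = 0 := by
  rw [ramp, Real.smoothTransition.one_of_one_le, Real.smoothTransition.one_of_one_le, sub_self]
  · linarith
  · have : 2 ≤ 2 / ε ^ 2 * s := by
      rw [div_mul_eq_mul_div, le_div_iff₀ (by positivity)]
      nlinarith
    linarith

theorem contDiff_radialField (hε : 0 < ε) (hε2 : ε ≤ 1 / 2) :
    ContDiff ℝ (⊤ : ℕ∞) (radialField ε) := by
  rw [contDiff_iff_contDiffAt]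
  intro x
  by_cases hx : x = 0
  · have e : radialField ε =ᶠ[𝓝 x] fun _ => 0 := by
      have hc : Continuous fun y : Plane => ‖y‖ ^ 2 := by fun_prop
      have : ∀ᶠ y in 𝓝 x, ‖y‖ ^ 2 < ε ^ 2 / 2 :=
        hc.continuousAt.eventually_lt_const (by simp [hx]; positivity)
      filter_upwards [this] with y hy
      rw [radialField, ramp_of_small hε hε2 hy.le]
      simp
    exact contDiffAt_const.congr_of_eventuallyEq e
  · have hr : ContDiff ℝ (⊤ : ℕ∞) (ramp ε) :=
      (Real.smoothTransition.contDiff.comp (by fun_prop)).sub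
        (Real.smoothTransition.contDiff.comp (by fun_prop))
    exact ((hr.comp (contDiff_norm_sq ℝ)).contDiffAt.mul (contDiffAt_quadrant hx)).mul
      ((contDiff_norm_sq ℝ).contDiffAt.inv (by simpa using hx))

theorem radialField_eq_zero (hε : 0 < ε) (hε2 : ε ≤ 1 / 2) {x : Plane} (hx : 1 ≤ ‖x‖) :
    radialField ε x = 0 := by
  rw [radialField, ramp_of_large hε hε2 (by nlinarith)]
  simp

theorem hasCompactSupport_radialField (hε : 0 < ε) (hε2 : ε ≤ 1 / 2) :
    HasCompactSupport (radialField ε) := by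
  refine HasCompactSupport.of_support_subset_isCompact (isCompact_closedBall (0 : Plane) 1) ?_
  intro x hx
  by_contra h
  exact hx (radialField_eq_zero hε hε2 (not_le.1 (by simpa using h)).le)

/-- Differentiate along the ray `t ↦ t • x` at `t = 1`. The angular factor is constant on rays, and
in dimension two the derivative of `‖x‖⁻²` cancels the term `2 * radialField`. -/
theorem fderiv_radialField_self (hε : 0 < ε) (hε2 : ε ≤ 1 / 2) (x : Plane) :
    fderiv ℝ (radialField ε) x x + 2 * radialField ε x =
      2 * rampDeriv ε (‖x‖ ^ 2) * quadrant x := by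
  by_cases hx : x = 0
  · subst hx
    have h : ¬(0 < (0 : Plane) 0 ∧ 0 < (0 : Plane) 1) := by simp
    simp [radialField, quadrant_eq_zero h]
  · have hn : ‖x‖ ^ 2 ≠ 0 := pow_ne_zero 2 (norm_ne_zero_iff.2 hx)
    have hd := ((contDiff_radialField hε hε2).differentiable (by simp) ((1 : ℝ) • x)).hasFDerivAt
    have hline : HasDerivAt (fun t : ℝ => t • x) ((1 : ℝ) • x) 1 := (hasDerivAt_id 1).smul_const x
    have h1 := hd.comp_hasDerivAt (1 : ℝ) hline
    rw [one_smul] at h1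
    have e : (radialField ε ∘ fun t : ℝ => t • x) =ᶠ[𝓝 1]
        fun t => ramp ε (t ^ 2 * ‖x‖ ^ 2) * quadrant x * (t ^ 2 * ‖x‖ ^ 2)⁻¹ := by
      filter_upwards [Ioi_mem_nhds (zero_lt_one' ℝ)] with t ht
      simp only [Function.comp_apply, radialField, quadrant_smul ht, norm_smul, mul_pow,
        Real.norm_eq_abs, sq_abs]
    have hs : HasDerivAt (fun t : ℝ => t ^ 2 * ‖x‖ ^ 2) (2 * ‖x‖ ^ 2) 1 := by
      simpa using (hasDerivAt_pow 2 (1 : ℝ)).mul_const (‖x‖ ^ 2)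
    have hr : HasDerivAt (ramp ε) (rampDeriv ε (‖x‖ ^ 2)) ((1 : ℝ) ^ 2 * ‖x‖ ^ 2) := by
      simpa using hasDerivAt_ramp ε (‖x‖ ^ 2)
    have h2 := ((hr.comp (1 : ℝ) hs).mul_const (quadrant x)).mul (hs.inv (by simpa using hx))
    have h3 := (h2.congr_of_eventuallyEq e).unique h1
    rw [← h3, radialField]
    simp only [Function.comp_apply, Pi.inv_apply, one_pow, one_mul]
    field_simp
    ring

/-- The divergence of the radial field. -/
def radialDiv (ε : ℝ) (x : Plane) : ℝ := 2 * rampDeriv ε (‖x‖ ^ 2) * quadrant x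

theorem fderiv_radialField_coord (hε : 0 < ε) (hε2 : ε ≤ 1 / 2) (x : Plane) :
    ∑ i : Fin 2, fderiv ℝ (fun y => y i * radialField ε y) x (EuclideanSpace.single i 1) =
      radialDiv ε x := by
  have hd := (contDiff_radialField hε hε2).differentiable (by simp) x
  have hi : ∀ i : Fin 2, fderiv ℝ (fun y : Plane => y i * radialField ε y) x
      (EuclideanSpace.single i 1) =
      x i * fderiv ℝ (radialField ε) x (EuclideanSpace.single i 1) + radialField ε x := fun i => by
    have hp : HasFDerivAt (fun y : Plane => y i) (EuclideanSpace.proj i : Plane →L[ℝ] ℝ) x :=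
      (EuclideanSpace.proj (𝕜 := ℝ) i).hasFDerivAt
    rw [show fderiv ℝ (fun y : Plane => y i * radialField ε y) x = _ from
      (hp.mul hd.hasFDerivAt).fderiv]
    simp
  have hx : x = x 0 • EuclideanSpace.single (0 : Fin 2) (1 : ℝ) +
      x 1 • EuclideanSpace.single (1 : Fin 2) (1 : ℝ) := by
    ext i
    fin_cases i <;> simp
  rw [radialDiv, ← fderiv_radialField_self hε hε2 x, Fin.sum_univ_two, hi, hi]
  have : fderiv ℝ (radialField ε) x x =
      x 0 * fderiv ℝ (radialField ε) x (EuclideanSpace.single 0 1) +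
      x 1 * fderiv ℝ (radialField ε) x (EuclideanSpace.single 1 1) := by
    have := congrArg (fderiv ℝ (radialField ε) x) hx
    rwa [map_add, map_smul, map_smul] at this
  rw [this]
  ring

theorem coord_mul_radialField_mem (hε : 0 < ε) (hε2 : ε ≤ 1 / 2) (i : Fin 2) :
    (fun y : Plane => y i * radialField ε y) ∈ TestFunctions :=
  TestFunctions.mul (EuclideanSpace.proj (𝕜 := ℝ) i).contDiff
    ⟨contDiff_radialField hε hε2, hasCompactSupport_radialField hε hε2⟩

theorem continuous_radialDiv (hε : 0 < ε) (hε2 : ε ≤ 1 / 2) : Continuous (radialDiv ε) := by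
  have : radialDiv ε = fun x => ∑ i : Fin 2,
      fderiv ℝ (fun y => y i * radialField ε y) x (EuclideanSpace.single i 1) :=
    funext fun x => (fderiv_radialField_coord hε hε2 x).symm
  rw [this]
  exact continuous_finsetSum _ fun i _ =>
    continuous_partial (TestFunctions.contDiff (coord_mul_radialField_mem hε hε2 i)) _

/-- Here only the rising edge of the ramp contributes, and beyond radius `ε` only the falling edge.
The falling edge does not depend on `ε`, which makes the capacity bound uniform in the
neighbourhood. -/
theorem radialDiv_of_le (hε : 0 < ε) {x : Plane} (hx : ‖x‖ ≤ 1 / 2) :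
    0 ≤ radialDiv ε x ∧ outerDiv x = 0 := by
  have h : deriv Real.smoothTransition (4 * ‖x‖ ^ 2 - 1) = 0 :=
    deriv_smoothTransition_of_nonpos (by nlinarith [norm_nonneg x])
  rw [radialDiv, rampDeriv, outerDiv, h]
  have := deriv_smoothTransition_nonneg (2 / ε ^ 2 * ‖x‖ ^ 2 - 1)
  have := quadrant_nonneg x
  constructor
  · rw [zero_mul, sub_zero]
    positivity
  · ring

theorem radialDiv_of_ge (hε : 0 < ε) {x : Plane} (hx : ε ≤ ‖x‖) :
    radialDiv ε x = -outerDiv x := by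
  have h : deriv Real.smoothTransition (2 / ε ^ 2 * ‖x‖ ^ 2 - 1) = 0 := by
    refine deriv_smoothTransition_of_one_le ?_
    have : 2 ≤ 2 / ε ^ 2 * ‖x‖ ^ 2 := by
      rw [div_mul_eq_mul_div, le_div_iff₀ (by positivity)]
      gcongr
    linarith
  rw [radialDiv, rampDeriv, outerDiv, h]
  ring

theorem outerDiv_nonneg (x : Plane) : 0 ≤ outerDiv x :=
  mul_nonneg (mul_nonneg (by norm_num) (deriv_smoothTransition_nonneg _)) (quadrant_nonneg x)

/-- As the negative part of a continuous function, `outerDiv` is continuous also at the origin,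
where `quadrant` is not. -/
theorem outerDiv_eq (hε : 0 < ε) (hε2 : ε ≤ 1 / 2) (x : Plane) :
    outerDiv x = max (-radialDiv ε x) 0 := by
  rcases le_total ‖x‖ (1 / 2) with hx | hx
  · obtain ⟨h1, h2⟩ := radialDiv_of_le hε hx
    rw [h2, max_eq_right (by linarith)]
  · rw [radialDiv_of_ge hε (hε2.trans hx), neg_neg, max_eq_left (outerDiv_nonneg x)]

theorem continuous_outerDiv : Continuous outerDiv := by
  rw [funext (outerDiv_eq (ε := 1 / 2) (by norm_num) le_rfl)]
  exact (continuous_radialDiv (by norm_num) le_rfl).neg.max continuous_const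

theorem outerDiv_eq_zero {x : Plane} (hx : 1 ≤ ‖x‖) : outerDiv x = 0 := by
  rw [outerDiv, deriv_smoothTransition_of_one_le (by nlinarith)]
  ring

theorem hasCompactSupport_outerDiv : HasCompactSupport outerDiv := by
  refine HasCompactSupport.of_support_subset_isCompact (isCompact_closedBall (0 : Plane) 1) ?_
  intro x hx
  by_contra h
  exact hx (outerDiv_eq_zero (not_le.1 (by simpa using h)).le)

theorem integral_outerDiv_pos : 0 < ∫ x, outerDiv x := by
  -- The mean value theorem provides a `t` where the derivative is `1`; the point on the diagonal
  -- with `4‖x‖² - 1 = t` has both coordinates `√((t + 1) / 8)`.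
  obtain ⟨t, ht, hdt⟩ := exists_deriv_eq_slope Real.smoothTransition zero_lt_one
    Real.smoothTransition.continuous.continuousOn
    (fun t _ => (hasDerivAt_smoothTransition t).differentiableAt.differentiableWithinAt)
  rw [Real.smoothTransition.zero, Real.smoothTransition.one] at hdt
  set r := √((t + 1) / 8) with hr
  have hr2 : r ^ 2 = (t + 1) / 8 := Real.sq_sqrt (by linarith [ht.1])
  have hr0 : 0 < r := Real.sqrt_pos.2 (by linarith [ht.1])
  refine continuous_outerDiv.integral_pos_of_hasCompactSupport_nonneg_nonzero
    hasCompactSupport_outerDiv outerDiv_nonneg (x := !₂[r, r]) ?_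
  have hn : ‖(!₂[r, r] : Plane)‖ ^ 2 = (t + 1) / 4 := by
    rw [norm_sq_plane]
    simp [hr2]
    ring
  have hn0 : 0 < ‖(!₂[r, r] : Plane)‖⁻¹ := by
    rw [inv_pos, norm_pos_iff]
    intro h
    rw [h] at hn
    simp at hn
    linarith [ht.1]
  have hp := Real.smoothTransition.pos_of_pos (mul_pos hr0 hn0)
  rw [outerDiv, hn, show 4 * ((t + 1) / 4) - 1 = t by ring, hdt]
  refine mul_ne_zero (by norm_num) (mul_pos ?_ ?_).ne'
  · simpa using hp
  · simpa using hp

theorem HasWeakGradient.integral_mul_radialDiv {f : Plane → ℝ} {g : Plane → Plane}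
    (h : HasWeakGradient f g) (hε : 0 < ε) (hε2 : ε ≤ 1 / 2) :
    ∫ x, f x * radialDiv ε x = -∫ x, radialField ε x * inner ℝ x (g x) := by
  have hmem := coord_mul_radialField_mem hε hε2
  have e1 : ∀ x, f x * radialDiv ε x = ∑ i : Fin 2,
      f x * fderiv ℝ (fun y => y i * radialField ε y) x (EuclideanSpace.single i 1) := fun x => by
    rw [← fderiv_radialField_coord hε hε2, Finset.mul_sum]
  have e2 : ∀ x, radialField ε x * inner ℝ x (g x) =
      ∑ i : Fin 2, g x i * (x i * radialField ε x) := fun x => by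
    rw [PiLp.inner_apply, Finset.mul_sum]
    refine Finset.sum_congr rfl fun i _ => ?_
    simp
    ring
  simp only [e1, e2]
  rw [integral_finsetSum _ fun i _ => h.integrable_mul_partial (hmem i) _,
    integral_finsetSum _ fun i _ => h.integrable_coord_mul (hmem i) i, ← Finset.sum_neg_distrib]
  exact Finset.sum_congr rfl fun i _ => h.2.2 _ (hmem i) i

/-- The field has total divergence zero, so the outflow `∫ outerDiv` equals the inner divergence,
which is nonnegative and supported where `f ≥ 1`. Weighting it with `f` only increases it, and
integration by parts turns the weighted integral into the pairing with `g`. -/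
theorem integral_outerDiv_le {f : Plane → ℝ} {g : Plane → Plane} (h : HasWeakGradient f g)
    (hε : 0 < ε) (hε2 : ε ≤ 1 / 2)
    (h1 : ∀ᵐ x : Plane, 0 < x 0 → 0 < x 1 → ‖x‖ < ε → 1 ≤ f x) :
    ∫ x, outerDiv x ≤ (∫ x, f x * outerDiv x) - ∫ x, radialField ε x * inner ℝ x (g x) := by
  have hc := continuous_radialDiv hε hε2
  have hz : ∀ x : Plane, 1 ≤ ‖x‖ → radialDiv ε x = 0 := fun x hx => by
    rw [radialDiv_of_ge hε (by linarith), outerDiv_eq_zero hx, neg_zero]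
  have hcs : HasCompactSupport (radialDiv ε) := by
    refine HasCompactSupport.of_support_subset_isCompact (isCompact_closedBall (0 : Plane) 1) ?_
    intro x hx
    by_contra h
    exact hx (hz x (not_le.1 (by simpa using h)).le)
  have i1 := integrable_mul_of_hasCompactSupport h.1 hc hcs
  have i2 := integrable_mul_of_hasCompactSupport h.1 continuous_outerDiv hasCompactSupport_outerDiv
  have i3 : Integrable (radialDiv ε) := hc.integrable_of_hasCompactSupport hcs
  have i4 : Integrable outerDiv :=
    continuous_outerDiv.integrable_of_hasCompactSupport hasCompactSupport_outerDiv
  -- The divergence theorem, read off from the integration by parts against the constant `1`.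
  have z : ∫ x, radialDiv ε x = 0 := by
    have h0 : HasWeakGradient (fun _ : Plane => (1 : ℝ)) (fun _ => 0) :=
      (HasWeakGradient.of_contDiff contDiff_const).congr (ae_eq_refl _)
        (ae_of_all _ fun x => by simp [gradient])
    simpa using h0.integral_mul_radialDiv hε hε2
  have e := h.integral_mul_radialDiv hε hε2
  have mono : ∫ x, (radialDiv ε x + outerDiv x) ≤ ∫ x, (f x * radialDiv ε x + f x * outerDiv x) := by
    refine integral_mono_ae (i3.add i4) (i1.add i2) ?_
    filter_upwards [h1] with x hx
    by_cases hxε : ‖x‖ < ε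
    · obtain ⟨p1, p2⟩ := radialDiv_of_le hε (x := x) (by linarith)
      by_cases hq : 0 < x 0 ∧ 0 < x 1
      · simp only [p2]
        nlinarith [hx hq.1 hq.2 hxε]
      · simp [radialDiv, outerDiv, quadrant_eq_zero hq]
    · simp [radialDiv_of_ge hε (not_lt.1 hxε)]
  rw [integral_add i3 i4, integral_add i1 i2, z, e] at mono
  linarith

end

namespace IsSplitWeight

variable {ρ : Plane → ℝ≥0∞}

/-- The field has length at most `1/‖x‖` and lives in the first quadrant, where `1/‖x‖` belongs to
`L²(1/ρ)`. Weighted Cauchy–Schwarz bounds the fixed positive number `∫ outerDiv` by `C` times the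
square root of the energy, with `C` free of `f` and `ε`. -/
theorem exists_lower_bound (hρ : IsSplitWeight ρ) :
    ∃ κ : ℝ≥0∞, 0 < κ ∧ ∀ (f : Plane → ℝ) (g : Plane → Plane) (ε : ℝ), HasWeakGradient f g →
      0 < ε → ε ≤ 1 / 2 → (∀ᵐ x : Plane, 0 < x 0 → 0 < x 1 → ‖x‖ < ε → 1 ≤ f x) →
      κ ≤ sobolevEnergy (volume.withDensity ρ) f g := by
  set Q : Set Plane := {x : Plane | ‖x‖ < 1 ∧ 0 < x 0 * x 1} with hQ
  have hm0 : Measurable fun x : Plane => x 0 * x 1 := by fun_prop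
  have hQm : MeasurableSet Q := (measurableSet_lt measurable_norm measurable_const).inter
    (measurableSet_lt measurable_const hm0)
  -- One majorant for both terms: in the unit ball `1 ≤ 1/‖x‖`, so it also absorbs the bounded
  -- function `outerDiv`.
  let m : Plane → ℝ≥0∞ := Q.indicator fun x => (ENNReal.ofReal ‖x‖)⁻¹
  have hm : Measurable m := Measurable.indicator (by fun_prop) hQm
  have hM : ∫⁻ x, m x ^ 2 * (ρ x)⁻¹ < ⊤ := by
    refine lt_of_eq_of_lt ?_ hρ.lintegral_inv_div_sq
    rw [← lintegral_indicator hQm]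
    refine lintegral_congr fun x => ?_
    by_cases hx : x ∈ Q
    · simp only [m, indicator_of_mem hx]
      rw [ENNReal.ofReal_pow (norm_nonneg _), ENNReal.inv_pow, mul_comm]
    · simp [m, hx]
  have hL := stepBound_pos
  set C : ℝ≥0∞ := (ENNReal.ofReal (8 * stepBound) + 1) *
    (∫⁻ x, m x ^ 2 * (ρ x)⁻¹) ^ (1 / 2 : ℝ) with hC
  have hCt : C ≠ ⊤ := ENNReal.mul_ne_top
    (ENNReal.add_ne_top.2 ⟨ENNReal.ofReal_ne_top, ENNReal.one_ne_top⟩)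
    (ENNReal.rpow_lt_top_of_nonneg (by norm_num) hM.ne).ne
  have hc0 : ENNReal.ofReal (∫ x, outerDiv x) ≠ 0 := by
    simpa using integral_outerDiv_pos
  have bound : ∀ {E : Type} [NormedAddCommGroup E] {F : Plane → E}, AEStronglyMeasurable F →
      ∀ {T : ℝ≥0∞}, ∫⁻ x, ‖F x‖ₑ ^ 2 ∂(volume.withDensity ρ) ≤ T →
      ∫⁻ x, ‖F x‖ₑ * m x ≤ T ^ (1 / 2 : ℝ) * (∫⁻ x, m x ^ 2 * (ρ x)⁻¹) ^ (1 / 2 : ℝ) := by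
    intro E _ F hF T hT
    refine (hρ.lintegral_mul_le hF.enorm hm.aemeasurable).trans ?_
    gcongr
  refine ⟨(ENNReal.ofReal (∫ x, outerDiv x) / C) ^ 2,
    ENNReal.pow_pos (ENNReal.div_pos hc0 hCt) 2, fun f g ε h hε hε2 h1 => ?_⟩
  set T := sobolevEnergy (volume.withDensity ρ) f g
  have hx0 : ∀ x : Plane, quadrant x ≠ 0 → x ≠ 0 ∧ 0 < x 0 * x 1 := fun x hx => by
    have : 0 < x 0 ∧ 0 < x 1 := by
      by_contra hcon
      exact hx (quadrant_eq_zero hcon)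
    have hp := mul_pos this.1 this.2
    exact ⟨by rintro rfl; simp at hp, hp⟩
  have b1 : ∀ x, ‖f x * outerDiv x‖ₑ ≤ ENNReal.ofReal (8 * stepBound) * (‖f x‖ₑ * m x) := by
    intro x
    by_cases hx : x ∈ Q
    · simp only [m, indicator_of_mem hx]
      rw [enorm_mul, mul_left_comm]
      gcongr
      have hn1 : (1 : ℝ≥0∞) ≤ (ENNReal.ofReal ‖x‖)⁻¹ :=
        ENNReal.one_le_inv.2 (ENNReal.ofReal_le_one.2 hx.1.le)
      refine le_trans ?_ (le_mul_of_one_le_right' hn1)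
      rw [← ofReal_norm]
      refine ENNReal.ofReal_le_ofReal ?_
      rw [Real.norm_eq_abs, abs_of_nonneg (outerDiv_nonneg x), outerDiv]
      have := abs_deriv_smoothTransition_le (4 * ‖x‖ ^ 2 - 1)
      rw [abs_of_nonneg (deriv_smoothTransition_nonneg _)] at this
      calc _ ≤ 8 * stepBound * 1 := by
            gcongr
            · exact quadrant_nonneg x
            · exact quadrant_le_one x
        _ = _ := mul_one _
    · have : outerDiv x = 0 := by
        rcases le_or_gt 1 ‖x‖ with hn | hn
        · exact outerDiv_eq_zero hn
        · rw [outerDiv]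
          by_cases hq : quadrant x = 0
          · rw [hq, mul_zero]
          · exact absurd ⟨hn, (hx0 x hq).2⟩ hx
      simp [this]
  have b2 : ∀ x, ‖radialField ε x * inner ℝ x (g x)‖ₑ ≤ ‖g x‖ₑ * m x := by
    intro x
    by_cases hx : x ∈ Q
    · have hxn : 0 < ‖x‖ := by
        rw [norm_pos_iff]
        rintro rfl
        simpa using hx.2
      simp only [m, indicator_of_mem hx]
      rw [← ENNReal.ofReal_inv_of_pos hxn, ← ofReal_norm, ← ofReal_norm,
        ← ENNReal.ofReal_mul (norm_nonneg _)]
      refine ENNReal.ofReal_le_ofReal ?_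
      have hin : |inner ℝ x (g x)| ≤ ‖x‖ * ‖g x‖ := abs_real_inner_le_norm x (g x)
      have hr := abs_ramp_le_one ε (‖x‖ ^ 2)
      rw [norm_mul, Real.norm_eq_abs, Real.norm_eq_abs, radialField, abs_mul, abs_mul,
        abs_of_nonneg (quadrant_nonneg x), abs_of_nonneg (by positivity : 0 ≤ (‖x‖ ^ 2)⁻¹)]
      calc _ ≤ 1 * 1 * (‖x‖ ^ 2)⁻¹ * (‖x‖ * ‖g x‖) := by
            gcongr
            · exact quadrant_nonneg x
            · exact quadrant_le_one x
        _ = _ := by field_simp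
    · have : radialField ε x = 0 := by
        rcases le_or_gt 1 ‖x‖ with hn | hn
        · exact radialField_eq_zero hε hε2 hn
        · rw [radialField]
          by_cases hq : quadrant x = 0
          · rw [hq]; simp
          · exact absurd ⟨hn, (hx0 x hq).2⟩ hx
      simp [this]
  have key : ENNReal.ofReal (∫ x, outerDiv x) ≤ C * T ^ (1 / 2 : ℝ) := by
    calc ENNReal.ofReal (∫ x, outerDiv x)
        ≤ ENNReal.ofReal ((∫ x, f x * outerDiv x) - ∫ x, radialField ε x * inner ℝ x (g x)) :=
          ENNReal.ofReal_le_ofReal (integral_outerDiv_le h hε hε2 h1)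
      _ ≤ ‖(∫ x, f x * outerDiv x) - ∫ x, radialField ε x * inner ℝ x (g x)‖ₑ := by
          rw [← ofReal_norm]
          exact ENNReal.ofReal_le_ofReal (le_abs_self _)
      _ ≤ ‖∫ x, f x * outerDiv x‖ₑ + ‖∫ x, radialField ε x * inner ℝ x (g x)‖ₑ :=
          enorm_sub_le
      _ ≤ ENNReal.ofReal (8 * stepBound) * (∫⁻ x, ‖f x‖ₑ * m x) + ∫⁻ x, ‖g x‖ₑ * m x := by
          refine add_le_add ((enorm_integral_le_lintegral_enorm _).trans ?_)
            ((enorm_integral_le_lintegral_enorm _).trans (lintegral_mono b2))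
          rw [← lintegral_const_mul' _ _ ENNReal.ofReal_ne_top]
          exact lintegral_mono b1
      _ ≤ ENNReal.ofReal (8 * stepBound) * (T ^ (1 / 2 : ℝ) *
            (∫⁻ x, m x ^ 2 * (ρ x)⁻¹) ^ (1 / 2 : ℝ)) +
            T ^ (1 / 2 : ℝ) * (∫⁻ x, m x ^ 2 * (ρ x)⁻¹) ^ (1 / 2 : ℝ) := by
          gcongr
          · exact bound h.1.aestronglyMeasurable le_add_self
          · exact bound h.2.1.aestronglyMeasurable le_self_add
      _ = C * T ^ (1 / 2 : ℝ) := by rw [hC]; ring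
  have h2 : ENNReal.ofReal (∫ x, outerDiv x) / C ≤ T ^ (1 / 2 : ℝ) :=
    ENNReal.div_le_of_le_mul' key
  calc _ ≤ (T ^ (1 / 2 : ℝ)) ^ 2 := by gcongr
    _ = T := by
      rw [← ENNReal.rpow_natCast, ← ENNReal.rpow_mul]
      norm_num

end IsSplitWeight

/-- On the first quadrant `psi = 1`, so inside the unit ball a point `x` there is at distance `‖x‖ +
‖x‖²` from `plus`. Every neighbourhood of `plus` thus contains the open first quadrant of a small
ball. -/
theorem capW_plus_pos {a : ℝ → ℝ≥0∞} (ha : IsAdmissible a) : 0 < capW a {SplitPlane.plus} := by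
  obtain ⟨κ, hκ, hmain⟩ := ha.isSplitWeight.exists_lower_bound
  refine hκ.trans_le (not_lt.1 fun hcon => ?_)
  obtain ⟨A, f, g, hA, h0, h, hE, hlt, h1⟩ := exists_of_capW_lt ha hcon
  obtain ⟨δ, hδ, hball⟩ := Metric.isOpen_iff.1 hA _ (h0 rfl)
  set ε := min (δ / 2) (1 / 2) with hε
  have hε0 : 0 < ε := by positivity
  have hε1 : ε ≤ δ / 2 := min_le_left _ _
  have hε2 : ε ≤ 1 / 2 := min_le_right _ _
  refine absurd hlt (not_lt.2 (hmain f g ε h hε0 hε2 ?_))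
  filter_upwards [h1] with x hx hx0 hx1 hxn
  have hne : x ≠ 0 := by
    rintro rfl
    simp at hx0
  refine hx hne (hball ?_)
  have hpsi : psi x = 1 := by rw [psi, if_pos hx0.le, if_pos hx1.le]
  have hn0 := norm_nonneg x
  rw [Metric.mem_ball, SplitPlane.dist_def, psiZero_punctured hne (by linarith), hpsi]
  have r1 : ‖x - (0 : Plane)‖ = ‖x‖ := by simp
  show ‖x - (0 : Plane)‖ + |(1 - ‖x‖ ^ 2) * 1 - 1| < δ
  have r2 : |(1 - ‖x‖ ^ 2) * 1 - 1| = ‖x‖ ^ 2 := by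
    rw [mul_one, sub_sub_cancel_left, abs_neg, abs_of_nonneg (sq_nonneg _)]
  rw [r1, r2]
  nlinarith

end

end Zhikov

theorem mainTheorem8 (a : ℝ → ENNReal) (ha : Zhikov.IsAdmissible a) :
    Zhikov.capW a Zhikov.arcSet = 0 ∧
    Zhikov.capW a {Zhikov.SplitPlane.plus, Zhikov.SplitPlane.minus} = Zhikov.capH a {0} ∧
    Zhikov.capW a {Zhikov.SplitPlane.plus} = Zhikov.capW a {Zhikov.SplitPlane.minus} ∧
    0 < Zhikov.capW a {Zhikov.SplitPlane.plus} :=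
  ⟨Zhikov.capW_arcSet ha, le_antisymm (Zhikov.capW_le_capH ha) (Zhikov.capH_le_capW ha),
    le_antisymm (Zhikov.capW_plus_le_minus ha) (Zhikov.capW_minus_le_plus ha),
    Zhikov.capW_plus_pos ha⟩
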